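/- Every masked unique hard-attention transformer (UHAT) over the rationals can be translated in exponential time into an LTL formula of exponential size that recognizes the same language. Definitions. Words over a finite alphabet $\Sigma=\{0,\dots,k-1\}$ have positions $1,\dots,n$. LTL formulas over $\Sigma$ are built from $\top$, $\bot$, $Q_a$ ($a\in\Sigma$), $\wedge$, $\vee$, $\neg$, since ($\mathsf S$) and until ($\mathsf U$), where $w,i\models\varphi\,\mathsf S\,\psi$ iff there is $j<i$ with $w,j\models\psi$ and $w,l\models\varphi$ for all $j<l<i$, and $w,i\models\varphi\,\mathsf U\,\psi$ iff there is $j>i$ with $w,j\models\psi$ and $w,l\models\varphi$ for all $i<l<j$. A UHAT $\mathcal T$ over $\Sigma$ consists of a token embedding $\Sigma\to\mathbb Q^d$ ($d>0$), a finite sequence of layers of matching widths, an acceptance vector $\boldsymbol t\in\mathbb Q^s$, and an output position (first or last). Each layer is either a ReLU layer, applying $x\mapsto\max\{0,x\}$ to one fixed coordinate at every position, or an attention layer of width $r>0$, given by rational affine maps $A,B:\mathbb Q^r\to\mathbb Q^r$ and $C:\mathbb Q^{2r}\to\mathbb Q^{m}$, a mask (at position $i$ the unmasked positions $j$ are all $j$,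 those with $j<i$, or those with $j>i$), and a tie-breaking rule (leftmost or rightmost). The attention layer maps $\boldsymbol v_1,\dots,\boldsymbol v_n$ to $C(\boldsymbol v_1,\boldsymbol a_1),\dots,C(\boldsymbol v_n,\boldsymbol a_n)$, where $\boldsymbol a_i=\boldsymbol v_j$ for the leftmost (rightmost) unmasked position $j$ that maximizes $\langle A\boldsymbol v_i,B\boldsymbol v_j\rangle$ among the unmasked positions, and $\boldsymbol a_i=\boldsymbol 0$ if no position is unmasked. $L(\mathcal T)$ is the set of non-empty words on which the output vector $\boldsymbol v$ at the output position satisfies $\langle\boldsymbol t,\boldsymbol v\rangle>0$; the language of an LTL formula with a given output position is the set of non-empty words that satisfy it at that position. Sizes $|\mathcal T|$ and $|\varphi|$ are the lengths of the usual binary encodings (rationals written in binary; the encoding of $\mathcal T$ includes the alphabet and the output position). Theorem. There are a Turing machine $M$ and a polynomial $p$ such that for every finite alphabet $\Sigma$ and every UHAT $\mathcal T$ over $\Sigma$ there is an LTL formula $\varphi$ over $\Sigma$ which, with the output position of $\mathcal T$, recognizes $L(\mathcal T)$, which has size $|\varphi|\le 2^{p(|\mathcal T|)}$, and whose encoding is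 output by $M$ on input the encoding of $\mathcal T$ within at most $2^{p(|\mathcal T|)}$ steps. -/

import Mathlib

open Matrix

/-! ### Output positions -/

/-- The position of a word at which acceptance is decided: the first or the last one. -/
inductive OutputPos
  | first
  | last

/-- The output position (counted from `0`) in a non-empty word of length `n`. -/
def OutputPos.index : OutputPos → (n : ℕ) → 0 < n → Fin n
  | .first, _, h => ⟨0, h⟩
  | .last, n, h => ⟨n - 1, Nat.sub_lt h Nat.one_pos⟩

/-! ### Linear temporal logic on finite words -/

/-- Syntax of LTL formulas over the alphabet `α`, with the past modality since and the future
modality until. -/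
inductive LTL (α : Type)
  | top
  | bot
  | atom (a : α)
  | and (φ ψ : LTL α)
  | or (φ ψ : LTL α)
  | not (φ : LTL α)
  | sinceOp (φ ψ : LTL α)
  | untilOp (φ ψ : LTL α)

namespace LTL

variable {α : Type}

/-- `φ.Sat w i` says that the word `w` satisfies `φ` at position `i` (counted from `0`); since and
until are strict. -/
def Sat (w : List α) : LTL α → Fin w.length → Prop
  | top, _ => True
  | bot, _ => False
  | atom a, i => w.get i = a
  | and φ ψ, i => Sat w φ i ∧ Sat w ψ i
  | or φ ψ, i => Sat w φ i ∨ Sat w ψ i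
  | not φ, i => ¬ Sat w φ i
  | sinceOp φ ψ, i => ∃ j, j < i ∧ Sat w ψ j ∧ ∀ k, j < k → k < i → Sat w φ k
  | untilOp φ ψ, i => ∃ j, i < j ∧ Sat w ψ j ∧ ∀ k, i < k → k < j → Sat w φ k

/-- The language recognized by a formula with a given output position. The empty word has no
position, hence is never accepted. -/
def language (φ : LTL α) (o : OutputPos) : Language α :=
  {w | ∃ h : 0 < w.length, φ.Sat w (o.index w.length h)}

end LTL

/-! ### Masked unique hard-attention transformers -/

/-- An affine transformation `x ↦ Q x + b` from `ℚ^m` to `ℚ^n`. -/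
structure QAffine (m n : ℕ) where
  mat : Matrix (Fin n) (Fin m) ℚ
  bias : Fin n → ℚ

/-- Evaluation of an affine transformation. -/
def QAffine.apply {m n : ℕ} (A : QAffine m n) (x : Fin m → ℚ) : Fin n → ℚ :=
  A.mat *ᵥ x + A.bias

/-- The mask predicates: no masking, strict future masking, strict past masking. -/
inductive Mask
  | none
  | future
  | past

/-- `M.Allows i j` says that position `j` is unmasked at position `i`. -/
def Mask.Allows {n : ℕ} : Mask → Fin n → Fin n → Prop
  | .none, _, _ => True
  | .future, i, j => j < i
  | .past, i, j => i < j

/-- The tie-breaking functions. -/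
inductive TieBreak
  | leftmost
  | rightmost

/-- The element selected by a tie-breaking function from a non-empty finite set. -/
def TieBreak.select {n : ℕ} : TieBreak → (B : Finset (Fin n)) → B.Nonempty → Fin n
  | .leftmost, B, h => B.min' h
  | .rightmost, B, h => B.max' h

/-- A masked unique hard-attention layer of width `r` with outputs of dimension `s`. -/
structure AttentionLayer (r s : ℕ) where
  A : QAffine r r
  B : QAffine r r
  C : QAffine (r + r) s
  mask : Mask
  tie : TieBreak

namespace AttentionLayer

variable {r s n : ℕ}

/-- The score `⟨A x, B y⟩`. -/
def score (L : AttentionLayer r s) (x y : Fin r → ℚ) : ℚ :=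
  L.A.apply x ⬝ᵥ L.B.apply y

open Classical in
/-- The set of unmasked positions at position `i`. -/
noncomputable def unmasked (L : AttentionLayer r s) (i : Fin n) : Finset (Fin n) :=
  Finset.univ.filter fun j => L.mask.Allows i j

open Classical in
/-- The set of unmasked positions that maximize the score at position `i`. -/
noncomputable def best (L : AttentionLayer r s) (v : Fin n → Fin r → ℚ) (i : Fin n) :
    Finset (Fin n) :=
  (L.unmasked i).filter fun j => ∀ j' ∈ L.unmasked i, L.score (v i) (v j') ≤ L.score (v i) (v j)

theorem best_nonempty (L : AttentionLayer r s) (v : Fin n → Fin r → ℚ) (i : Fin n)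
    (h : (L.unmasked i).Nonempty) : (L.best v i).Nonempty := by
  obtain ⟨j, hj, hmax⟩ := Finset.exists_max_image _ (fun j => L.score (v i) (v j)) h
  exact ⟨j, Finset.mem_filter.2 ⟨hj, hmax⟩⟩

open Classical in
/-- The attention vector at position `i`; it is `0` if every position is masked. -/
noncomputable def attention (L : AttentionLayer r s) (v : Fin n → Fin r → ℚ) (i : Fin n) :
    Fin r → ℚ :=
  if h : (L.unmasked i).Nonempty then v (L.tie.select (L.best v i) (L.best_nonempty v i h)) else 0

/-- The sequence that the layer outputs on the sequence `v`. -/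
noncomputable def run (L : AttentionLayer r s) (v : Fin n → Fin r → ℚ) : Fin n → Fin s → ℚ :=
  fun i => L.C.apply (Fin.append (v i) (L.attention v i))

end AttentionLayer

/-- The ReLU layer of width `r` that applies `x ↦ max 0 x` to coordinate `c` everywhere. -/
def reluRun {r n : ℕ} (c : Fin r) (v : Fin n → Fin r → ℚ) : Fin n → Fin r → ℚ :=
  fun i => Function.update (v i) c (max 0 (v i c))

/-- A sequence of attention layers and ReLU layers of matching width, from dimension `d` to
dimension `s`. The first layer of a non-empty sequence comes first. -/
inductive Layers : ℕ → ℕ → Type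
  | nil {d : ℕ} : Layers d d
  | attention {r m s : ℕ} (hr : 0 < r) (L : AttentionLayer r m) (rest : Layers m s) : Layers r s
  | relu {r s : ℕ} (c : Fin r) (rest : Layers r s) : Layers r s

/-- Application of a sequence of layers to a sequence of vectors. -/
noncomputable def Layers.run {n : ℕ} :
    {d s : ℕ} → Layers d s → (Fin n → Fin d → ℚ) → (Fin n → Fin s → ℚ)
  | _, _, .nil, v => v
  | _, _, .attention _ L rest, v => rest.run (L.run v)
  | _, _, .relu c rest, v => rest.run (reluRun c v)

/-- A masked unique hard-attention transformer over the alphabet of `k` symbols, as a language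
recognizer: a token embedding, a sequence of layers, an acceptance vector, an output position. -/
structure UHAT (k : ℕ) where
  d : ℕ
  d_pos : 0 < d
  emb : Fin k → Fin d → ℚ
  s : ℕ
  layers : Layers d s
  accept : Fin s → ℚ
  out : OutputPos

namespace UHAT

variable {k : ℕ}

/-- The sequence of vectors that the transformer outputs on a word. -/
noncomputable def run (T : UHAT k) (w : List (Fin k)) : Fin w.length → Fin T.s → ℚ :=
  T.layers.run fun i => T.emb (w.get i)

/-- The language recognized by the transformer. The empty word has no output position, hence is
never accepted. -/
def language (T : UHAT k) : Language (Fin k) :=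
  {w | ∃ h : 0 < w.length, 0 < T.accept ⬝ᵥ T.run w (T.out.index w.length h)}

end UHAT

/-! ### Binary encodings and sizes -/

/-- A self-delimiting binary code: a code word can be split off from the front of a bit string in
at most one way. In particular the code is injective. -/
def SelfDelimiting {α : Type} (c : α → List Bool) : Prop :=
  ∀ a b x y, c a ++ x = c b ++ y → a = b ∧ x = y

/-- Natural numbers: the binary digits, least significant first, each preceded by the bit `1`,
followed by the bit `0`. -/
def natCode (n : ℕ) : List Bool :=
  (Nat.bits n).flatMap (fun b => [true, b]) ++ [false]

/-- Rational numbers: the sign, the absolute value of the numerator, and the denominator, in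
lowest terms. -/
def ratCode (q : ℚ) : List Bool :=
  decide (q < 0) :: (natCode q.num.natAbs ++ natCode q.den)

/-- A tuple of known length: the codes of the entries one after the other. -/
def tupleCode {α : Type} {n : ℕ} (c : α → List Bool) (f : Fin n → α) : List Bool :=
  (List.ofFn f).flatMap c

def QAffine.code {m n : ℕ} (A : QAffine m n) : List Bool :=
  tupleCode (tupleCode ratCode) A.mat ++ tupleCode ratCode A.bias

def Mask.code : Mask → List Bool
  | .none => [false]
  | .future => [true, false]
  | .past => [true, true]

def TieBreak.code : TieBreak → List Bool
  | .leftmost => [false]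
  | .rightmost => [true]

def OutputPos.code : OutputPos → List Bool
  | .first => [false]
  | .last => [true]

def AttentionLayer.code {r s : ℕ} (L : AttentionLayer r s) : List Bool :=
  L.A.code ++ (L.B.code ++ (L.C.code ++ (L.mask.code ++ L.tie.code)))

def Layers.code : {d s : ℕ} → Layers d s → List Bool
  | _, _, .nil => [false]
  | _, _, .attention (m := m) _ L rest => true :: true :: (natCode m ++ (L.code ++ rest.code))
  | _, _, .relu c rest => true :: false :: (natCode c ++ rest.code)

/-- The binary encoding of a transformer, including its alphabet. -/
def UHAT.code {k : ℕ} (T : UHAT k) : List Bool :=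
  natCode k ++ (natCode T.d ++ (tupleCode (tupleCode ratCode) T.emb ++
    (T.layers.code ++ (tupleCode ratCode T.accept ++ T.out.code))))

/-- The size of a transformer is the length of its binary encoding. -/
def UHAT.size {k : ℕ} (T : UHAT k) : ℕ := T.code.length

/-- The binary encoding of a formula, in prefix notation. -/
def LTL.code {k : ℕ} : LTL (Fin k) → List Bool
  | .top => [false, false, false]
  | .bot => [false, false, true]
  | .atom a => [false, true, false] ++ natCode a
  | .not φ => [false, true, true] ++ φ.code
  | .and φ ψ => [true, false, false] ++ (φ.code ++ ψ.code)
  | .or φ ψ => [true, false, true] ++ (φ.code ++ ψ.code)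
  | .sinceOp φ ψ => [true, true, false] ++ (φ.code ++ ψ.code)
  | .untilOp φ ψ => [true, true, true] ++ (φ.code ++ ψ.code)

/-- The size of a formula is the length of its binary encoding. -/
def LTL.size {k : ℕ} (φ : LTL (Fin k)) : ℕ := φ.code.length

/-! The encodings determine the encoded objects. -/

theorem natCode_selfDelimiting : SelfDelimiting natCode := by
  have key : ∀ (l l' : List Bool) (x y : List Bool),
      (l.flatMap (fun b => [true, b]) ++ [false]) ++ x =
        (l'.flatMap (fun b => [true, b]) ++ [false]) ++ y → l = l' ∧ x = y := by
    intro l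
    induction l with
    | nil =>
      intro l' x y h
      cases l' with
      | nil => simpa using h
      | cons b l' => simp at h
    | cons b l ih =>
      intro l' x y h
      cases l' with
      | nil => simp at h
      | cons b' l' =>
        simp only [List.flatMap_cons, List.append_assoc, List.cons_append, List.nil_append,
          List.cons.injEq, true_and] at h
        obtain ⟨h1, h2⟩ := ih l' x y (by simpa using h.2)
        exact ⟨by rw [h.1, h1], h2⟩
  intro a b x y h
  obtain ⟨h1, h2⟩ := key _ _ _ _ h
  refine ⟨?_, h2⟩
  have bits_inj : ∀ m n : ℕ, Nat.bits m = Nat.bits n → m = n := by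
    intro m n hmn
    apply Nat.eq_of_testBit_eq
    intro i
    rw [Nat.testBit_eq_inth, Nat.testBit_eq_inth, hmn]
  exact bits_inj _ _ h1

theorem ratCode_selfDelimiting : SelfDelimiting ratCode := by
  intro a b x y h
  simp only [ratCode, List.cons_append, List.append_assoc, List.cons.injEq] at h
  obtain ⟨hs, h⟩ := h
  obtain ⟨hn, h⟩ := natCode_selfDelimiting _ _ _ _ h
  obtain ⟨hd, h⟩ := natCode_selfDelimiting _ _ _ _ h
  refine ⟨Rat.ext ?_ hd, h⟩
  have hs' : a.num < 0 ↔ b.num < 0 := by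
    rw [Rat.num_neg, Rat.num_neg]
    simpa using hs
  omega

theorem tupleCode_selfDelimiting {α : Type} {c : α → List Bool} (hc : SelfDelimiting c) :
    ∀ n : ℕ, SelfDelimiting (tupleCode (n := n) c) := by
  intro n
  induction n with
  | zero =>
    intro f g x y h
    exact ⟨Subsingleton.elim _ _, by simpa [tupleCode] using h⟩
  | succ n ih =>
    intro f g x y h
    simp only [tupleCode, List.ofFn_succ, List.flatMap_cons, List.append_assoc] at h
    obtain ⟨h0, h⟩ := hc _ _ _ _ h
    obtain ⟨h1, h⟩ := ih _ _ _ _ h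
    refine ⟨funext fun i => ?_, h⟩
    induction i using Fin.cases with
    | zero => exact h0
    | succ i => exact congrFun h1 i

theorem QAffine.code_selfDelimiting (m n : ℕ) :
    SelfDelimiting (QAffine.code (m := m) (n := n)) := by
  rintro ⟨M, v⟩ ⟨M', v'⟩ x y h
  simp only [QAffine.code, List.append_assoc] at h
  obtain ⟨h1, h⟩ :=
    tupleCode_selfDelimiting (tupleCode_selfDelimiting ratCode_selfDelimiting m) n _ _ _ _ h
  obtain ⟨h2, h⟩ := tupleCode_selfDelimiting ratCode_selfDelimiting n _ _ _ _ h
  exact ⟨by subst h1; subst h2; rfl, h⟩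

theorem Mask.code_selfDelimiting : SelfDelimiting Mask.code := by
  intro a b x y h
  cases a <;> cases b <;> simp_all [Mask.code]

theorem TieBreak.code_selfDelimiting : SelfDelimiting TieBreak.code := by
  intro a b x y h
  cases a <;> cases b <;> simp_all [TieBreak.code]

theorem OutputPos.code_selfDelimiting : SelfDelimiting OutputPos.code := by
  intro a b x y h
  cases a <;> cases b <;> simp_all [OutputPos.code]

theorem AttentionLayer.code_selfDelimiting (r s : ℕ) :
    SelfDelimiting (AttentionLayer.code (r := r) (s := s)) := by
  rintro ⟨A, B, C, m, t⟩ ⟨A', B', C', m', t'⟩ x y h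
  simp only [AttentionLayer.code, List.append_assoc] at h
  replace h := QAffine.code_selfDelimiting _ _ _ _ _ _ h
  obtain ⟨rfl, h⟩ := h
  replace h := QAffine.code_selfDelimiting _ _ _ _ _ _ h
  obtain ⟨rfl, h⟩ := h
  replace h := QAffine.code_selfDelimiting _ _ _ _ _ _ h
  obtain ⟨rfl, h⟩ := h
  replace h := Mask.code_selfDelimiting _ _ _ _ h
  obtain ⟨rfl, h⟩ := h
  replace h := TieBreak.code_selfDelimiting _ _ _ _ h
  obtain ⟨rfl, h⟩ := h
  exact ⟨rfl, h⟩

theorem Layers.code_selfDelimiting {d s : ℕ} (L : Layers d s) :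
    ∀ {s' : ℕ} (L' : Layers d s') (x y : List Bool),
      L.code ++ x = L'.code ++ y → s = s' ∧ HEq L L' ∧ x = y := by
  induction L with
  | nil =>
    intro s' L' x y h
    cases L' <;> simp_all [Layers.code]
  | attention hr A rest ih =>
    intro s' L' x y h
    cases L' with
    | nil => simp [Layers.code] at h
    | relu c rest' => simp [Layers.code] at h
    | attention hr' A' rest' =>
      simp only [Layers.code, List.cons_append, List.append_assoc, List.cons.injEq,
        true_and] at h
      replace h := natCode_selfDelimiting _ _ _ _ h
      obtain ⟨rfl, h⟩ := h
      replace h := AttentionLayer.code_selfDelimiting _ _ _ _ _ _ h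
      obtain ⟨rfl, h⟩ := h
      replace h := ih _ _ _ h
      obtain ⟨rfl, h1, h⟩ := h
      obtain rfl := eq_of_heq h1
      exact ⟨rfl, HEq.rfl, h⟩
  | relu c rest ih =>
    intro s' L' x y h
    cases L' with
    | nil => simp [Layers.code] at h
    | attention hr' A' rest' => simp [Layers.code] at h
    | relu c' rest' =>
      simp only [Layers.code, List.cons_append, List.append_assoc, List.cons.injEq,
        true_and] at h
      replace h := natCode_selfDelimiting _ _ _ _ h
      rw [← Fin.ext_iff] at h
      obtain ⟨rfl, h⟩ := h
      replace h := ih _ _ _ h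
      obtain ⟨rfl, h1, h⟩ := h
      obtain rfl := eq_of_heq h1
      exact ⟨rfl, HEq.rfl, h⟩

/-- A transformer, together with its alphabet, is determined by its binary encoding. -/
theorem UHAT.code_injective :
    Function.Injective fun T : (k : ℕ) × UHAT k => T.2.code := by
  rintro ⟨k, T⟩ ⟨k', T'⟩ h
  obtain ⟨d, hd, emb, s, L, t, o⟩ := T
  obtain ⟨d', hd', emb', s', L', t', o'⟩ := T'
  simp only [UHAT.code] at h
  replace h := natCode_selfDelimiting _ _ _ _ h
  obtain ⟨rfl, h⟩ := h
  replace h := natCode_selfDelimiting _ _ _ _ h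
  obtain ⟨rfl, h⟩ := h
  replace h := tupleCode_selfDelimiting (tupleCode_selfDelimiting ratCode_selfDelimiting _) _ _ _ _ _ h
  obtain ⟨rfl, h⟩ := h
  replace h := Layers.code_selfDelimiting _ _ _ _ h
  obtain ⟨rfl, h1, h⟩ := h
  obtain rfl := eq_of_heq h1
  replace h := tupleCode_selfDelimiting ratCode_selfDelimiting _ _ _ _ _ h
  obtain ⟨rfl, h⟩ := h
  have h' : o.code ++ [] = o'.code ++ [] := by simpa using h
  obtain ⟨rfl, -⟩ := OutputPos.code_selfDelimiting _ _ _ _ h'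
  rfl

theorem LTL.code_selfDelimiting (k : ℕ) : SelfDelimiting (LTL.code (k := k)) := by
  intro φ
  induction φ with
  | top => intro ψ x y h; cases ψ <;> simp_all [LTL.code]
  | bot => intro ψ x y h; cases ψ <;> simp_all [LTL.code]
  | atom a =>
    intro ψ x y h
    cases ψ with
    | atom b =>
      simp only [LTL.code, List.append_assoc, List.append_cancel_left_eq] at h
      obtain ⟨h1, h⟩ := natCode_selfDelimiting _ _ _ _ h
      exact ⟨by rw [Fin.ext h1], h⟩
    | _ => simp [LTL.code] at h
  | not φ ih =>
    intro ψ x y h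
    cases ψ with
    | not ψ =>
      simp only [LTL.code, List.append_assoc, List.append_cancel_left_eq] at h
      replace h := ih _ _ _ h
      obtain ⟨rfl, h⟩ := h
      exact ⟨rfl, h⟩
    | _ => simp [LTL.code] at h
  | and φ φ' ih ih' | or φ φ' ih ih' | sinceOp φ φ' ih ih' | untilOp φ φ' ih ih' =>
    intro ψ x y h
    cases ψ <;> first
      | (simp [LTL.code] at h; done)
      | (simp only [LTL.code, List.append_assoc, List.append_cancel_left_eq] at h
         replace h := ih _ _ _ h
         obtain ⟨rfl, h⟩ := h
         replace h := ih' _ _ _ h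
         obtain ⟨rfl, h⟩ := h
         exact ⟨rfl, h⟩)

/-- A formula is determined by its binary encoding. -/
theorem LTL.code_injective (k : ℕ) : Function.Injective (LTL.code (k := k)) := by
  intro φ ψ h
  exact (LTL.code_selfDelimiting k φ ψ [] [] (by rw [h])).1

/-! ### Running time -/

/-- The Turing machine `M` (a multi-stack machine whose input and output alphabets are identified
with `{0, 1}`), started on the bit string `x`, halts after at most `t` steps with output `y`. -/
def OutputsWithin (M : Turing.TM2ComputableAux Bool Bool) (x y : List Bool) (t : ℕ) : Prop :=
  Nonempty (Turing.TM2OutputsInTime M.tm (x.map M.inputAlphabet.symm)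
    (some (y.map M.outputAlphabet.symm)) t)

/-! Finitely many vectors. The vectors that occur in a run of `T` come from a finite set that does
not depend on the word. `Fits e` says that the entries of a family of vectors have a common
denominator and absolute values of at most `2 ^ e`. ReLU preserves this, and attention only copies a
vector or inserts zero; the score maps `A` and `B` merely decide which vector is copied. Only `C`
enlarges the exponent, and by no more than the length of its own code, because the product of the
denominators and the sum of the absolute values of a list of rationals are at most `2` to the length
of its code (`prod_den_le`, `sum_abs_le`, `Fits.affine`). The codes of the layers are disjoint
pieces of the code of `T`, so the exponent `n = |T|` suffices at every depth. With `X` the number of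
the code of `T` and `U = base X ^ (n + 1) = 2 ^ O(n ^ 2)`, every vector has a code `u < U`
(`exists_vecVal`, `Fits.covered`).

The formula. For each `l` and each `u < U`, `levelForm l u` defines the positions whose vector after
`l` layers is the one with code `u`. A ReLU layer gives a disjunction over the possible preimages.
An attention layer gives a disjunction over the pairs `(u, a)` with `C (u, a) = u'`, each saying
that the own vector is `u` and the attended vector is `a`. Once `u` is a constant of the formula,
comparing scores is a property of the vector at one position, hence a disjunction over codes.
Selection by the unique maximum then says that there is an unmasked position with vector `a` and no
unmasked position to its left or right that defeats it, which strict since and until express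
(`select_best_eq_iff`, `LTL.sat_attForm`). A layer multiplies the size by at most `100 * U ^ 3`, so
the size is `U ^ O(n) = 2 ^ O(n ^ 3)`.

The machine. Time exponential in `n` allows numbers such as `X` and `U` to be kept in unary, so it
is enough that each ingredient is computable in time polynomial in the values of its arguments
(`Feasible`). This class is closed under composition, bounded sums and primitive recursion with a
feasible bound, which covers decoding `T` from `X` and checking the conditions on codes in
cleared-denominator form. The formula itself is too large to be such a value. It is generated by a
grammar instead: a token is a number polynomial in `U` that names a subformula and expands to two
tokens by feasible functions. A stack machine expands tokens depth first, with polynomial cost in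
`U` per token (`Prog.exists_expand`), and the number of tokens is bounded together with the size of
the formula (`Gens.acceptForm`). Structured programs on stacks are compiled to a `Turing.TM2`
machine with the same number of steps (`Prog.Exec.steps`). -/

/-! ### Structured stack programs -/

/-- Structured programs over stacks of bits, indexed by natural numbers. A test looks at the top
of one stack. -/
inductive Prog
  | push (k : ℕ) (b : Bool)
  | pop (k : ℕ)
  | seq (p q : Prog)
  | ite (k : ℕ) (f : Option Bool → Bool) (p q : Prog)
  | loop (k : ℕ) (f : Option Bool → Bool) (p : Prog)

namespace Prog

/-- The contents of all stacks. -/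
abbrev Store := ℕ → List Bool

/-- `Exec p s s' t` says that `p`, started on `s`, ends on `s'` after `t` steps. -/
inductive Exec : Prog → Store → Store → ℕ → Prop
  | push (k b s) : Exec (push k b) s (Function.update s k (b :: s k)) 1
  | pop (k s) : Exec (pop k) s (Function.update s k (s k).tail) 1
  | seq {p q s₁ s₂ s₃ t₁ t₂} : Exec p s₁ s₂ t₁ → Exec q s₂ s₃ t₂ → Exec (seq p q) s₁ s₃ (t₁ + t₂)
  | iteTrue {k f p q s s' t} : f (s k).head? = true → Exec p s s' t →
      Exec (ite k f p q) s s' (1 + t)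
  | iteFalse {k f p q s s' t} : f (s k).head? = false → Exec q s s' t →
      Exec (ite k f p q) s s' (1 + t)
  | loopEnd {k f p s} : f (s k).head? = false → Exec (loop k f p) s s 1
  | loopStep {k f p s₁ s₂ s₃ t₁ t₂} : f (s₁ k).head? = true → Exec p s₁ s₂ t₁ →
      Exec (loop k f p) s₂ s₃ t₂ → Exec (loop k f p) s₁ s₃ (1 + t₁ + t₂)

/-- Labels of the flowchart of a program. -/
def Lab : Prog → Type
  | push _ _ => Unit
  | pop _ => Unit
  | seq p q => Lab p ⊕ Lab q
  | ite _ _ p q => Option (Lab p ⊕ Lab q)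
  | loop _ _ p => Option (Lab p)

/-- The label at which the execution starts. -/
def entry : (p : Prog) → Lab p
  | push _ _ => ()
  | pop _ => ()
  | seq p _ => Sum.inl (entry p)
  | ite _ _ _ _ => none
  | loop _ _ _ => none

/-- The labels form a finite type. -/
@[reducible] noncomputable def labFintype : (p : Prog) → Fintype (Lab p)
  | push _ _ => inferInstanceAs (Fintype Unit)
  | pop _ => inferInstanceAs (Fintype Unit)
  | seq p q => @instFintypeSum _ _ (labFintype p) (labFintype q)
  | ite _ _ p q => @instFintypeOption _ (@instFintypeSum _ _ (labFintype p) (labFintype q))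
  | loop _ _ p => @instFintypeOption _ (labFintype p)

/-- A bound on the stacks that a program uses. -/
def width : Prog → ℕ
  | push k _ => k + 1
  | pop k => k + 1
  | seq p q => max (width p) (width q)
  | ite k _ p q => max (k + 1) (max (width p) (width q))
  | loop k _ p => max (k + 1) (width p)

/-- Statements of the target machine with `N + 1` stacks of bits. -/
abbrev TStmt (N : ℕ) (Λ : Type) :=
  Turing.TM2.Stmt (fun _ : Fin (N + 1) => Bool) Λ (Option Bool)

/-- A jump to a label, or halting. -/
def jump {N : ℕ} {Λ : Type} : Option Λ → TStmt N Λ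
  | none => .halt
  | some l => .goto fun _ => l

/-- A conditional jump. -/
def test {N : ℕ} {Λ : Type} (k : ℕ) (f : Option Bool → Bool) (a b : Option Λ) : TStmt N Λ :=
  .peek (Fin.ofNat (N + 1) k) (fun _ o => o)
    -- The register is reset after the test, so between statements it always holds `none`, as `cfg`
    -- assumes.
    (.branch f (.load (fun _ => none) (jump a)) (.load (fun _ => none) (jump b)))

/-- The statements at the labels of a program, whose labels are embedded into `Λ` by `i`. -/
def comp {N : ℕ} {Λ : Type} : (p : Prog) → (i : Lab p → Λ) → (exit : Option Λ) → Lab p → TStmt N Λ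
  | push k b, _, e, _ => .push (Fin.ofNat (N + 1) k) (fun _ => b) (jump e)
  | pop k, _, e, _ => .pop (Fin.ofNat (N + 1) k) (fun s _ => s) (jump e)
  | seq p q, i, _, Sum.inl l =>
      comp p (fun l => i (Sum.inl l)) (some (i (Sum.inr (entry q)))) l
  | seq _ q, i, e, Sum.inr l => comp q (fun l => i (Sum.inr l)) e l
  | ite k f p q, i, _, none =>
      test k f (some (i (some (Sum.inl (entry p))))) (some (i (some (Sum.inr (entry q)))))
  | ite _ _ p _, i, e, some (Sum.inl l) => comp p (fun l => i (some (Sum.inl l))) e l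
  | ite _ _ _ q, i, e, some (Sum.inr l) => comp q (fun l => i (some (Sum.inr l))) e l
  | loop k f p, i, e, none => test k f (some (i (some (entry p)))) e
  | loop _ _ p, i, _, some l => comp p (fun l => i (some l)) (some (i none)) l

section Correct

variable {N : ℕ} {Λ : Type}

/-- The configuration of the target machine for a store. -/
def cfg (l : Option Λ) (s : Store) : Turing.TM2.Cfg (fun _ : Fin (N + 1) => Bool) Λ (Option Bool) :=
  ⟨l, none, fun k => s k⟩

/-- The target machine takes `t` steps. -/
def Steps (m : Λ → TStmt N Λ)
    (a b : Turing.TM2.Cfg (fun _ : Fin (N + 1) => Bool) Λ (Option Bool)) (t : ℕ) : Prop :=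
  (flip bind (Turing.TM2.step m))^[t] (some a) = some b

theorem Steps.trans {m : Λ → TStmt N Λ} {a b c} {t₁ t₂ : ℕ} (h₁ : Steps m a b t₁)
    (h₂ : Steps m b c t₂) : Steps m a c (t₁ + t₂) := by
  have h := Function.iterate_add_apply (flip bind (Turing.TM2.step m)) t₂ t₁ (some a)
  exact (congrArg (fun n => (flip bind (Turing.TM2.step m))^[n] (some a)) (add_comm t₁ t₂)).trans <|
    h.trans ((congrArg _ h₁).trans h₂)

theorem stepAux_jump (e : Option Λ) (s : Store) :
    Turing.TM2.stepAux (jump e) none (fun k : Fin (N + 1) => s k) = cfg e s := by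
  cases e <;> rfl

theorem ofNat_val {k : ℕ} (h : k < N + 1) : (Fin.ofNat (N + 1) k : ℕ) = k := by
  simpa using Nat.mod_eq_of_lt h

theorem update_ofNat {k : ℕ} (h : k < N + 1) (s : Store) (l : List Bool) :
    Function.update (fun j : Fin (N + 1) => s j) (Fin.ofNat (N + 1) k) l =
      fun j : Fin (N + 1) => Function.update s k l j := by
  funext j
  by_cases hj : (j : ℕ) = k
  · have : j = Fin.ofNat (N + 1) k := Fin.ext (by rw [ofNat_val h, hj])
    subst this
    rw [Function.update_self, ofNat_val h, Function.update_self]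
  · have : j ≠ Fin.ofNat (N + 1) k := fun h' => hj (by rw [h', ofNat_val h])
    rw [Function.update_of_ne this, Function.update_of_ne hj]

theorem steps_test {m : Λ → TStmt N Λ} {l : Λ} {k : ℕ} {f : Option Bool → Bool} {a b : Option Λ}
    (h : k < N + 1) (hm : m l = test k f a b) (s : Store) :
    Steps m (cfg (some l) s) (cfg (if f (s k).head? then a else b) s) 1 := by
  have h' := ofNat_val h
  simp only [Steps, Function.iterate_one, flip, cfg, Option.bind_eq_bind, Option.bind_some,
    Turing.TM2.step, hm, test, Turing.TM2.stepAux, stepAux_jump, h']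
  cases f (s k).head? <;> rfl

/-- Each execution step is one machine step. The label embedding `i` and the exit `e` are arbitrary
so that the induction hypothesis applies to a subprogram in its place inside the machine; for a
loop, the second hypothesis is used with the same `i` and `e`. The bound on `width` ensures that
`Fin.ofNat` does not wrap around. -/
theorem Exec.steps {p : Prog} {s s' : Store} {t : ℕ} (h : Exec p s s' t) :
    ∀ (i : Lab p → Λ) (e : Option Λ) (m : Λ → TStmt N Λ), width p ≤ N + 1 →
      (∀ l, m (i l) = comp p i e l) → Steps m (cfg (some (i (entry p))) s) (cfg e s') t := by
  induction h with
  | push k b s =>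
    intro i e m hw hm
    have hw' : k < N + 1 := hw
    have h' := ofNat_val hw'
    simp only [Steps, Function.iterate_one, flip, cfg, Option.bind_eq_bind, Option.bind_some,
      Turing.TM2.step, hm, comp, Turing.TM2.stepAux, h']
    rw [update_ofNat hw', stepAux_jump]; rfl
  | pop k s =>
    intro i e m hw hm
    have hw' : k < N + 1 := hw
    have h' := ofNat_val hw'
    simp only [Steps, Function.iterate_one, flip, cfg, Option.bind_eq_bind, Option.bind_some,
      Turing.TM2.step, hm, comp, Turing.TM2.stepAux, h']
    rw [update_ofNat hw', stepAux_jump]; rfl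
  | seq _ _ ih₁ ih₂ =>
    intro i e m hw hm
    have hw' := max_le_iff.1 hw
    exact (ih₁ _ _ m hw'.1 fun l => hm (Sum.inl l)).trans
      (ih₂ _ _ m hw'.2 fun l => hm (Sum.inr l))
  | @iteTrue _ _ _ _ s _ _ hf _ ih =>
    intro i e m hw hm
    have hw' := max_le_iff.1 hw
    have h1 := steps_test hw'.1 (hm none) s
    rw [hf, if_pos rfl] at h1
    exact h1.trans (ih _ _ m (max_le_iff.1 hw'.2).1 fun l => hm (some (Sum.inl l)))
  | @iteFalse _ _ _ _ s _ _ hf _ ih =>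
    intro i e m hw hm
    have hw' := max_le_iff.1 hw
    have h1 := steps_test hw'.1 (hm none) s
    rw [hf, if_neg (by simp)] at h1
    exact h1.trans (ih _ _ m (max_le_iff.1 hw'.2).2 fun l => hm (some (Sum.inr l)))
  | @loopEnd _ _ _ s hf =>
    intro i e m hw hm
    have h1 := steps_test (max_le_iff.1 hw).1 (hm none) s
    rwa [hf, if_neg (by simp)] at h1
  | @loopStep _ _ _ s _ _ _ _ hf _ _ ih₁ ih₂ =>
    intro i e m hw hm
    have hw' := max_le_iff.1 hw
    have h1 := steps_test hw'.1 (hm none) s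
    rw [hf, if_pos rfl] at h1
    exact (h1.trans (ih₁ _ _ m hw'.2 fun l => hm (some l))).trans (ih₂ i e m hw hm)

end Correct

/-- The Turing machine that runs a program; stack `0` holds the input, stack `1` the output. -/
noncomputable def machine (p : Prog) : Turing.TM2ComputableAux Bool Bool where
  tm :=
    -- The maximum guarantees that the output stack `1` exists even if the program never mentions
    -- it.
    { K := Fin (max 1 (width p) + 1)
      k₀ := 0
      k₁ := 1
      Γ := fun _ => Bool
      Λ := Lab p
      main := entry p
      ΛFin := labFintype p
      σ := Option Bool
      initialState := none
      Γk₀Fin := inferInstanceAs (Fintype Bool)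
      m := comp p id none }
  inputAlphabet := Equiv.refl Bool
  outputAlphabet := Equiv.refl Bool

/-- `Turing.haltList` prescribes the whole final configuration, so all stacks but the output must be
empty at the end. This is why programs clean up after themselves. -/
theorem outputsWithin_machine {p : Prog} {x y : List Bool} {t T : ℕ} (hT : t ≤ T)
    (h : Exec p (Function.update (fun _ => []) 0 x) (Function.update (fun _ => []) 1 y) t) :
    OutputsWithin (machine p) x y T := by
  have hs := h.steps (N := max 1 (width p)) id none (comp p id none)
    ((le_max_right _ _).trans (Nat.le_succ _)) fun _ => rfl
  refine ⟨⟨⟨t, ?_⟩, hT⟩⟩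
  have e0 : Turing.initList (machine p).tm (x.map (machine p).inputAlphabet.symm) =
      cfg (some (entry p)) (Function.update (fun _ => []) 0 x) := by
    have hx : x.map (machine p).inputAlphabet.symm = x := List.map_id x
    rw [hx]
    refine congrArg (Turing.TM2.Cfg.mk _ _) (funext fun k => ?_)
    by_cases hk : k = (machine p).tm.k₀
    · subst hk; rfl
    · rw [dif_neg hk]
      exact (Function.update_of_ne (f := fun _ : ℕ => ([] : List Bool)) (a' := 0) (a := k.val)
        (fun h => hk (Fin.ext h)) x).symm
  have e1 : Turing.haltList (machine p).tm (y.map (machine p).outputAlphabet.symm) =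
      cfg none (Function.update (fun _ => []) 1 y) := by
    have hy : y.map (machine p).outputAlphabet.symm = y := List.map_id y
    rw [hy]
    have h1 : ((1 : Fin (max 1 (width p) + 1)) : ℕ) = 1 :=
      Fin.val_one' _ |>.trans (Nat.mod_eq_of_lt (by omega))
    refine congrArg (Turing.TM2.Cfg.mk _ _) (funext fun k => ?_)
    by_cases hk : k = (machine p).tm.k₁
    · subst hk
      rw [dif_pos rfl]
      exact (congrArg (Function.update (fun _ => []) 1 y) h1).trans (Function.update_self _ _ _) |>.symm
    · rw [dif_neg hk]
      exact (Function.update_of_ne (f := fun _ : ℕ => ([] : List Bool)) (a' := 1) (a := k.val)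
        (fun h => hk (Fin.ext (h.trans h1.symm))) y).symm
  rw [e0, Option.map_some, e1]
  exact hs

end Prog

/-! ### Polynomially bounded functions -/

/-- Bounded by a power of the argument, for arguments that are at least `2`. -/
def PolyBdd (T : ℕ → ℕ) : Prop := ∃ c, ∀ M, 2 ≤ M → T M ≤ M ^ c

namespace PolyBdd

theorem pow (c : ℕ) : PolyBdd fun M => M ^ c := ⟨c, fun _ _ => le_rfl⟩

theorem id : PolyBdd fun M => M := ⟨1, fun _ _ => (pow_one _).ge⟩

/-- The restriction to `M ≥ 2` serves here: `k < 2 ^ k ≤ M ^ k`. -/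
theorem const (k : ℕ) : PolyBdd fun _ => k :=
  ⟨k, fun _ hM => k.lt_two_pow_self.le.trans (Nat.pow_le_pow_left hM _)⟩

theorem mul {S T : ℕ → ℕ} (hS : PolyBdd S) (hT : PolyBdd T) : PolyBdd fun M => S M * T M := by
  obtain ⟨a, ha⟩ := hS
  obtain ⟨b, hb⟩ := hT
  exact ⟨a + b, fun M hM => by rw [pow_add]; exact Nat.mul_le_mul (ha M hM) (hb M hM)⟩

theorem add {S T : ℕ → ℕ} (hS : PolyBdd S) (hT : PolyBdd T) : PolyBdd fun M => S M + T M := by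
  obtain ⟨a, ha⟩ := hS
  obtain ⟨b, hb⟩ := hT
  -- The additional factor `M ≥ 2` pays for adding two powers with exponent `max a b`.
  refine ⟨max a b + 1, fun M hM => ?_⟩
  have h1 := (ha M hM).trans (Nat.pow_le_pow_right (by omega) (le_max_left a b))
  have h2 := (hb M hM).trans (Nat.pow_le_pow_right (by omega) (le_max_right a b))
  rw [pow_succ]
  nlinarith

theorem powPow {S : ℕ → ℕ} (hS : PolyBdd S) (c : ℕ) : PolyBdd fun M => S M ^ c := by
  obtain ⟨a, ha⟩ := hS
  exact ⟨a * c, fun M hM => by rw [pow_mul]; exact Nat.pow_le_pow_left (ha M hM) c⟩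

end PolyBdd

/-! ### Unary numbers on stacks -/

/-- The unary representation of a number. -/
abbrev rep (n : ℕ) : List Bool := List.replicate n true

/-- The test for a stack that starts with `true`. -/
def headTrue (o : Option Bool) : Bool := o == some true

namespace Prog

/-- `p` leads from `s` to `s'` within `T` steps. -/
def Run (p : Prog) (s s' : Store) (T : ℕ) : Prop := ∃ t ≤ T, Exec p s s' t

variable {p q : Prog} {s s₁ s₂ s₃ s' : Store} {T T₁ T₂ : ℕ}

theorem Run.mono (h : Run p s s' T₁) (hT : T₁ ≤ T₂) : Run p s s' T₂ :=
  let ⟨t, ht, he⟩ := h; ⟨t, ht.trans hT, he⟩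

theorem Run.to (h : Run p s s' T) {u' : Store} (e : s' = u') : Run p s u' T := e ▸ h

theorem Run.seq (h₁ : Run p s₁ s₂ T₁) (h₂ : Run q s₂ s₃ T₂) : Run (seq p q) s₁ s₃ (T₁ + T₂) :=
  let ⟨t₁, ht₁, he₁⟩ := h₁
  let ⟨t₂, ht₂, he₂⟩ := h₂
  ⟨t₁ + t₂, add_le_add ht₁ ht₂, he₁.seq he₂⟩

theorem run_push (k : ℕ) (b : Bool) (s : Store) :
    Run (push k b) s (Function.update s k (b :: s k)) 1 := ⟨1, le_rfl, .push k b s⟩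

theorem run_pop (k : ℕ) (s : Store) :
    Run (pop k) s (Function.update s k (s k).tail) 1 := ⟨1, le_rfl, .pop k s⟩

theorem Run.ite_true {k f} (hf : f (s k).head? = true) (h : Run p s s' T) :
    Run (ite k f p q) s s' (1 + T) :=
  let ⟨t, ht, he⟩ := h; ⟨1 + t, by omega, .iteTrue hf he⟩

theorem Run.ite_false {k f} (hf : f (s k).head? = false) (h : Run q s s' T) :
    Run (ite k f p q) s s' (1 + T) :=
  let ⟨t, ht, he⟩ := h; ⟨1 + t, by omega, .iteFalse hf he⟩

theorem Run.loop_end {k f} (hf : f (s k).head? = false) : Run (loop k f p) s s 1 :=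
  ⟨1, le_rfl, .loopEnd hf⟩

theorem Run.loop_step {k f} (hf : f (s₁ k).head? = true) (h₁ : Run p s₁ s₂ T₁)
    (h₂ : Run (loop k f p) s₂ s₃ T₂) : Run (loop k f p) s₁ s₃ (1 + T₁ + T₂) :=
  let ⟨t₁, ht₁, he₁⟩ := h₁
  let ⟨t₂, ht₂, he₂⟩ := h₂
  ⟨1 + t₁ + t₂, by omega, .loopStep hf he₁ he₂⟩

/-- A loop that runs through the states `S 0, ..., S n`. -/
theorem run_loop {k f} (S : ℕ → Store) (T : ℕ) : ∀ (n : ℕ),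
    (∀ i < n, f (S i k).head? = true) → f (S n k).head? = false →
    (∀ i < n, Run p (S i) (S (i + 1)) T) → Run (loop k f p) (S 0) (S n) (n * (T + 1) + 1) := by
  intro n
  induction n generalizing S with
  | zero => intro _ h _; exact (Run.loop_end h).mono (by omega)
  | succ n ih =>
    intro h1 h2 h3
    have := ih (fun i => S (i + 1)) (fun i hi => h1 _ (by omega)) h2 fun i hi => h3 _ (by omega)
    exact (Run.loop_step (h1 0 (by omega)) (h3 0 (by omega)) this).mono (by ring_nf; omega)

/-- Empties a stack that holds a number. -/
def clear (k : ℕ) : Prog := loop k headTrue (pop k)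

theorem run_clear {k n : ℕ} (h : s k = rep n) :
    Run (clear k) s (Function.update s k []) (2 * n + 1) := by
  have := run_loop (k := k) (f := headTrue) (p := pop k)
    (fun i => Function.update s k (rep (n - i))) 1 n ?_ ?_ ?_
  · simp only [Nat.sub_zero, Nat.sub_self, rep, List.replicate_zero] at this
    rw [show List.replicate n true = s k from h.symm, Function.update_eq_self] at this
    exact this.mono (by omega)
  · intro i hi
    obtain ⟨m, hm⟩ : ∃ m, n - i = m + 1 := ⟨n - i - 1, by omega⟩
    simp [hm, rep, List.replicate_succ, headTrue]
  · simp [rep, headTrue]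
  · intro i hi
    have := run_pop k (Function.update s k (rep (n - i)))
    rw [Function.update_self, Function.update_idem] at this
    simpa [rep, Nat.sub_add_eq] using this

/-- Moves a number from one stack to another one. -/
def move (a b : ℕ) : Prog := loop a headTrue (seq (pop a) (push b true))

/-- The number may lie on top of further contents `l`. Since `l` does not start with `true`, the
loop stops exactly below the number; stacks of numbers separated by `false` rely on this. -/
theorem run_move {a b n : ℕ} {l : List Bool} (hab : a ≠ b) (h : s a = rep n ++ l)
    (hl : headTrue l.head? = false) :
    Run (move a b) s (Function.update (Function.update s a l) b (rep n ++ s b)) (3 * n + 1) := by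
  have := run_loop (k := a) (f := headTrue) (p := seq (pop a) (push b true))
    (fun i => Function.update (Function.update s a (rep (n - i) ++ l)) b (rep i ++ s b)) 2 n ?_ ?_ ?_
  · simp only [Nat.sub_zero, Nat.sub_self, rep, List.replicate_zero, List.nil_append] at this
    rw [show List.replicate n true ++ l = s a from h.symm, Function.update_eq_self,
      Function.update_eq_self] at this
    exact this.mono (by omega)
  · intro i hi
    obtain ⟨m, hm⟩ : ∃ m, n - i = m + 1 := ⟨n - i - 1, by omega⟩
    simp [hm, rep, List.replicate_succ, headTrue, Function.update_of_ne hab]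
  · simpa [rep, Function.update_of_ne hab] using hl
  · intro i hi
    obtain ⟨m, hm⟩ : ∃ m, n - i = m + 1 := ⟨n - i - 1, by omega⟩
    have hm' : n - (i + 1) = m := by omega
    refine ((run_pop a _).seq (run_push b true _)).to ?_
    funext j
    simp only [Function.update_apply, hm, hm']
    split_ifs with h1 h2 <;> first | omega | simp_all [rep, List.replicate_succ]

/-- Copies a number to an empty stack, with the help of another empty stack. -/
def copy (a b c : ℕ) : Prog :=
  seq (loop a headTrue (seq (pop a) (seq (push b true) (push c true)))) (move c a)

theorem run_copy {a b c n : ℕ} (hab : a ≠ b) (hac : a ≠ c) (hbc : b ≠ c) (h : s a = rep n)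
    (hb : s b = []) (hc : s c = []) :
    Run (copy a b c) s (Function.update s b (rep n)) (7 * n + 2) := by
  have h1 := run_loop (k := a) (f := headTrue)
    (p := seq (pop a) (seq (push b true) (push c true)))
    (fun i => Function.update (Function.update (Function.update s a (rep (n - i))) b (rep i)) c
      (rep i)) 3 n ?_ ?_ ?_
  · have h2 := run_move (s := Function.update (Function.update (Function.update s a (rep (n - n)))
      b (rep n)) c (rep n)) (a := c) (b := a) (n := n) (l := []) hac.symm (by simp) rfl
    have e0 : Function.update (Function.update (Function.update s a (rep (n - 0))) b (rep 0)) c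
        (rep 0) = s := by
      funext j
      simp only [Function.update_apply]
      split_ifs with h1 h2 h3 <;> simp_all
    rw [e0] at h1
    refine ((h1.seq h2).mono (by omega)).to ?_
    funext j
    simp only [Function.update_apply]
    split_ifs with h1 h2 h3 <;> simp_all
  · intro i hi
    obtain ⟨m, hm⟩ : ∃ m, n - i = m + 1 := ⟨n - i - 1, by omega⟩
    simp [hm, rep, List.replicate_succ, headTrue, Function.update_of_ne hab, Function.update_of_ne hac]
  · simp [rep, headTrue, Function.update_of_ne hab, Function.update_of_ne hac]
  · intro i hi
    obtain ⟨m, hm⟩ : ∃ m, n - i = m + 1 := ⟨n - i - 1, by omega⟩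
    have hm' : n - (i + 1) = m := by omega
    refine ((run_pop a _).seq ((run_push b true _).seq (run_push c true _))).to ?_
    funext j
    simp only [Function.update_apply, hm, hm']
    split_ifs with h1 h2 h3 <;> first | omega | simp_all [rep, List.replicate_succ]

end Prog

/-! ### A calculus of polynomial time on unary numbers -/

/-! ### Functions that are computable in time polynomial in the values of the arguments -/

/-- `f` is computed by a program that gets its arguments in unary, in time and with a value
polynomial in the arguments. The program is given the stacks of the arguments, and leaves the
result in the first free stack. -/
@[fun_prop]
def Feasible {ι : Type} (f : (ι → ℕ) → ℕ) : Prop :=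
  ∃ (p : (ι → ℕ) → ℕ → Prog) (c : ℕ), ∀ M, 2 ≤ M → ∀ v : ι → ℕ, (∀ i, v i ≤ M) →
    f v ≤ M ^ c ∧ ∀ (src : ι → ℕ) (fr : ℕ) (s : Prog.Store), (∀ i, src i < fr) →
      (∀ i, s (src i) = rep (v i)) → (∀ j, fr ≤ j → s j = []) →
      Prog.Run (p src fr) s (Function.update s fr (rep (f v))) (M ^ c)

namespace Feasible

open Prog

variable {ι κ : Type}

theorem of_bound {f : (ι → ℕ) → ℕ} {T : ℕ → ℕ} (hT : PolyBdd T) (p : (ι → ℕ) → ℕ → Prog)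
    (h : ∀ M, 2 ≤ M → ∀ v : ι → ℕ, (∀ i, v i ≤ M) →
      f v ≤ T M ∧ ∀ (src : ι → ℕ) (fr : ℕ) (s : Store), (∀ i, src i < fr) →
        (∀ i, s (src i) = rep (v i)) → (∀ j, fr ≤ j → s j = []) →
        Run (p src fr) s (Function.update s fr (rep (f v))) (T M)) : Feasible f := by
  obtain ⟨c, hc⟩ := hT
  refine ⟨p, c, fun M hM v hv => ⟨(h M hM v hv).1.trans (hc M hM), ?_⟩⟩
  intro src fr s h1 h2 h3
  exact ((h M hM v hv).2 src fr s h1 h2 h3).mono (hc M hM)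

theorem bound {f : (ι → ℕ) → ℕ} (hf : Feasible f) :
    ∃ c, ∀ M, 2 ≤ M → ∀ v : ι → ℕ, (∀ i, v i ≤ M) → f v ≤ M ^ c :=
  let ⟨_, c, h⟩ := hf; ⟨c, fun M hM v hv => (h M hM v hv).1⟩

theorem rename {f : (κ → ℕ) → ℕ} (hf : Feasible f) (ρ : κ → ι) :
    Feasible fun v : ι → ℕ => f fun i => v (ρ i) := by
  obtain ⟨p, c, h⟩ := hf
  refine ⟨fun src fr => p (fun i => src (ρ i)) fr, c, fun M hM v hv => ?_⟩
  obtain ⟨h1, h2⟩ := h M hM (fun i => v (ρ i)) fun i => hv _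
  exact ⟨h1, fun src fr s a b c => h2 _ fr s (fun i => a _) (fun i => b _) c⟩

theorem var (i : ι) : Feasible fun v : ι → ℕ => v i := by
  refine of_bound (T := fun M => 7 * M + 2) (((PolyBdd.const 7).mul .id).add (.const 2))
    (fun src fr => copy (src i) fr (fr + 1)) fun M hM v hv => ⟨(hv i).trans (by omega), ?_⟩
  intro src fr s h1 h2 h3
  have := h1 i
  have := hv i
  exact (run_copy (n := v i) (by omega) (by omega) (by omega) (h2 i) (h3 _ le_rfl)
    (h3 _ (by omega))).mono (by omega)

/-- Pushes a number. -/
def pushNum (k : ℕ) : ℕ → Prog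
  | 0 => clear k
  | n + 1 => seq (pushNum k n) (push k true)

theorem run_pushNum {k : ℕ} {s : Store} (h : s k = []) (n : ℕ) :
    Run (pushNum k n) s (Function.update s k (rep n)) (n + 1) := by
  induction n with
  | zero => exact run_clear (n := 0) h
  | succ n ih =>
    have := ih.seq (run_push k true _)
    rwa [Function.update_self, Function.update_idem] at this

theorem const (n : ℕ) : Feasible fun _ : ι → ℕ => n := by
  refine of_bound (T := fun _ => n + 1) (.const _) (fun _ fr => pushNum fr n)
    fun M hM v hv => ⟨by omega, ?_⟩
  intro src fr s h1 h2 h3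
  exact run_pushNum (h3 _ le_rfl) n

theorem succ {f : (ι → ℕ) → ℕ} (hf : Feasible f) : Feasible fun v => f v + 1 := by
  obtain ⟨p, c, h⟩ := hf
  refine of_bound (T := fun M => M ^ c + 1) ((PolyBdd.pow c).add (.const 1))
    (fun src fr => seq (p src fr) (push fr true)) fun M hM v hv => ?_
  obtain ⟨h1, h2⟩ := h M hM v hv
  refine ⟨by omega, fun src fr s a b d => ?_⟩
  have := (h2 src fr s a b d).seq (run_push fr true _)
  rwa [Function.update_self, Function.update_idem] at this

/-- Extension of a valuation. -/
def ext (a : ℕ) (v : ι → ℕ) : Option ι → ℕ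
  | none => a
  | some i => v i

theorem one_le_pow {M : ℕ} (hM : 2 ≤ M) (c : ℕ) : 1 ≤ M ^ c := Nat.one_le_pow _ _ (by omega)

theorem le_powSucc {M : ℕ} (hM : 2 ≤ M) (c : ℕ) : M ≤ M ^ (c + 1) := by
  rw [pow_succ]; exact Nat.le_mul_of_pos_left _ (one_le_pow hM c)

theorem pow_le_powSucc {M : ℕ} (hM : 2 ≤ M) (c : ℕ) : M ^ c ≤ M ^ (c + 1) :=
  Nat.pow_le_pow_right (by omega) (by omega)

/-- The value of `g` stays in stack `fr` as an additional argument while `f` is computed into `fr +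
1`, and is then overwritten by the result. -/
theorem bind {f : (Option ι → ℕ) → ℕ} {g : (ι → ℕ) → ℕ} (hf : Feasible f) (hg : Feasible g) :
    Feasible fun v => f (ext (g v) v) := by
  obtain ⟨p, c, hp⟩ := hf
  obtain ⟨q, d, hq⟩ := hg
  refine of_bound (T := fun M => M ^ d + ((M ^ (d + 1)) ^ c + ((2 * M ^ d + 1) +
    (3 * (M ^ (d + 1)) ^ c + 1))))
    ((PolyBdd.pow d).add ((PolyBdd.powPow (.pow _) c).add
      ((((PolyBdd.const 2).mul (.pow d)).add (.const 1)).add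
      (((PolyBdd.const 3).mul (PolyBdd.powPow (.pow _) c)).add (.const 1)))))
    (fun src fr => seq (q src fr) (seq (p (ext fr src) (fr + 1))
      (seq (clear fr) (move (fr + 1) fr)))) fun M hM v hv => ?_
  obtain ⟨g1, g2⟩ := hq M hM v hv
  -- `M ^ (d + 1)` bounds the old arguments, which are at most `M`, as well as the new one, which is
  -- at most `M ^ d`.
  obtain ⟨f1, f2⟩ := hp (M ^ (d + 1)) (hM.trans (le_powSucc hM d)) (ext (g v) v) (by
    rintro (_ | i)
    · exact g1.trans (pow_le_powSucc hM d)
    · exact (hv i).trans (le_powSucc hM d))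
  refine ⟨by omega, fun src fr s h1 h2 h3 => ?_⟩
  refine (g2 src fr s h1 h2 h3).seq (.seq (f2 (ext fr src) (fr + 1) _ ?_ ?_ ?_)
    (.seq ((run_clear (n := g v) ?_).mono (by omega))
      (((run_move (n := f (ext (g v) v)) (l := []) ?_ ?_ rfl).mono (by omega)).to ?_)))
  · rintro (_ | i)
    · exact Nat.lt_succ_self _
    · exact (h1 i).trans (Nat.lt_succ_self _)
  · rintro (_ | i)
    · exact Function.update_self ..
    · have := h1 i
      exact (Function.update_of_ne (by simp only [ext]; omega) _ _).trans (h2 i)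
  · intro j hj
    rw [Function.update_of_ne (by omega)]
    exact h3 j (by omega)
  · rw [Function.update_of_ne (by omega), Function.update_self]
  · omega
  · rw [Function.update_of_ne (by omega), Function.update_self, List.append_nil]
  · have := h3 (fr + 1) (by omega)
    funext j
    simp only [Function.update_apply]
    split_ifs <;> first | omega | simp_all

theorem ite {f g h : (ι → ℕ) → ℕ} (hh : Feasible h) (hf : Feasible f) (hg : Feasible g) :
    Feasible fun v => if h v = 0 then f v else g v := by
  obtain ⟨p, c, hp⟩ := hf
  obtain ⟨q, d, hq⟩ := hg
  obtain ⟨r, e, hr⟩ := hh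
  refine of_bound (T := fun M => M ^ e + (1 + ((2 * M ^ e + 1) + (M ^ c + M ^ d))))
    ((PolyBdd.pow e).add ((PolyBdd.const 1).add ((((PolyBdd.const 2).mul (.pow e)).add
      (.const 1)).add ((PolyBdd.pow c).add (.pow d)))))
    (fun src fr => seq (r src fr) (.ite fr headTrue (seq (clear fr) (q src fr)) (p src fr)))
    fun M hM v hv => ?_
  obtain ⟨f1, f2⟩ := hp M hM v hv
  obtain ⟨g1, g2⟩ := hq M hM v hv
  obtain ⟨h1, h2⟩ := hr M hM v hv
  refine ⟨by split_ifs <;> omega, fun src fr s k1 k2 k3 => ?_⟩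
  refine (h2 src fr s k1 k2 k3).seq ?_
  have hs : Function.update s fr [] = s := by rw [← k3 fr le_rfl, Function.update_eq_self]
  by_cases h0 : h v = 0
  · rw [if_pos h0, h0]
    rw [show rep 0 = [] from rfl, hs]
    refine (Run.ite_false ?_ (f2 src fr s k1 k2 k3)).mono (by omega)
    rw [k3 fr le_rfl]; rfl
  · rw [if_neg h0]
    refine (Run.ite_true ?_ ((run_clear (n := h v) (Function.update_self ..)).seq
      (T₂ := M ^ d) ?_)).mono (T₁ := 1 + ((2 * h v + 1) + M ^ d)) (by omega)
    · obtain ⟨m, hm⟩ := Nat.exists_eq_succ_of_ne_zero h0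
      rw [Function.update_self, hm]; rfl
    · rw [Function.update_idem, hs]
      exact g2 src fr s k1 k2 k3

/-- Stack `fr` counts down, `fr + 1` holds the index and `fr + 2` the current value. The bound `B`
on all intermediate values is essential: iterating a feasible function can lead beyond polynomial
growth. -/
theorem natRec {b f : (ι → ℕ) → ℕ} {g : (Option (Option ι) → ℕ) → ℕ} {R : (ι → ℕ) → ℕ → ℕ}
    (hb : Feasible b) (hf : Feasible f) (hg : Feasible g)
    (h0 : ∀ v, R v 0 = f v) (hS : ∀ v i, R v (i + 1) = g (ext (R v i) (ext i v)))
    {B : ℕ → ℕ} (hB : PolyBdd B)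
    (hR : ∀ M, 2 ≤ M → ∀ v : ι → ℕ, (∀ i, v i ≤ M) → ∀ i ≤ b v, R v i ≤ B M) :
    Feasible fun v => R v (b v) := by
  obtain ⟨p, c, hp⟩ := hb
  obtain ⟨q, d, hq⟩ := hf
  obtain ⟨r, e, hr⟩ := hg
  have hP : PolyBdd fun M => (M + M ^ c + B M) ^ e :=
    .powPow ((PolyBdd.id.add (.pow c)).add hB) e
  refine of_bound (T := fun M => B M + (M ^ c + (M ^ d + ((M ^ c * ((1 + ((M + M ^ c + B M) ^ e
    + ((2 * B M + 1) + ((3 * (M + M ^ c + B M) ^ e + 1) + 1)))) + 1) + 1) +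
    ((2 * M ^ c + 1) + (3 * B M + 1))))))
    (hB.add ((PolyBdd.pow c).add ((PolyBdd.pow d).add (((PolyBdd.pow c).mul
      (((PolyBdd.const 1).add (hP.add (((((PolyBdd.const 2).mul hB).add (.const 1))).add
      ((((PolyBdd.const 3).mul hP).add (.const 1)).add (.const 1))))).add (.const 1)) |>.add
      (.const 1)).add ((((PolyBdd.const 2).mul (.pow c)).add (.const 1)).add
      (((PolyBdd.const 3).mul hB).add (.const 1)))))))
    (fun src fr => seq (p src fr) (seq (q src (fr + 2)) (seq
      (loop fr headTrue (seq (pop fr) (seq (r (ext (fr + 2) (ext (fr + 1) src)) (fr + 3))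
        (seq (clear (fr + 2)) (seq (move (fr + 3) (fr + 2)) (push (fr + 1) true))))))
      (seq (clear (fr + 1)) (move (fr + 2) fr))))) fun M hM v hv => ?_
  obtain ⟨b1, b2⟩ := hp M hM v hv
  obtain ⟨f1, f2⟩ := hq M hM v hv
  have hRM := hR M hM v hv
  refine ⟨(hRM _ le_rfl).trans (by omega), fun src fr s k1 k2 k3 => ?_⟩
  set S : ℕ → Store := fun i => Function.update (Function.update (Function.update s fr
    (rep (b v - i))) (fr + 1) (rep i)) (fr + 2) (rep (R v i)) with hSdef
  have hs1 : s (fr + 1) = [] := k3 _ (by omega)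
  have hs2 : s (fr + 2) = [] := k3 _ (by omega)
  have hs3 : s (fr + 3) = [] := k3 _ (by omega)
  have loopRun := run_loop (k := fr) (f := headTrue) (p := seq (pop fr)
      (seq (r (ext (fr + 2) (ext (fr + 1) src)) (fr + 3))
        (seq (clear (fr + 2)) (seq (move (fr + 3) (fr + 2)) (push (fr + 1) true))))) S
        (1 + ((M + M ^ c + B M) ^ e + ((2 * B M + 1) + ((3 * (M + M ^ c + B M) ^ e + 1) + 1))))
        (b v) ?_ ?_ ?_
  · refine Run.mono (T₁ := M ^ c + (M ^ d + (_ + ((2 * M ^ c + 1) + (3 * B M + 1)))))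
      ((b2 src fr s k1 k2 k3).seq (.seq (s₂ := S 0) ?_ (loopRun.mono
        (Nat.add_le_add_right (Nat.mul_le_mul_right _ b1) _) |>.seq
        (.seq (s₂ := Function.update (S (b v)) (fr + 1) []) ?_ ?_)))) (by omega)
    · have := f2 src (fr + 2) (Function.update s fr (rep (b v))) (fun i => by have := k1 i; omega)
        (fun i => by have := k1 i; rw [Function.update_of_ne (by omega)]; exact k2 i)
        (fun j hj => by rw [Function.update_of_ne (by omega)]; exact k3 j (by omega))
      refine this.to ?_
      funext j
      simp only [hSdef, Function.update_apply, h0]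
      split_ifs <;> first | omega | simp_all
    · refine (run_clear (n := b v) ?_).mono (by omega)
      simp [hSdef]
    · have := run_move (s := Function.update (S (b v)) (fr + 1) []) (a := fr + 2) (b := fr)
        (n := R v (b v)) (l := []) (by omega) (by simp [hSdef]) rfl
      refine (this.mono (by have := hRM _ le_rfl; omega)).to ?_
      funext j
      simp only [hSdef, Function.update_apply]
      split_ifs <;> first | omega | simp_all
  · intro i hi
    obtain ⟨m, hm⟩ : ∃ m, b v - i = m + 1 := ⟨b v - i - 1, by omega⟩
    simp [hSdef, hm, rep, List.replicate_succ, headTrue]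
  · simp [hSdef, headTrue]
  · intro i hi
    obtain ⟨m, hm⟩ : ∃ m, b v - i = m + 1 := ⟨b v - i - 1, by omega⟩
    have hm' : b v - (i + 1) = m := by omega
    have hRi := hRM i hi.le
    obtain ⟨g1, g2⟩ := hr (M + M ^ c + B M) (by omega) (ext (R v i) (ext i v)) (by
      rintro (_ | _ | j)
      · simp only [ext]; omega
      · simp only [ext]; omega
      · have := hv j; simp only [ext]; omega)
    rw [← hS] at g1 g2
    have e1 := run_pop fr (S i)
    have e2 := g2 (ext (fr + 2) (ext (fr + 1) src)) (fr + 3)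
      (Function.update (S i) fr (S i fr).tail) ?_ ?_ ?_
    · refine e1.seq (e2.seq (.seq ((run_clear (n := R v i) ?_).mono (by omega))
        (.seq ((run_move (n := R v (i + 1)) (l := []) (by omega) ?_ rfl).mono (by omega))
          ((run_push (fr + 1) true _).to ?_))))
      · simp [hSdef]
      · simp
      · funext j
        simp only [hSdef, Function.update_apply, hm, hm']
        clear g2 e1 e2 b2 f2 hp hq hr hR hS h0 hRM
        split_ifs <;> first
          | omega
          | simp only [rep, List.replicate_succ, List.tail_cons, List.append_nil]
          | (subst_vars; simp only [hs3])
    · rintro (_ | _ | j)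
      · simp only [ext]; omega
      · simp only [ext]; omega
      · have := k1 j; simp only [ext]; omega
    · rintro (_ | _ | j)
      · simp [ext, hSdef]
      · simp [ext, hSdef]
      · have := k1 j
        simp only [ext, hSdef, Function.update_apply]
        split_ifs <;> first | omega | exact k2 j
    · intro j hj
      simp only [hSdef, Function.update_apply]
      split_ifs <;> first | omega | exact k3 j (by omega)

end Feasible

namespace Feasible

variable {ι κ : Type}

attribute [fun_prop] var const succ

/-! ### Closure under composition -/

/-- Simultaneous substitution is reduced to `bind`, one function at a time: the value of `g 0`
becomes the new variable `none`, and the induction hypothesis is applied over `Option ι`. -/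
theorem comp_aux (m : ℕ) : ∀ {ι : Type} {f : (Fin m ⊕ ι → ℕ) → ℕ} (_ : Feasible f)
    {g : Fin m → (ι → ℕ) → ℕ} (_ : ∀ i, Feasible (g i)),
    Feasible fun v => f (Sum.elim (fun i => g i v) v) := by
  induction m with
  | zero =>
    intro ι f hf g _
    convert hf.rename (ι := ι) (Sum.elim Fin.elim0 id) using 3 with v
    funext i
    rcases i with i | i
    · exact i.elim0
    · rfl
  | succ m ih =>
    intro ι f hf g hg
    have h1 : Feasible fun v : Fin m ⊕ Option ι → ℕ => f fun i =>
        v (Sum.elim (Fin.cases (Sum.inr none) Sum.inl) (fun j => Sum.inr (some j)) i) :=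
      hf.rename _
    have h2 := ih h1 (g := fun i v => g i.succ fun j => v (some j))
      fun i => (hg i.succ).rename some
    have h3 := h2.bind (hg 0)
    convert h3 using 3 with v
    funext i
    rcases i with i | i
    · induction i using Fin.cases <;> rfl
    · rfl

theorem comp {m : ℕ} {f : (Fin m → ℕ) → ℕ} (hf : Feasible f) {g : Fin m → (ι → ℕ) → ℕ}
    (hg : ∀ i, Feasible (g i)) : Feasible fun v => f fun i => g i v :=
  comp_aux m (hf.rename Sum.inl) hg

theorem comp₁ {f : ℕ → ℕ} (hf : Feasible fun v : Fin 1 → ℕ => f (v 0)) {a : (ι → ℕ) → ℕ}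
    (ha : Feasible a) : Feasible fun v => f (a v) :=
  hf.comp (g := ![a]) (by simp [ha])

theorem comp₂ {f : ℕ → ℕ → ℕ} (hf : Feasible fun v : Fin 2 → ℕ => f (v 0) (v 1))
    {a b : (ι → ℕ) → ℕ} (ha : Feasible a) (hb : Feasible b) : Feasible fun v => f (a v) (b v) :=
  hf.comp (g := ![a, b]) (by simp [Fin.forall_fin_succ, ha, hb])

theorem comp₃ {f : ℕ → ℕ → ℕ → ℕ} (hf : Feasible fun v : Fin 3 → ℕ => f (v 0) (v 1) (v 2))
    {a b c : (ι → ℕ) → ℕ} (ha : Feasible a) (hb : Feasible b) (hc : Feasible c) :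
    Feasible fun v => f (a v) (b v) (c v) :=
  hf.comp (g := ![a, b, c]) (by simp [Fin.forall_fin_succ, ha, hb, hc])

/-! ### Arithmetic -/

@[fun_prop]
theorem add {f g : (ι → ℕ) → ℕ} (hf : Feasible f) (hg : Feasible g) :
    Feasible fun v => f v + g v := by
  obtain ⟨c, hc⟩ := hf.bound
  obtain ⟨d, hd⟩ := hg.bound
  refine natRec (R := fun v i => f v + i) (g := fun w => w none + 1) hg hf (var none).succ
    (fun v => rfl) (fun v i => rfl) ((PolyBdd.pow c).add (.pow d)) fun M hM v hv i hi => ?_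
  have := hc M hM v hv
  have := hd M hM v hv
  show f v + i ≤ _
  omega

@[fun_prop]
theorem sum {b : (ι → ℕ) → ℕ} {F : (ι → ℕ) → ℕ → ℕ} (hb : Feasible b)
    (hF : Feasible fun w : Option ι → ℕ => F (fun i => w (some i)) (w none)) :
    Feasible fun v => ∑ j ∈ Finset.range (b v), F v j := by
  obtain ⟨c, hc⟩ := hb.bound
  obtain ⟨d, hd⟩ := hF.bound
  have hF' : Feasible fun w : Option (Option ι) → ℕ =>
      F (fun i => w (some (some i))) (w (some none)) := hF.rename some
  refine natRec (R := fun v n => ∑ j ∈ Finset.range n, F v j) hb (const 0) ((var none).add hF')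
    (fun v => rfl) (fun v i => Finset.sum_range_succ _ _)
    (B := fun M => M ^ c * (M ^ (c + 1)) ^ d) ((PolyBdd.pow c).mul (.powPow (.pow _) d))
    fun M hM v hv i hi => ?_
  refine (Finset.sum_le_card_nsmul _ _ ((M ^ (c + 1)) ^ d) fun j hj => ?_).trans ?_
  · have hbv := hc M hM v hv
    refine hd _ (hM.trans (le_powSucc hM c)) (ext j v) ?_
    rintro (_ | i)
    · have := Finset.mem_range.1 hj
      have := pow_le_powSucc hM c
      simp only [ext]; omega
    · exact (hv i).trans (le_powSucc hM c)
  · rw [Finset.card_range, smul_eq_mul]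
    exact Nat.mul_le_mul_right _ (hi.trans (hc M hM v hv))

@[fun_prop]
theorem mul {f g : (ι → ℕ) → ℕ} (hf : Feasible f) (hg : Feasible g) :
    Feasible fun v => f v * g v := by
  have := hf.sum (F := fun v _ => g v) (hg.rename some)
  simpa using this

/-- Primitive recursion with a feasible bound. -/
theorem boundedRec {b f h : (ι → ℕ) → ℕ} {g : (ι → ℕ) → ℕ → ℕ → ℕ} (R : (ι → ℕ) → ℕ → ℕ)
    (hb : Feasible b) (hf : Feasible f)
    (hg : Feasible fun w : Option (Option ι) → ℕ =>
      g (fun i => w (some (some i))) (w (some none)) (w none))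
    (h0 : ∀ v, R v 0 = f v) (hS : ∀ v i, R v (i + 1) = g v i (R v i)) (hh : Feasible h)
    (hle : ∀ v, ∀ i ≤ b v, R v i ≤ h v) : Feasible fun v => R v (b v) := by
  obtain ⟨c, hc⟩ := hh.bound
  exact natRec hb hf hg h0 hS (.pow c) fun M hM v hv i hi => (hle v i hi).trans (hc M hM v hv)

/-- The recursion step returns its index and forgets the previous value, so the result lags one
behind. -/
theorem pred {f : (ι → ℕ) → ℕ} (hf : Feasible f) : Feasible fun v => f v - 1 :=
  boundedRec (g := fun _ i _ => i) (fun _ n => n - 1) hf (const 0) (var (some none))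
    (fun _ => rfl) (fun _ _ => rfl) hf fun _ _ hi => (Nat.sub_le _ _).trans hi

@[fun_prop]
theorem sub {f g : (ι → ℕ) → ℕ} (hf : Feasible f) (hg : Feasible g) :
    Feasible fun v => f v - g v :=
  boundedRec (g := fun _ _ a => a - 1) (fun v n => f v - n) hg hf (var none).pred
    (fun _ => rfl) (fun _ _ => rfl) hf fun _ _ _ => Nat.sub_le _ _

end Feasible

/-! ### Decidable predicates -/

/-- `P` has a feasible characteristic function. -/
@[fun_prop]
def Decides {ι : Type} (P : (ι → ℕ) → Prop) : Prop := ∃ χ, Feasible χ ∧ ∀ v, P v ↔ χ v ≠ 0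

namespace Decides

variable {ι : Type} {P Q : (ι → ℕ) → Prop} {f g : (ι → ℕ) → ℕ}

@[fun_prop]
theorem and (hP : Decides P) (hQ : Decides Q) : Decides fun v => P v ∧ Q v := by
  obtain ⟨χ, h, h'⟩ := hP
  obtain ⟨θ, k, k'⟩ := hQ
  exact ⟨fun v => χ v * θ v, by fun_prop, fun v => by simp [h', k']⟩

@[fun_prop]
theorem le (hf : Feasible f) (hg : Feasible g) : Decides fun v => f v ≤ g v :=
  ⟨fun v => 1 - (f v - g v), by fun_prop, fun v => by beta_reduce; omega⟩

@[fun_prop]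
theorem lt (hf : Feasible f) (hg : Feasible g) : Decides fun v => f v < g v :=
  ⟨fun v => g v - f v, by fun_prop, fun v => by beta_reduce; omega⟩

@[fun_prop]
theorem eq (hf : Feasible f) (hg : Feasible g) : Decides fun v => f v = g v :=
  ⟨fun v => 1 - ((f v - g v) + (g v - f v)), by fun_prop, fun v => by beta_reduce; omega⟩

theorem comp {m : ℕ} {P : (Fin m → ℕ) → Prop} (hP : Decides P) {g : Fin m → (ι → ℕ) → ℕ}
    (hg : ∀ i, Feasible (g i)) : Decides fun v => P fun i => g i v :=
  let ⟨χ, h, h'⟩ := hP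
  ⟨fun v => χ fun i => g i v, h.comp hg, fun _ => h' _⟩

end Decides

namespace Feasible

variable {ι : Type}

@[fun_prop]
theorem ifThenElse {f g : (ι → ℕ) → ℕ} {P : (ι → ℕ) → Prop} [∀ v, Decidable (P v)]
    (hP : Decides P) (hf : Feasible f) (hg : Feasible g) :
    Feasible fun v => if P v then f v else g v := by
  obtain ⟨χ, h, h'⟩ := hP
  convert ite h hg hf using 2 with v
  simp only [h', ne_eq, ite_not]

end Feasible

namespace Decides

variable {ι : Type}

@[fun_prop]
theorem ball {b : (ι → ℕ) → ℕ} {P : (ι → ℕ) → ℕ → Prop} (hb : Feasible b)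
    (hP : Decides fun w : Option ι → ℕ => P (fun i => w (some i)) (w none)) :
    Decides fun v => ∀ j < b v, P v j := by
  classical
  refine ⟨fun v => 1 - ∑ j ∈ Finset.range (b v), if P v j then 0 else 1, ?_, fun v => ?_⟩
  · refine (Feasible.const 1).sub (hb.sum ?_)
    exact Feasible.ifThenElse hP (Feasible.const 0) (Feasible.const 1)
  · rw [← Nat.pos_iff_ne_zero, Nat.sub_pos_iff_lt, Nat.lt_one_iff, Finset.sum_eq_zero_iff]
    simp

end Decides

namespace Feasible

variable {ι : Type} {f g : (ι → ℕ) → ℕ}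

@[fun_prop]
theorem min (hf : Feasible f) (hg : Feasible g) : Feasible fun v => min (f v) (g v) := by
  have : Feasible fun v => f v - (f v - g v) := by fun_prop
  convert this using 2
  omega

-- The quotient of `a` by `b > 0` is the number of `j < a` with `(j + 1) * b ≤ a`; square roots are
-- counted in the same way.
@[fun_prop]
theorem div (hf : Feasible f) (hg : Feasible g) : Feasible fun v => f v / g v := by
  have h : Feasible fun v : Fin 2 → ℕ => if v 1 = 0 then 0 else
    ∑ j ∈ Finset.range (v 0), if (j + 1) * v 1 ≤ v 0 then 1 else 0 := by fun_prop
  convert h.comp₂ (f := fun a b => if b = 0 then 0 else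
    ∑ j ∈ Finset.range a, if (j + 1) * b ≤ a then 1 else 0) hf hg using 2 with v
  split_ifs with h0
  · simp [h0]
  · have hpos := Nat.pos_of_ne_zero h0
    rw [← Finset.sum_filter, Finset.sum_const, smul_eq_mul, mul_one]
    have : (Finset.range (f v)).filter (fun j => (j + 1) * g v ≤ f v) =
        Finset.range (f v / g v) := by
      ext j
      have := Nat.div_le_self (f v) (g v)
      simp only [Finset.mem_filter, Finset.mem_range, ← Nat.le_div_iff_mul_le hpos]
      omega
    rw [this, Finset.card_range]

@[fun_prop]
theorem mod (hf : Feasible f) (hg : Feasible g) : Feasible fun v => f v % g v := by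
  have : Feasible fun v => f v - g v * (f v / g v) := by fun_prop
  convert this using 2
  exact Nat.mod_eq_sub_mul_div

@[fun_prop]
theorem sqrt (hf : Feasible f) : Feasible fun v => Nat.sqrt (f v) := by
  have h : Feasible fun v : Fin 1 → ℕ =>
    ∑ j ∈ Finset.range (v 0), if (j + 1) * (j + 1) ≤ v 0 then 1 else 0 := by fun_prop
  convert h.comp₁ (f := fun a =>
    ∑ j ∈ Finset.range a, if (j + 1) * (j + 1) ≤ a then 1 else 0) hf using 2 with v
  rw [← Finset.sum_filter, Finset.sum_const, smul_eq_mul, mul_one]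
  have : (Finset.range (f v)).filter (fun j => (j + 1) * (j + 1) ≤ f v) =
      Finset.range (Nat.sqrt (f v)) := by
    ext j
    have := Nat.sqrt_le_self (f v)
    simp only [Finset.mem_filter, Finset.mem_range, ← Nat.le_sqrt]
    omega
  rw [this, Finset.card_range]

@[fun_prop]
theorem pair (hf : Feasible f) (hg : Feasible g) : Feasible fun v => Nat.pair (f v) (g v) := by
  simp only [Nat.pair]
  fun_prop

/-- Iteration of a function that does not increase its argument. -/
theorem iterate {F : (ι → ℕ) → ℕ → ℕ} (hF : Feasible fun w : Option ι → ℕ =>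
      F (fun i => w (some i)) (w none)) (hle : ∀ v y, F v y ≤ y) (hf : Feasible f)
    (hg : Feasible g) : Feasible fun v => (F v)^[f v] (g v) := by
  have hF' : Feasible fun w : Option (Option ι) → ℕ => F (fun i => w (some (some i))) (w none) :=
    hF.rename (fun o : Option ι => o.elim none fun i => some (some i))
  refine boundedRec (g := fun v _ a => F v a) (fun v n => (F v)^[n] (g v)) hf hg hF'
    (fun v => rfl) (fun v i => Function.iterate_succ_apply' _ _ _) hg fun v i _ => ?_
  induction i with
  | zero => exact le_rfl
  | succ i ih => rw [Function.iterate_succ_apply']; exact (hle _ _).trans (ih (by omega))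

end Feasible

/-- The first component of the pair with number `n`. -/
def fstN (n : ℕ) : ℕ := n.unpair.1

/-- The second component of the pair with number `n`. -/
def sndN (n : ℕ) : ℕ := n.unpair.2

@[simp] theorem fstN_pair (a b : ℕ) : fstN (Nat.pair a b) = a := by simp [fstN]

@[simp] theorem sndN_pair (a b : ℕ) : sndN (Nat.pair a b) = b := by simp [sndN]

namespace Feasible

variable {ι : Type} {f : (ι → ℕ) → ℕ}

@[fun_prop]
theorem fstN (hf : Feasible f) : Feasible fun v => fstN (f v) := by
  have : Feasible fun v => if f v - Nat.sqrt (f v) * Nat.sqrt (f v) < Nat.sqrt (f v)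
      then f v - Nat.sqrt (f v) * Nat.sqrt (f v) else Nat.sqrt (f v) := by fun_prop
  convert this using 2 with v
  simp only [_root_.fstN, Nat.unpair]
  split_ifs <;> rfl

@[fun_prop]
theorem sndN (hf : Feasible f) : Feasible fun v => sndN (f v) := by
  have : Feasible fun v => if f v - Nat.sqrt (f v) * Nat.sqrt (f v) < Nat.sqrt (f v)
      then Nat.sqrt (f v) else f v - Nat.sqrt (f v) * Nat.sqrt (f v) - Nat.sqrt (f v) := by fun_prop
  convert this using 2 with v
  simp only [_root_.sndN, Nat.unpair]
  split_ifs <;> rfl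

end Feasible

/-! ### Integer-valued functions -/

/-- `f` is a difference of feasible functions. -/
@[fun_prop]
def FeasibleInt {ι : Type} (f : (ι → ℕ) → ℤ) : Prop :=
  ∃ a b, Feasible a ∧ Feasible b ∧ ∀ v, f v = (a v : ℤ) - b v

namespace FeasibleInt

variable {ι : Type} {f g : (ι → ℕ) → ℤ}

@[fun_prop]
theorem natCast {a : (ι → ℕ) → ℕ} (ha : Feasible a) : FeasibleInt fun v => (a v : ℤ) :=
  ⟨a, fun _ => 0, ha, .const 0, fun v => by simp⟩

@[fun_prop]
theorem zero : FeasibleInt fun _ : ι → ℕ => (0 : ℤ) :=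
  ⟨fun _ => 0, fun _ => 0, .const 0, .const 0, fun v => by simp⟩

@[fun_prop]
theorem add (hf : FeasibleInt f) (hg : FeasibleInt g) : FeasibleInt fun v => f v + g v := by
  obtain ⟨a, b, ha, hb, h⟩ := hf
  obtain ⟨c, d, hc, hd, h'⟩ := hg
  exact ⟨fun v => a v + c v, fun v => b v + d v, by fun_prop, by fun_prop, fun v => by
    beta_reduce; rw [h, h']; push_cast; ring⟩

@[fun_prop]
theorem sub (hf : FeasibleInt f) (hg : FeasibleInt g) : FeasibleInt fun v => f v - g v := by
  obtain ⟨a, b, ha, hb, h⟩ := hf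
  obtain ⟨c, d, hc, hd, h'⟩ := hg
  exact ⟨fun v => a v + d v, fun v => b v + c v, by fun_prop, by fun_prop, fun v => by
    beta_reduce; rw [h, h']; push_cast; ring⟩

@[fun_prop]
theorem mul (hf : FeasibleInt f) (hg : FeasibleInt g) : FeasibleInt fun v => f v * g v := by
  obtain ⟨a, b, ha, hb, h⟩ := hf
  obtain ⟨c, d, hc, hd, h'⟩ := hg
  exact ⟨fun v => a v * c v + b v * d v, fun v => a v * d v + b v * c v, by fun_prop, by fun_prop,
    fun v => by beta_reduce; rw [h, h']; push_cast; ring⟩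

@[fun_prop]
theorem sum {b : (ι → ℕ) → ℕ} {F : (ι → ℕ) → ℕ → ℤ} (hb : Feasible b)
    (hF : FeasibleInt fun w : Option ι → ℕ => F (fun i => w (some i)) (w none)) :
    FeasibleInt fun v => ∑ j ∈ Finset.range (b v), F v j := by
  obtain ⟨c, d, hc, hd, h⟩ := hF
  refine ⟨fun v => ∑ j ∈ Finset.range (b v), c (Feasible.ext j v),
    fun v => ∑ j ∈ Finset.range (b v), d (Feasible.ext j v), hb.sum ?_, hb.sum ?_, fun v => ?_⟩
  · convert hc using 3
    funext i; cases i <;> rfl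
  · convert hd using 3
    funext i; cases i <;> rfl
  · push_cast
    rw [← Finset.sum_sub_distrib]
    exact Finset.sum_congr rfl fun j _ => h (Feasible.ext j v)

@[fun_prop]
theorem ifThenElse {P : (ι → ℕ) → Prop} [∀ v, Decidable (P v)]
    (hP : Decides P) (hf : FeasibleInt f) (hg : FeasibleInt g) :
    FeasibleInt fun v => if P v then f v else g v := by
  obtain ⟨a, b, ha, hb, h⟩ := hf
  obtain ⟨c, d, hc, hd, h'⟩ := hg
  refine ⟨fun v => if P v then a v else c v, fun v => if P v then b v else d v, by fun_prop,
    by fun_prop, fun v => ?_⟩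
  beta_reduce
  rw [h, h']
  split_ifs <;> rfl

@[fun_prop]
theorem le (hf : FeasibleInt f) (hg : FeasibleInt g) : Decides fun v => f v ≤ g v := by
  obtain ⟨a, b, ha, hb, h⟩ := hf
  obtain ⟨c, d, hc, hd, h'⟩ := hg
  have : Decides fun v => a v + d v ≤ c v + b v := by fun_prop
  convert this using 2 with v
  rw [h, h']
  omega

@[fun_prop]
theorem lt (hf : FeasibleInt f) (hg : FeasibleInt g) : Decides fun v => f v < g v := by
  obtain ⟨a, b, ha, hb, h⟩ := hf
  obtain ⟨c, d, hc, hd, h'⟩ := hg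
  have : Decides fun v => a v + d v < c v + b v := by fun_prop
  convert this using 2 with v
  rw [h, h']
  omega

@[fun_prop]
theorem eq (hf : FeasibleInt f) (hg : FeasibleInt g) : Decides fun v => f v = g v := by
  obtain ⟨a, b, ha, hb, h⟩ := hf
  obtain ⟨c, d, hc, hd, h'⟩ := hg
  have : Decides fun v => a v + d v = c v + b v := by fun_prop
  convert this using 2 with v
  rw [h, h']
  omega

end FeasibleInt

/-! ### Decoding a transformer by arithmetic on the number of its code -/

/-! ### Bit strings as numbers -/

/-- The number of a bit string; the first bit is the least significant one. -/
def enc : List Bool → ℕ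
  -- The leading one marks the end, so trailing `false` bits are not lost. Dropping the first bit is
  -- division by two, and a position inside a code is represented by the number of the remaining
  -- suffix.
  | [] => 1
  | b :: l => 2 * enc l + b.toNat

theorem enc_pos (l : List Bool) : 0 < enc l := by
  cases l with
  | nil => exact Nat.one_pos
  | cons b l => have := enc_pos l; simp only [enc]; omega

theorem enc_cons_mod (b : Bool) (l : List Bool) : enc (b :: l) % 2 = b.toNat := by
  cases b <;> simp [enc, Nat.add_mod]

theorem enc_cons_div (b : Bool) (l : List Bool) : enc (b :: l) / 2 = enc l := by
  cases b <;> simp only [enc, Bool.toNat_true, Bool.toNat_false] <;> omega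

theorem two_pow_le_enc (l : List Bool) : 2 ^ l.length ≤ enc l := by
  induction l with
  | nil => exact le_rfl
  | cons b l ih => simp only [enc, List.length_cons, pow_succ]; omega

theorem enc_lt_two_pow (l : List Bool) : enc l < 2 ^ (l.length + 1) := by
  induction l with
  | nil => norm_num [enc]
  | cons b l ih =>
    have := Bool.toNat_le b
    simp only [enc, List.length_cons]
    rw [pow_succ]; omega

theorem length_le_enc (l : List Bool) : l.length ≤ enc l :=
  l.length.lt_two_pow_self.le.trans (two_pow_le_enc l)

theorem enc_le_append (l l' : List Bool) : enc l' ≤ enc (l ++ l') := by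
  induction l with
  | nil => exact le_rfl
  | cons b l ih => simp only [List.cons_append, enc]; omega

/-! ### Reading numbers -/

/-- The number whose code is at the front of a bit string, read up to a given number of digits. -/
def natValAux : ℕ → ℕ → ℕ
  | 0, _ => 0
  | k + 1, Y => if Y % 2 = 0 then 0 else Y / 2 % 2 + 2 * natValAux k (Y / 4)

/-- The number whose code is at the front of a bit string. -/
def natVal (Y : ℕ) : ℕ := natValAux Y Y

/-- Drops one digit of the code of a number. -/
def natStep (Y : ℕ) : ℕ := if Y % 2 = 0 then Y else Y / 4

/-- Drops the code of a number. -/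
def skipNat (Y : ℕ) : ℕ := natStep^[Y] Y / 2

theorem natCode_zero : natCode 0 = [false] := rfl

theorem natCode_bit (b : Bool) (n : ℕ) (h : n = 0 → b = true) :
    natCode (Nat.bit b n) = true :: b :: natCode n := by
  simp [natCode, Nat.bits_append_bit n b h]

/-- Any fuel from the length of the code on is good enough, because both recursions stop changing at
the terminating bit `false`. A bit string is no longer than its number, so `natVal` and `skipNat`
may use the number itself as fuel. -/
theorem natCode_reads (m : ℕ) (z : List Bool) : ∀ k, (natCode m).length ≤ k →
    natValAux k (enc (natCode m ++ z)) = m ∧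
      natStep^[k] (enc (natCode m ++ z)) = enc (false :: z) := by
  induction m using Nat.binaryRec' with
  | zero =>
    intro k hk
    have h2 : natStep (enc (false :: z)) = enc (false :: z) := by
      rw [natStep, enc_cons_mod]; rfl
    rw [natCode_zero, List.singleton_append]
    refine ⟨?_, Function.iterate_fixed h2 k⟩
    cases k with
    | zero => rfl
    | succ k => rw [natValAux, enc_cons_mod]; rfl
  | bit b n h ih =>
    intro k hk
    rw [natCode_bit b n h] at hk ⊢
    obtain ⟨k, rfl⟩ : ∃ k', k = k' + 1 := ⟨k - 1, by simp at hk; omega⟩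
    obtain ⟨h1, h2⟩ := ih k (by simp at hk; omega)
    have e : enc (true :: b :: natCode n ++ z) / 4 = enc (natCode n ++ z) := by
      rw [show 4 = 2 * 2 from rfl, ← Nat.div_div_eq_div_mul]
      simp only [List.cons_append]
      rw [enc_cons_div, enc_cons_div]
    have e1 : enc (true :: b :: natCode n ++ z) % 2 = 1 := enc_cons_mod _ _
    have e2 : enc (true :: b :: natCode n ++ z) / 2 % 2 = b.toNat := by
      simp only [List.cons_append]
      rw [enc_cons_div, enc_cons_mod]
    constructor
    · rw [natValAux, e, e1, e2, h1, if_neg one_ne_zero, Nat.bit_val]; ring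
    · rw [Function.iterate_succ_apply, natStep, e, e1, if_neg one_ne_zero, h2]

theorem length_le_enc_append (l z : List Bool) : l.length ≤ enc (l ++ z) :=
  (by simp : l.length ≤ (l ++ z).length).trans (length_le_enc _)

theorem natVal_enc (m : ℕ) (z : List Bool) : natVal (enc (natCode m ++ z)) = m :=
  (natCode_reads m z _ (length_le_enc_append _ _)).1

theorem skipNat_enc (m : ℕ) (z : List Bool) : skipNat (enc (natCode m ++ z)) = enc z := by
  rw [skipNat, (natCode_reads m z _ (length_le_enc_append _ _)).2, enc_cons_div]

theorem natValAux_le (k Y : ℕ) : natValAux k Y ≤ Y := by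
  induction k generalizing Y with
  | zero => exact Nat.zero_le _
  | succ k ih =>
    have := ih (Y / 4)
    rw [natValAux]
    split_ifs <;> omega

theorem natVal_le (Y : ℕ) : natVal Y ≤ Y := natValAux_le Y Y

theorem natStep_le (Y : ℕ) : natStep Y ≤ Y := by
  rw [natStep]; split_ifs <;> omega

theorem skipNat_le (Y : ℕ) : skipNat Y ≤ Y :=
  (Nat.div_le_self _ _).trans (Function.iterate_le_id_of_le_id (f := natStep) natStep_le Y Y)

/-! ### Reading rational numbers -/

/-- Drops the code of a rational number. -/
def skipRat (Y : ℕ) : ℕ := skipNat (skipNat (Y / 2))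

/-- Drops the codes of `t` rational numbers. -/
def ratPos (Y t : ℕ) : ℕ := skipRat^[t] Y

/-- The positive part of the numerator of the `t`-th rational number of a sequence. -/
def posAt (Y t : ℕ) : ℕ := if ratPos Y t % 2 = 0 then natVal (ratPos Y t / 2) else 0

/-- The negative part of the numerator of the `t`-th rational number of a sequence. -/
def negAt (Y t : ℕ) : ℕ := if ratPos Y t % 2 = 0 then 0 else natVal (ratPos Y t / 2)

/-- The denominator of the `t`-th rational number of a sequence. -/
def denAt (Y t : ℕ) : ℕ := natVal (skipNat (ratPos Y t / 2))

theorem skipRat_le (Y : ℕ) : skipRat Y ≤ Y :=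
  (skipNat_le _).trans ((skipNat_le _).trans (Nat.div_le_self _ _))

theorem ratCode_append (q : ℚ) (z : List Bool) : ratCode q ++ z =
    decide (q < 0) :: (natCode q.num.natAbs ++ (natCode q.den ++ z)) := by
  simp [ratCode]

theorem skipRat_enc (q : ℚ) (z : List Bool) : skipRat (enc (ratCode q ++ z)) = enc z := by
  rw [skipRat, ratCode_append, enc_cons_div, skipNat_enc, skipNat_enc]

theorem ratPos_enc (qs : List ℚ) (z : List Bool) (t : ℕ) (ht : t ≤ qs.length) :
    ratPos (enc (qs.flatMap ratCode ++ z)) t = enc ((qs.drop t).flatMap ratCode ++ z) := by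
  induction t generalizing qs with
  | zero => rfl
  | succ t ih =>
    cases qs with
    | nil => simp at ht
    | cons q qs =>
      rw [ratPos, Function.iterate_succ_apply, List.flatMap_cons, List.append_assoc, skipRat_enc]
      exact ih qs (by simpa using ht)

theorem ratPos_enc_length (qs : List ℚ) (z : List Bool) :
    ratPos (enc (qs.flatMap ratCode ++ z)) qs.length = enc z := by
  simp [ratPos_enc qs z _ le_rfl]

theorem ratPos_enc_get (qs : List ℚ) (z : List Bool) (t : ℕ) (ht : t < qs.length) :
    ∃ z', ratPos (enc (qs.flatMap ratCode ++ z)) t = enc (ratCode qs[t] ++ z') := by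
  rw [ratPos_enc qs z _ ht.le, List.drop_eq_getElem_cons ht, List.flatMap_cons, List.append_assoc]
  exact ⟨_, rfl⟩

theorem denAt_enc (qs : List ℚ) (z : List Bool) (t : ℕ) (ht : t < qs.length) :
    denAt (enc (qs.flatMap ratCode ++ z)) t = qs[t].den := by
  obtain ⟨z', h⟩ := ratPos_enc_get qs z t ht
  rw [denAt, h, ratCode_append, enc_cons_div, skipNat_enc, natVal_enc]

theorem posAt_sub_negAt_enc (qs : List ℚ) (z : List Bool) (t : ℕ) (ht : t < qs.length) :
    (posAt (enc (qs.flatMap ratCode ++ z)) t : ℤ) - negAt (enc (qs.flatMap ratCode ++ z)) t =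
      qs[t].num := by
  obtain ⟨z', h⟩ := ratPos_enc_get qs z t ht
  rw [posAt, negAt, h, ratCode_append, enc_cons_div, enc_cons_mod, natVal_enc]
  by_cases hq : qs[t] < 0
  · have : qs[t].num < 0 := Rat.num_neg.2 hq
    simp only [hq, decide_true, Bool.toNat_true, one_ne_zero, if_false]
    omega
  · have : ¬ qs[t].num < 0 := fun h => hq (Rat.num_neg.1 h)
    simp only [hq, decide_false, Bool.toNat_false, if_true]
    omega

/-! ### Common denominators -/

/-- The product of the first `n` denominators, cut off at `Y`. -/
def denProd (Y : ℕ) : ℕ → ℕ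
  | 0 => 1
  | n + 1 => min (denProd Y n * denAt Y n) (Y + 1)

theorem denProd_le (Y n : ℕ) : denProd Y n ≤ Y + 1 := by
  cases n with
  | zero => exact Nat.le_add_left _ _
  | succ n => exact min_le_right _ _

theorem lt_two_pow_length_natCode (m : ℕ) : m < 2 ^ (natCode m).length := by
  have h : ∀ m, m < 2 ^ m.bits.length := by
    intro m
    induction m using Nat.binaryRec' with
    | zero => simp
    | bit b n h ih =>
      rw [Nat.bits_append_bit n b h, List.length_cons, pow_succ, Nat.bit_val]
      have := Bool.toNat_le b
      omega
  refine (h m).trans_le (Nat.pow_le_pow_right (by norm_num) ?_)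
  simp only [natCode, List.length_append, List.length_flatMap]
  simp
  omega

theorem den_le_two_pow (q : ℚ) : q.den ≤ 2 ^ (ratCode q).length := by
  refine (lt_two_pow_length_natCode q.den).le.trans (Nat.pow_le_pow_right (by norm_num) ?_)
  simp [ratCode]
  omega

/-- Each denominator is written in the code and is thus at most `2` to the length of its part, and
the lengths add up. This bounds common denominators, for the decoder as well as for the vectors of a
run. -/
theorem prod_den_le (qs : List ℚ) :
    (qs.map Rat.den).prod ≤ 2 ^ (qs.flatMap ratCode).length := by
  induction qs with
  | nil => simp
  | cons q qs ih =>
    rw [List.map_cons, List.prod_cons, List.flatMap_cons, List.length_append, pow_add]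
    exact Nat.mul_le_mul (den_le_two_pow q) ih

/-- The cut-off in `denProd` only serves to bound it on numbers that are not codes. On a code it is
never reached: the product is at most `2` to the length, hence at most the number of the string. -/
theorem denProd_enc (qs : List ℚ) (z : List Bool) (n : ℕ) (hn : n ≤ qs.length) :
    denProd (enc (qs.flatMap ratCode ++ z)) n = ((qs.take n).map Rat.den).prod := by
  induction n with
  | zero => simp [denProd]
  | succ n ih =>
    have h1 := prod_den_le (qs.take (n + 1))
    have h2 : 2 ^ ((qs.take (n + 1)).flatMap ratCode).length ≤
        enc (qs.flatMap ratCode ++ z) := by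
      refine le_trans (Nat.pow_le_pow_right (by norm_num) ?_) (two_pow_le_enc _)
      conv_rhs => rw [← List.take_append_drop (n + 1) qs, List.flatMap_append, List.append_assoc,
        List.length_append]
      omega
    rw [denProd, ih (by omega), denAt_enc _ _ _ hn]
    rw [List.take_succ_eq_append_getElem hn] at h1 h2 ⊢
    simp only [List.map_append, List.prod_append, List.map_cons, List.map_nil, List.prod_cons,
      List.prod_nil, mul_one] at h1 ⊢
    exact min_eq_left (by omega)

/-- The `t`-th rational number of a sequence of length `n`, times the product of all
denominators. -/
def entry (Y n t : ℕ) : ℤ := ((posAt Y t : ℤ) - negAt Y t) * (denProd Y n / denAt Y t : ℕ)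

theorem denProd_pos_enc (qs : List ℚ) (z : List Bool) :
    0 < denProd (enc (qs.flatMap ratCode ++ z)) qs.length := by
  rw [denProd_enc qs z _ le_rfl]
  refine Nat.pos_of_ne_zero fun h => ?_
  obtain ⟨q, -, hq⟩ := List.mem_map.1 (List.prod_eq_zero_iff.1 h)
  exact q.den_ne_zero hq

theorem entry_enc (qs : List ℚ) (z : List Bool) (t : ℕ) (ht : t < qs.length) :
    (entry (enc (qs.flatMap ratCode ++ z)) qs.length t : ℚ) =
      denProd (enc (qs.flatMap ratCode ++ z)) qs.length * qs[t] := by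
  -- By divisibility, the natural-number quotient in `entry` is exact.
  have hd : qs[t].den ∣ denProd (enc (qs.flatMap ratCode ++ z)) qs.length := by
    rw [denProd_enc qs z _ le_rfl, List.take_length]
    exact List.dvd_prod (List.mem_map_of_mem (List.getElem_mem ht))
  rw [entry, posAt_sub_negAt_enc qs z t ht, denAt_enc qs z t ht]
  have h0 : (qs[t].den : ℚ) ≠ 0 := by exact_mod_cast qs[t].den_ne_zero
  rw [Int.cast_mul, Int.cast_natCast, Nat.cast_div hd h0]
  conv_rhs => rw [← Rat.num_div_den qs[t]]
  ring

namespace Feasible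

variable {ι : Type} {f g h : (ι → ℕ) → ℕ}

theorem iterate_div_four {a b : (ι → ℕ) → ℕ} (ha : Feasible a) (hb : Feasible b) :
    Feasible fun v => (fun y => y / 4)^[a v] (b v) :=
  iterate (F := fun _ y => y / 4) (by fun_prop) (fun _ _ => Nat.div_le_self _ _) ha hb

@[fun_prop]
theorem natVal (hf : Feasible f) : Feasible fun v => natVal (f v) := by
  have h0 : Feasible fun w : Option (Option (Fin 1)) → ℕ =>
      (fun y => y / 4)^[w (some (some 0)) - (w (some none) + 1)] (w (some (some 0))) :=
    iterate_div_four (by fun_prop) (by fun_prop)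
  -- `natValAux` consumes its argument from the front, while a bounded recursion builds values from
  -- small fuel upwards. Stage `s` therefore evaluates the suffix left after `v 0 - s` digits. The
  -- guard `s ≤ v 0` makes the recursion equation hold for all `s`, also where the subtraction is
  -- truncated.
  have h1 : Feasible fun v : Fin 1 → ℕ => if v 0 ≤ v 0 then
      natValAux (v 0) ((fun y => y / 4)^[v 0 - v 0] (v 0)) else 0 := by
    refine boundedRec (b := fun v => v 0) (f := fun _ => 0) (h := fun v => v 0)
      (g := fun v s a => if s < v 0 then (if (fun y => y / 4)^[v 0 - (s + 1)] (v 0) % 2 = 0 then 0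
        else (fun y => y / 4)^[v 0 - (s + 1)] (v 0) / 2 % 2 + 2 * a) else 0)
      (fun v s => if s ≤ v 0 then natValAux s ((fun y => y / 4)^[v 0 - s] (v 0)) else 0)
      (var 0) (const 0) ?_ ?_ ?_ (var 0) ?_
    · have h2 := (h0.mod (const 2))
      have h3 := ((h0.div (const 2)).mod (const 2)).add ((const 2).mul (var none))
      exact ifThenElse (by fun_prop) (ifThenElse (Decides.eq h2 (const 0)) (const 0) h3) (const 0)
    · intro v; simp [natValAux]
    · intro v s
      by_cases hs : s < v 0
      · rw [if_pos (Nat.succ_le_of_lt hs), if_pos hs, if_pos hs.le, natValAux,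
          ← Function.iterate_succ_apply' (fun y => y / 4)]
        rw [show (v 0 - (s + 1)).succ = v 0 - s by omega]
      · rw [if_neg (by omega), if_neg hs]
    · intro v s _
      split_ifs
      · exact (natValAux_le _ _).trans
          (Function.iterate_le_id_of_le_id (f := fun y => y / 4) (fun y => Nat.div_le_self y 4) _ _)
  simp only [Nat.sub_self, le_refl, if_true] at h1
  exact h1.comp₁ (f := fun Y => natValAux Y Y) hf

@[fun_prop]
theorem natStep (hf : Feasible f) : Feasible fun v => natStep (f v) := by
  unfold _root_.natStep
  fun_prop

@[fun_prop]
theorem skipNat (hf : Feasible f) : Feasible fun v => skipNat (f v) := by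
  have h1 : Feasible fun v : ι → ℕ => _root_.natStep^[f v] (f v) :=
    iterate (F := fun _ y => _root_.natStep y) (by fun_prop) (fun _ => natStep_le) hf hf
  unfold _root_.skipNat
  fun_prop

@[fun_prop]
theorem skipRat (hf : Feasible f) : Feasible fun v => skipRat (f v) := by
  unfold _root_.skipRat
  fun_prop

@[fun_prop]
theorem ratPos (hf : Feasible f) (hg : Feasible g) : Feasible fun v => ratPos (f v) (g v) :=
  iterate (F := fun _ y => _root_.skipRat y) (by fun_prop) (fun _ => skipRat_le) hg hf

@[fun_prop]
theorem posAt (hf : Feasible f) (hg : Feasible g) : Feasible fun v => posAt (f v) (g v) := by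
  unfold _root_.posAt
  fun_prop

@[fun_prop]
theorem negAt (hf : Feasible f) (hg : Feasible g) : Feasible fun v => negAt (f v) (g v) := by
  unfold _root_.negAt
  fun_prop

@[fun_prop]
theorem denAt (hf : Feasible f) (hg : Feasible g) : Feasible fun v => denAt (f v) (g v) := by
  unfold _root_.denAt
  fun_prop

@[fun_prop]
theorem denProd (hf : Feasible f) (hg : Feasible g) : Feasible fun v => denProd (f v) (g v) := by
  have h1 : Feasible fun v : Fin 2 → ℕ => _root_.denProd (v 0) (v 1) :=
    boundedRec (g := fun v n a => Min.min (a * _root_.denAt (v 0) n) (v 0 + 1))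
      (fun v n => _root_.denProd (v 0) n) (var 1) (const 1) (by fun_prop) (fun _ => rfl)
      (fun _ _ => rfl) (var 0).succ fun v i _ => denProd_le _ _
  exact h1.comp₂ hf hg

@[fun_prop]
theorem entry (hf : Feasible f) (hg : Feasible g) (hh : Feasible h) :
    FeasibleInt fun v => entry (f v) (g v) (h v) := by
  unfold _root_.entry
  fun_prop

end Feasible

/-! ### Affine maps -/

/-- The entries of a matrix, row by row. -/
def matEntries {n m : ℕ} (M : Fin n → Fin m → ℚ) : List ℚ :=
  (List.ofFn fun i => List.ofFn (M i)).flatten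

theorem tupleCode_tupleCode {n m : ℕ} (M : Fin n → Fin m → ℚ) :
    tupleCode (tupleCode ratCode) M = (matEntries M).flatMap ratCode := by
  have h : (List.ofFn fun i => List.ofFn (M i)) = (List.ofFn M).map fun x => List.ofFn x := by
    rw [List.map_ofFn]; rfl
  rw [tupleCode, matEntries, h, ← List.flatMap_def, List.flatMap_assoc]
  rfl

theorem matEntries_eq {n m : ℕ} (M : Fin n → Fin m → ℚ) :
    matEntries M = List.ofFn fun t : Fin (n * m) =>
      M (finProdFinEquiv.symm t).1 (finProdFinEquiv.symm t).2 := by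
  rw [List.ofFn_mul]
  refine congrArg List.flatten (congrArg List.ofFn (funext fun i => congrArg List.ofFn
    (funext fun j => ?_)))
  have : (⟨i * m + j, by
      calc (i : ℕ) * m + j < (i + 1) * m := by rw [add_mul, one_mul]; omega
        _ ≤ n * m := Nat.mul_le_mul_right _ i.isLt⟩ : Fin (n * m)) = finProdFinEquiv (i, j) := by
    apply Fin.ext
    simp [finProdFinEquiv]
    ring
  rw [this, Equiv.symm_apply_apply]

theorem length_matEntries {n m : ℕ} (M : Fin n → Fin m → ℚ) : (matEntries M).length = n * m := by
  rw [matEntries_eq, List.length_ofFn]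

theorem index_lt {n m i j : ℕ} (hi : i < n) (hj : j < m) : i * m + j < n * m :=
  calc i * m + j < (i + 1) * m := by rw [add_mul, one_mul]; omega
    _ ≤ n * m := Nat.mul_le_mul_right _ hi

theorem getElem_matEntries {n m : ℕ} (M : Fin n → Fin m → ℚ) (i : Fin n) (j : Fin m)
    (h : i * m + j < (matEntries M).length) : (matEntries M)[i * m + j] = M i j := by
  have e : (⟨i * m + j, by simpa [length_matEntries] using h⟩ : Fin (n * m)) =
      finProdFinEquiv (i, j) := by
    apply Fin.ext
    simp [finProdFinEquiv]
    ring
  simp only [matEntries_eq, List.getElem_ofFn]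
  rw [e, Equiv.symm_apply_apply]

namespace QAffine

variable {m n : ℕ}

/-- The entries of the matrix and of the bias. -/
def entries (A : QAffine m n) : List ℚ := matEntries (fun i j => A.mat i j) ++ List.ofFn A.bias

theorem code_eq (A : QAffine m n) : A.code = A.entries.flatMap ratCode := by
  rw [entries, List.flatMap_append, ← tupleCode_tupleCode]
  rfl

theorem length_entries (A : QAffine m n) : A.entries.length = n * m + n := by
  rw [entries, List.length_append, length_matEntries, List.length_ofFn]

theorem getElem_entries_mat (A : QAffine m n) (i : Fin n) (j : Fin m)
    (h : i * m + j < A.entries.length) : A.entries[i * m + j] = A.mat i j := by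
  have h' : i * m + j < (matEntries fun i j => A.mat i j).length := by
    rw [length_matEntries]; exact index_lt i.isLt j.isLt
  simp only [entries]
  rw [List.getElem_append_left h', getElem_matEntries]

theorem getElem_entries_bias (A : QAffine m n) (i : Fin n)
    (h : n * m + i < A.entries.length) : A.entries[n * m + i] = A.bias i := by
  simp only [entries]
  rw [List.getElem_append_right (by rw [length_matEntries]; omega)]
  simp [length_matEntries]

end QAffine

/-- The numerator of the `i`-th coordinate of the value of an affine map at `x / D`. -/
def affNum (Y cols rows i : ℕ) (x : ℕ → ℤ) (D : ℤ) : ℤ :=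
  ∑ j ∈ Finset.range cols, entry Y (rows * cols + rows) (i * cols + j) * x j +
    entry Y (rows * cols + rows) (rows * cols + i) * D

/-- The denominator that belongs to `affNum`, up to the denominator of the argument. -/
def affDen (Y cols rows : ℕ) : ℕ := denProd Y (rows * cols + rows)

theorem affDen_pos {m n : ℕ} (A : QAffine m n) (z : List Bool) :
    0 < affDen (enc (A.code ++ z)) m n := by
  have := denProd_pos_enc A.entries z
  rwa [A.length_entries, ← A.code_eq] at this

/-- The map is homogenized: with the argument given as `x / D`, the matrix acts on the integers `x`
and the bias is multiplied by `D`, so the common factor is the product of all denominators of the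
map times `D`. -/
theorem affNum_enc {m n : ℕ} (A : QAffine m n) (z : List Bool) (x : ℕ → ℤ) (D : ℤ)
    (y : Fin m → ℚ) (h : ∀ j : Fin m, (x j : ℚ) = D * y j) (i : Fin n) :
    (affNum (enc (A.code ++ z)) m n i x D : ℚ) =
      affDen (enc (A.code ++ z)) m n * D * A.apply y i := by
  have key : ∀ t (ht : t < A.entries.length), (entry (enc (A.code ++ z)) (n * m + n) t : ℚ) =
      affDen (enc (A.code ++ z)) m n * A.entries[t] := by
    intro t ht
    rw [affDen, ← A.length_entries, A.code_eq]
    exact entry_enc A.entries z t ht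
  have hl := A.length_entries
  rw [affNum, QAffine.apply, Finset.sum_range]
  push_cast
  rw [key _ (by omega), A.getElem_entries_bias, Pi.add_apply, mulVec, dotProduct, mul_add,
    Finset.mul_sum]
  congr 1
  · refine Finset.sum_congr rfl fun j _ => ?_
    have := index_lt i.isLt j.isLt
    rw [key _ (by omega), A.getElem_entries_mat, h]
    ring
  · ring

/-! ### Codes of vectors -/

/-- The offset of the digits in codes of vectors. -/
def half (X : ℕ) : ℕ := X * X + 1

/-- The base of codes of vectors. -/
def base (X : ℕ) : ℕ := 2 * half X

/-- A digit of the code of a vector. -/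
def digit (X u j : ℕ) : ℕ := (fun y => y / base X)^[j] u % base X

/-- The denominator of the vector with code `u`. -/
def vecDen (X u : ℕ) : ℕ := digit X u 0 + 1

/-- The numerator of a coordinate of the vector with code `u`. -/
def vecNum (X u j : ℕ) : ℤ := (digit X u (j + 1) : ℤ) - half X

/-- The vector with code `u`. -/
def vecVal (X r u : ℕ) : Fin r → ℚ := fun j => vecNum X u j / vecDen X u

theorem vecDen_pos (X u : ℕ) : (0 : ℚ) < vecDen X u := by
  exact_mod_cast Nat.succ_pos _

theorem vecNum_eq (X r u : ℕ) (j : Fin r) : (vecNum X u j : ℚ) = vecDen X u * vecVal X r u j := by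
  rw [vecVal]
  have := (vecDen_pos X u).ne'
  field_simp

theorem exists_digits (X m : ℕ) (f : ℕ → ℕ) (hf : ∀ j < m, f j < base X) :
    ∃ u < base X ^ m, ∀ j < m, digit X u j = f j := by
  induction m generalizing f with
  | zero => exact ⟨0, by simp, by simp⟩
  | succ m ih =>
    obtain ⟨u, hu, h⟩ := ih (fun j => f (j + 1)) fun j hj => hf _ (by omega)
    have h0 := hf 0 (by omega)
    refine ⟨f 0 + base X * u, ?_, fun j hj => ?_⟩
    · calc f 0 + base X * u < base X * (u + 1) := by rw [mul_add]; omega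
        _ ≤ base X ^ (m + 1) := by
          rw [pow_succ, mul_comm]
          exact Nat.mul_le_mul_right _ hu
    · cases j with
      | zero => rw [digit, Function.iterate_zero, id, Nat.add_mul_mod_self_left, Nat.mod_eq_of_lt h0]
      | succ j =>
        rw [← h j (by omega), digit, digit, Function.iterate_succ_apply,
          Nat.add_mul_div_left _ _ (by omega), Nat.div_eq_of_lt h0, Nat.zero_add]

/-- Digit `0` stores `D - 1`, so that every number denotes a positive denominator. The other digits
store the numerators `D * v j`, whose absolute values are at most `X * X`; adding `half X = X * X +
1` puts them between `0` and `base X`. Codes are not unique, as fractions need not be in lowest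
terms. -/
theorem exists_vecVal (X r D : ℕ) (hD : 0 < D) (hDX : D ≤ X) (v : Fin r → ℚ)
    (hv : ∀ j, ∃ p : ℤ, D * v j = p) (hb : ∀ j, |v j| ≤ X) :
    ∃ u < base X ^ (r + 1), vecVal X r u = v := by
  choose p hp using hv
  have hX : X ≤ X * X := Nat.le_mul_self X
  have hpb : ∀ j, |p j| ≤ X * X := by
    intro j
    have h1 : |(D : ℚ) * v j| ≤ X * X := by
      rw [abs_mul, Nat.abs_cast]
      exact mul_le_mul (by exact_mod_cast hDX) (hb j) (abs_nonneg _) (Nat.cast_nonneg _)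
    rw [hp] at h1
    exact_mod_cast h1
  obtain ⟨u, hu, h⟩ := exists_digits X (r + 1) (fun t => if t = 0 then D - 1 else
    if ht : t - 1 < r then (p ⟨t - 1, ht⟩ + half X).toNat else 0) (by
      intro t _
      split_ifs with h1 h2
      · simp only [base, half]; omega
      · have := abs_le.1 (hpb ⟨t - 1, h2⟩)
        simp only [base, half]; push_cast; omega
      · simp only [base, half]; omega)
  refine ⟨u, hu, funext fun j => ?_⟩
  have hden : vecDen X u = D := by
    rw [vecDen, h 0 (by omega), if_pos rfl]; omega
  have hnum : vecNum X u j = p j := by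
    rw [vecNum, h (j + 1) (by omega), if_neg (by omega), dif_pos (by simp)]
    have := abs_le.1 (hpb j)
    simp only [Nat.add_sub_cancel, Fin.eta, half]
    push_cast
    omega
  rw [vecVal, hden, hnum, ← hp]
  have : (D : ℚ) ≠ 0 := by exact_mod_cast hD.ne'
  field_simp

namespace Feasible

variable {ι : Type} {f g h a b c d : (ι → ℕ) → ℕ}

theorem affNum {x : (ι → ℕ) → ℕ → ℤ} {D : (ι → ℕ) → ℤ} (ha : Feasible a) (hb : Feasible b)
    (hc : Feasible c) (hd : Feasible d) (hx : FeasibleInt fun w : Option ι → ℕ =>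
      x (fun i => w (some i)) (w none)) (hD : FeasibleInt D) :
    FeasibleInt fun v => affNum (a v) (b v) (c v) (d v) (x v) (D v) := by
  have ha' := ha.rename (ι := Option ι) some
  have hb' := hb.rename (ι := Option ι) some
  have hc' := hc.rename (ι := Option ι) some
  have hd' := hd.rename (ι := Option ι) some
  unfold _root_.affNum
  refine FeasibleInt.add (FeasibleInt.sum hb (FeasibleInt.mul ?_ hx)) (FeasibleInt.mul ?_ hD)
  · exact entry ha' ((hc'.mul hb').add hc') ((hd'.mul hb').add (var none))
  · exact entry ha ((hc.mul hb).add hc) ((hc.mul hb).add hd)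

attribute [fun_prop] affNum

@[fun_prop]
theorem affDen (ha : Feasible a) (hb : Feasible b) (hc : Feasible c) :
    Feasible fun v => affDen (a v) (b v) (c v) := by
  unfold _root_.affDen
  fun_prop

@[fun_prop]
theorem half (ha : Feasible a) : Feasible fun v => half (a v) := by
  unfold _root_.half
  fun_prop

@[fun_prop]
theorem base (ha : Feasible a) : Feasible fun v => base (a v) := by
  unfold _root_.base
  fun_prop

-- Iterated division only decreases its argument and is thus feasible, whereas the power `base X ^
-- j` would not be.
@[fun_prop]
theorem digit (ha : Feasible a) (hb : Feasible b) (hc : Feasible c) :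
    Feasible fun v => digit (a v) (b v) (c v) := by
  have h1 : Feasible fun v : Fin 3 → ℕ => (fun y => y / _root_.base (v 0))^[v 2] (v 1) :=
    iterate (F := fun v y => y / _root_.base (v 0)) (by fun_prop)
      (fun _ _ => Nat.div_le_self _ _) (by fun_prop) (by fun_prop)
  have h2 : Feasible fun v : Fin 3 → ℕ => _root_.digit (v 0) (v 1) (v 2) := by
    unfold _root_.digit
    fun_prop
  exact h2.comp₃ ha hb hc

@[fun_prop]
theorem vecDen (ha : Feasible a) (hb : Feasible b) : Feasible fun v => vecDen (a v) (b v) := by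
  unfold _root_.vecDen
  fun_prop

@[fun_prop]
theorem vecNum (ha : Feasible a) (hb : Feasible b) (hc : Feasible c) :
    FeasibleInt fun v => vecNum (a v) (b v) (c v) := by
  unfold _root_.vecNum
  fun_prop

end Feasible

/-! ### Reading layers

A layer is read from its input width `r` and the number `Y` of the bit string that starts with it. -/

/-- The output width of an attention layer. -/
def attWidth (Y : ℕ) : ℕ := natVal (Y / 4)

/-- The position of the first affine map. -/
def posA (Y : ℕ) : ℕ := skipNat (Y / 4)

/-- The position of the second affine map. -/
def posB (r Y : ℕ) : ℕ := ratPos (posA Y) (r * r + r)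

/-- The position of the third affine map. -/
def posC (r Y : ℕ) : ℕ := ratPos (posB r Y) (r * r + r)

/-- The position of the mask. -/
def posMask (r Y : ℕ) : ℕ := ratPos (posC r Y) (attWidth Y * (r + r) + attWidth Y)

/-- The mask, as a number. -/
def maskNum (r Y : ℕ) : ℕ :=
  if posMask r Y % 2 = 0 then 0 else 1 + posMask r Y / 2 % 2

/-- The position of the tie-breaking rule. -/
def posTie (r Y : ℕ) : ℕ := if posMask r Y % 2 = 0 then posMask r Y / 2 else posMask r Y / 4

/-- The tie-breaking rule, as a number. -/
def tieNum (r Y : ℕ) : ℕ := posTie r Y % 2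

/-- The coordinate of a ReLU layer. -/
def reluCoord (Y : ℕ) : ℕ := natVal (Y / 4)

/-- The kind of the next layer: none, ReLU, or attention. -/
def layerKind (Y : ℕ) : ℕ := if Y % 2 = 0 then 0 else 1 + Y / 2 % 2

/-- The width after the next layer. -/
def nextWidth (r Y : ℕ) : ℕ := if layerKind Y = 2 then attWidth Y else r

/-- The position after the next layer. -/
def nextPos (r Y : ℕ) : ℕ :=
  if layerKind Y = 0 then Y else if layerKind Y = 1 then skipNat (Y / 4) else posTie r Y / 2

/-- The position of the token embedding. -/
def posEmb (X : ℕ) : ℕ := skipNat (skipNat X)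

/-- The width of the token embedding. -/
def embWidth (X : ℕ) : ℕ := natVal (skipNat X)

/-- The position of the first layer. -/
def posLayers (X : ℕ) : ℕ := ratPos (posEmb X) (natVal X * embWidth X)

/-- The width and the position after `l` layers. -/
def layerState (X : ℕ) : ℕ → ℕ
  | 0 => Nat.pair (embWidth X) (posLayers X)
  | l + 1 => Nat.pair (nextWidth (fstN (layerState X l)) (sndN (layerState X l)))
      (nextPos (fstN (layerState X l)) (sndN (layerState X l)))

/-- The width after `l` layers. -/
def widthAt (X l : ℕ) : ℕ := fstN (layerState X l)

/-- The position after `l` layers. -/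
def posAfter (X l : ℕ) : ℕ := sndN (layerState X l)

theorem ratPos_le (Y t : ℕ) : ratPos Y t ≤ Y :=
  Function.iterate_le_id_of_le_id (f := skipRat) skipRat_le t Y

theorem posTie_le (r Y : ℕ) : posTie r Y ≤ Y := by
  have h : posMask r Y ≤ Y := (ratPos_le _ _).trans <| (ratPos_le _ _).trans <|
    (ratPos_le _ _).trans <| (skipNat_le _).trans (Nat.div_le_self _ _)
  rw [posTie]
  split_ifs <;> omega

theorem nextPos_le (r Y : ℕ) : nextPos r Y ≤ Y := by
  have h1 := posTie_le r Y
  have h2 := skipNat_le (Y / 4)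
  rw [nextPos]
  split_ifs <;> omega

theorem widthAt_zero (X : ℕ) : widthAt X 0 = embWidth X := fstN_pair _ _

theorem posAfter_zero (X : ℕ) : posAfter X 0 = posLayers X := sndN_pair _ _

theorem widthAt_succ (X l : ℕ) : widthAt X (l + 1) = nextWidth (widthAt X l) (posAfter X l) :=
  fstN_pair _ _

theorem posAfter_succ (X l : ℕ) : posAfter X (l + 1) = nextPos (widthAt X l) (posAfter X l) :=
  sndN_pair _ _

theorem posAfter_le (X l : ℕ) : posAfter X l ≤ X := by
  induction l with
  | zero =>
    rw [posAfter_zero]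
    exact (ratPos_le _ _).trans ((skipNat_le _).trans (skipNat_le _))
  | succ l ih => rw [posAfter_succ]; exact (nextPos_le _ _).trans ih

theorem widthAt_le (X l : ℕ) : widthAt X l ≤ X := by
  induction l with
  | zero => rw [widthAt_zero]; exact (natVal_le _).trans (skipNat_le _)
  | succ l ih =>
    rw [widthAt_succ, nextWidth]
    split_ifs
    · exact (natVal_le _).trans ((Nat.div_le_self _ _).trans (posAfter_le X l))
    · exact ih

/-- This is the a priori bound that `Feasible.boundedRec` needs: for any `X`, widths and positions
are obtained by reading and dropping bits and never exceed `X`. -/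
theorem layerState_le (X l : ℕ) : layerState X l ≤ (X + 1) * (X + 1) := by
  have h : layerState X l = Nat.pair (widthAt X l) (posAfter X l) := (Nat.pair_unpair _).symm
  have h1 := widthAt_le X l
  have h2 := posAfter_le X l
  rw [h]
  refine (Nat.pair_lt_max_add_one_sq _ _).le.trans ?_
  rw [sq]
  exact Nat.mul_self_le_mul_self (by omega)

namespace Feasible

variable {ι : Type} {a b c d : (ι → ℕ) → ℕ}

@[fun_prop]
theorem attWidth (ha : Feasible a) : Feasible fun v => attWidth (a v) := by
  unfold _root_.attWidth; fun_prop

@[fun_prop]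
theorem posA (ha : Feasible a) : Feasible fun v => posA (a v) := by
  unfold _root_.posA; fun_prop

@[fun_prop]
theorem posB (ha : Feasible a) (hb : Feasible b) : Feasible fun v => posB (a v) (b v) := by
  unfold _root_.posB; fun_prop

@[fun_prop]
theorem posC (ha : Feasible a) (hb : Feasible b) : Feasible fun v => posC (a v) (b v) := by
  unfold _root_.posC; fun_prop

@[fun_prop]
theorem posMask (ha : Feasible a) (hb : Feasible b) : Feasible fun v => posMask (a v) (b v) := by
  unfold _root_.posMask; fun_prop

@[fun_prop]
theorem maskNum (ha : Feasible a) (hb : Feasible b) : Feasible fun v => maskNum (a v) (b v) := by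
  unfold _root_.maskNum; fun_prop

@[fun_prop]
theorem posTie (ha : Feasible a) (hb : Feasible b) : Feasible fun v => posTie (a v) (b v) := by
  unfold _root_.posTie; fun_prop

@[fun_prop]
theorem tieNum (ha : Feasible a) (hb : Feasible b) : Feasible fun v => tieNum (a v) (b v) := by
  unfold _root_.tieNum; fun_prop

@[fun_prop]
theorem reluCoord (ha : Feasible a) : Feasible fun v => reluCoord (a v) := by
  unfold _root_.reluCoord; fun_prop

@[fun_prop]
theorem layerKind (ha : Feasible a) : Feasible fun v => layerKind (a v) := by
  unfold _root_.layerKind; fun_prop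

@[fun_prop]
theorem nextWidth (ha : Feasible a) (hb : Feasible b) :
    Feasible fun v => nextWidth (a v) (b v) := by
  unfold _root_.nextWidth; fun_prop

@[fun_prop]
theorem nextPos (ha : Feasible a) (hb : Feasible b) : Feasible fun v => nextPos (a v) (b v) := by
  unfold _root_.nextPos; fun_prop

@[fun_prop]
theorem posEmb (ha : Feasible a) : Feasible fun v => posEmb (a v) := by
  unfold _root_.posEmb; fun_prop

@[fun_prop]
theorem embWidth (ha : Feasible a) : Feasible fun v => embWidth (a v) := by
  unfold _root_.embWidth; fun_prop

@[fun_prop]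
theorem posLayers (ha : Feasible a) : Feasible fun v => posLayers (a v) := by
  unfold _root_.posLayers; fun_prop

@[fun_prop]
theorem layerState (ha : Feasible a) (hb : Feasible b) :
    Feasible fun v => layerState (a v) (b v) := by
  have h1 : Feasible fun v : Fin 2 → ℕ => _root_.layerState (v 0) (v 1) :=
    boundedRec (g := fun v _ s => Nat.pair (_root_.nextWidth (_root_.fstN s) (_root_.sndN s))
        (_root_.nextPos (_root_.fstN s) (_root_.sndN s)))
      (h := fun v => (v 0 + 1) * (v 0 + 1))
      (f := fun v => Nat.pair (_root_.embWidth (v 0)) (_root_.posLayers (v 0)))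
      (fun v n => _root_.layerState (v 0) n) (var 1) (by fun_prop) (by fun_prop) (fun _ => rfl)
      (fun _ _ => rfl) (by fun_prop) fun v i _ => layerState_le _ _
  exact h1.comp₂ ha hb

@[fun_prop]
theorem widthAt (ha : Feasible a) (hb : Feasible b) : Feasible fun v => widthAt (a v) (b v) := by
  unfold _root_.widthAt; fun_prop

@[fun_prop]
theorem posAfter (ha : Feasible a) (hb : Feasible b) :
    Feasible fun v => posAfter (a v) (b v) := by
  unfold _root_.posAfter; fun_prop

end Feasible

/-! ### Reading the codes of layers -/

theorem layerKind_nil (z : List Bool) : layerKind (enc (false :: z)) = 0 := by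
  rw [layerKind, enc_cons_mod]; rfl

theorem layerKind_relu (z : List Bool) : layerKind (enc (true :: false :: z)) = 1 := by
  rw [layerKind, enc_cons_mod, enc_cons_div, enc_cons_mod]; rfl

theorem layerKind_attention (z : List Bool) : layerKind (enc (true :: true :: z)) = 2 := by
  rw [layerKind, enc_cons_mod, enc_cons_div, enc_cons_mod]; rfl

theorem enc_div_four (b b' : Bool) (z : List Bool) : enc (b :: b' :: z) / 4 = enc z := by
  rw [show 4 = 2 * 2 from rfl, ← Nat.div_div_eq_div_mul, enc_cons_div, enc_cons_div]

theorem ratPos_code {m n : ℕ} (A : QAffine m n) (z : List Bool) :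
    ratPos (enc (A.code ++ z)) (n * m + n) = enc z := by
  rw [← A.length_entries, A.code_eq, ratPos_enc_length]

/-- Masks as numbers. -/
def Mask.num : Mask → ℕ
  | .none => 0
  | .future => 1
  | .past => 2

/-- Tie-breaking rules as numbers. -/
def TieBreak.num : TieBreak → ℕ
  | .leftmost => 0
  | .rightmost => 1

section

variable {r m : ℕ} (L : AttentionLayer r m) (z : List Bool)

/-- The bit string that starts with an attention layer. -/
def attCode : List Bool := true :: true :: (natCode m ++ (L.code ++ z))

theorem attWidth_attCode : attWidth (enc (attCode L z)) = m := by
  rw [attWidth, attCode, enc_div_four, natVal_enc]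

theorem posA_attCode : posA (enc (attCode L z)) =
    enc (L.A.code ++ (L.B.code ++ (L.C.code ++ (L.mask.code ++ (L.tie.code ++ z))))) := by
  rw [posA, attCode, enc_div_four, skipNat_enc, AttentionLayer.code]
  simp only [List.append_assoc]

theorem posB_attCode : posB r (enc (attCode L z)) =
    enc (L.B.code ++ (L.C.code ++ (L.mask.code ++ (L.tie.code ++ z)))) := by
  rw [posB, posA_attCode, ratPos_code]

theorem posC_attCode : posC r (enc (attCode L z)) =
    enc (L.C.code ++ (L.mask.code ++ (L.tie.code ++ z))) := by
  rw [posC, posB_attCode, ratPos_code]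

theorem posMask_attCode : posMask r (enc (attCode L z)) =
    enc (L.mask.code ++ (L.tie.code ++ z)) := by
  rw [posMask, posC_attCode, attWidth_attCode, ratPos_code]

theorem maskNum_attCode : maskNum r (enc (attCode L z)) = L.mask.num := by
  rw [maskNum, posMask_attCode]
  cases L.mask <;> simp [Mask.code, Mask.num, enc_cons_mod, enc_cons_div]

theorem posTie_attCode : posTie r (enc (attCode L z)) = enc (L.tie.code ++ z) := by
  rw [posTie, posMask_attCode]
  cases L.mask <;> simp [Mask.code, enc_cons_mod, enc_cons_div, enc_div_four]

theorem tieNum_attCode : tieNum r (enc (attCode L z)) = L.tie.num := by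
  rw [tieNum, posTie_attCode]
  cases L.tie <;> simp [TieBreak.code, TieBreak.num, enc_cons_mod]

theorem nextWidth_attCode : nextWidth r (enc (attCode L z)) = m := by
  rw [nextWidth, attWidth_attCode, attCode, layerKind_attention, if_pos rfl]

theorem nextPos_attCode : nextPos r (enc (attCode L z)) = enc z := by
  rw [nextPos, posTie_attCode, attCode, layerKind_attention, if_neg (by norm_num),
    if_neg (by norm_num)]
  cases L.tie <;> simp [TieBreak.code, enc_cons_div]

end

theorem nextWidth_relu (r : ℕ) (z : List Bool) : nextWidth r (enc (true :: false :: z)) = r := by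
  rw [nextWidth, layerKind_relu, if_neg (by norm_num)]

theorem nextPos_relu (r c : ℕ) (z : List Bool) :
    nextPos r (enc (true :: false :: (natCode c ++ z))) = enc z := by
  rw [nextPos, layerKind_relu, if_neg (by norm_num), if_pos rfl, enc_div_four, skipNat_enc]

theorem reluCoord_enc (c : ℕ) (z : List Bool) :
    reluCoord (enc (true :: false :: (natCode c ++ z))) = c := by
  rw [reluCoord, enc_div_four, natVal_enc]

/-- Reading beyond the last layer changes nothing. The number of layers may therefore be replaced by
the size of the transformer, which the machine knows. -/
theorem nextWidth_nil (r : ℕ) (z : List Bool) : nextWidth r (enc (false :: z)) = r := by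
  rw [nextWidth, layerKind_nil, if_neg (by norm_num)]

theorem nextPos_nil (r : ℕ) (z : List Bool) :
    nextPos r (enc (false :: z)) = enc (false :: z) := by
  rw [nextPos, layerKind_nil, if_pos rfl]

/-! ### Checks on codes of vectors -/

/-- The concatenation of two vectors, over a common denominator. -/
def appendNum (X r u a j : ℕ) : ℤ :=
  if j < r then vecNum X u j * vecDen X a else vecNum X a (j - r) * vecDen X u

/-- `C (u, a) = u'` for an attention layer. -/
def AttCheck (X r Y u a u' : ℕ) : Prop :=
  ∀ i < attWidth Y, affNum (posC r Y) (r + r) (attWidth Y) i (appendNum X r u a)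
      (vecDen X u * vecDen X a : ℕ) * vecDen X u' =
    vecNum X u' i * affDen (posC r Y) (r + r) (attWidth Y) * (vecDen X u * vecDen X a : ℕ)

/-- The numerator of a score. -/
def scoreNum (X r Y u y : ℕ) : ℤ :=
  ∑ i ∈ Finset.range r, affNum (posA Y) r r i (vecNum X u) (vecDen X u) *
    affNum (posB r Y) r r i (vecNum X y) (vecDen X y)

/-- The score of `y` at `u` is larger than that of `a`. -/
def Better (X r Y u a y : ℕ) : Prop :=
  scoreNum X r Y u a * vecDen X y < scoreNum X r Y u y * vecDen X a

/-- The score of `y` at `u` is at least that of `a`. -/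
def BetterEq (X r Y u a y : ℕ) : Prop :=
  scoreNum X r Y u a * vecDen X y ≤ scoreNum X r Y u y * vecDen X a

/-- A ReLU layer maps `u` to `u'`. -/
def ReluCheck (X r Y u u' : ℕ) : Prop :=
  ∀ j < r, (if j = reluCoord Y ∧ vecNum X u j < 0 then 0 else vecNum X u j) * vecDen X u' =
    vecNum X u' j * vecDen X u

/-- The token embedding maps `σ` to `u`. -/
def EmbCheck (X σ u : ℕ) : Prop :=
  ∀ j < embWidth X, ((posAt (posEmb X) (σ * embWidth X + j) : ℤ) -
      negAt (posEmb X) (σ * embWidth X + j)) * vecDen X u =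
    vecNum X u j * denAt (posEmb X) (σ * embWidth X + j)

/-- The vector with code `u` is accepted by the acceptance vector at `Y`. -/
def AccCheck (X r Y u : ℕ) : Prop := 0 < ∑ j ∈ Finset.range r, entry Y r j * vecNum X u j

/-- The vector with code `u` is zero. -/
def ZeroCheck (X r u : ℕ) : Prop := ∀ j < r, vecNum X u j = 0

section

variable {X r m : ℕ} (L : AttentionLayer r m) (z : List Bool) (u a y : ℕ)

theorem appendNum_eq (j : Fin (r + r)) : (appendNum X r u a j : ℚ) =
    ((vecDen X u * vecDen X a : ℕ) : ℤ) * Fin.append (vecVal X r u) (vecVal X r a) j := by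
  push_cast
  refine Fin.addCases (fun j => ?_) (fun j => ?_) j
  · rw [Fin.append_left, appendNum, if_pos (by simp)]
    push_cast
    rw [Fin.val_castAdd, vecNum_eq X r u j]
    ring
  · rw [Fin.append_right, appendNum, if_neg (by simp)]
    push_cast
    rw [Fin.val_natAdd, Nat.add_sub_cancel_left, vecNum_eq X r a j]
    ring

theorem vecVal_apply (i : Fin m) : vecVal X m u i = vecNum X u i / vecDen X u := rfl

/-- Both sides of the check are the rational coordinates multiplied by the same positive factor,
namely the denominators of `C`, `u`, `a` and `u'`. -/
theorem attCheck_iff (u' : ℕ) : AttCheck X r (enc (attCode L z)) u a u' ↔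
    L.C.apply (Fin.append (vecVal X r u) (vecVal X r a)) = vecVal X m u' := by
  rw [AttCheck, attWidth_attCode, posC_attCode, funext_iff]
  have hE : (0 : ℚ) < affDen (enc (L.C.code ++ (L.mask.code ++ (L.tie.code ++ z)))) (r + r) m := by
    exact_mod_cast affDen_pos L.C _
  have h1 := vecDen_pos X u
  have h2 := vecDen_pos X a
  have h3 := vecDen_pos X u'
  have key : ∀ i : Fin m, (affNum (enc (L.C.code ++ (L.mask.code ++ (L.tie.code ++ z)))) (r + r) m i
      (appendNum X r u a) (vecDen X u * vecDen X a : ℕ) * vecDen X u' =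
      vecNum X u' i * affDen (enc (L.C.code ++ (L.mask.code ++ (L.tie.code ++ z)))) (r + r) m *
        (vecDen X u * vecDen X a : ℕ)) ↔
      L.C.apply (Fin.append (vecVal X r u) (vecVal X r a)) i = vecVal X m u' i := by
    intro i
    rw [← @Int.cast_inj ℚ]
    push_cast
    rw [← Nat.cast_mul, affNum_enc L.C _ _ _ _ (appendNum_eq u a), vecVal_apply]
    push_cast
    rw [eq_div_iff h3.ne']
    constructor
    · intro h
      have h0 : (affDen (enc (L.C.code ++ (L.mask.code ++ (L.tie.code ++ z)))) (r + r) m : ℚ) *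
        (vecDen X u * vecDen X a) ≠ 0 := by positivity
      exact mul_left_cancel₀ h0 (by linear_combination h)
    · intro h
      rw [← h]
      ring
  exact ⟨fun h i => (key i).1 (h i i.isLt), fun h i hi => (key ⟨i, hi⟩).2 (h _)⟩

/-- The denominator of the scores. -/
def scoreDen : ℚ := affDen (posA (enc (attCode L z))) r r * affDen (posB r (enc (attCode L z))) r r

theorem scoreDen_pos : 0 < scoreDen L z := by
  rw [scoreDen, posA_attCode, posB_attCode]
  have h1 := affDen_pos L.A (L.B.code ++ (L.C.code ++ (L.mask.code ++ (L.tie.code ++ z))))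
  have h2 := affDen_pos L.B (L.C.code ++ (L.mask.code ++ (L.tie.code ++ z)))
  positivity

theorem scoreNum_eq : (scoreNum X r (enc (attCode L z)) u y : ℚ) =
    scoreDen L z * vecDen X u * vecDen X y * L.score (vecVal X r u) (vecVal X r y) := by
  rw [scoreNum, scoreDen, posA_attCode, posB_attCode, Finset.sum_range, AttentionLayer.score,
    dotProduct, Finset.mul_sum]
  push_cast
  refine Finset.sum_congr rfl fun i _ => ?_
  rw [affNum_enc L.A _ _ _ (vecVal X r u) (fun j => by push_cast; exact vecNum_eq X r u j),
    affNum_enc L.B _ _ _ (vecVal X r y) (fun j => by push_cast; exact vecNum_eq X r y j)]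
  push_cast
  ring

/-- The scores of `a` and `y` at `u` share the factors `scoreDen` and `vecDen X u`; only the
denominators of `a` and `y` have to be multiplied crosswise. -/
theorem better_iff : Better X r (enc (attCode L z)) u a y ↔
    L.score (vecVal X r u) (vecVal X r a) < L.score (vecVal X r u) (vecVal X r y) := by
  have h0 := scoreDen_pos L z
  have h1 := vecDen_pos X u
  have h2 := vecDen_pos X a
  have h3 := vecDen_pos X y
  rw [Better, ← @Int.cast_lt ℚ]
  push_cast
  rw [scoreNum_eq, scoreNum_eq]
  have h4 : 0 < scoreDen L z * vecDen X u * vecDen X y * vecDen X a := by positivity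
  conv_rhs => rw [← mul_lt_mul_iff_right₀ h4]
  ring_nf

theorem betterEq_iff : BetterEq X r (enc (attCode L z)) u a y ↔
    L.score (vecVal X r u) (vecVal X r a) ≤ L.score (vecVal X r u) (vecVal X r y) := by
  have h0 := scoreDen_pos L z
  have h1 := vecDen_pos X u
  have h2 := vecDen_pos X a
  have h3 := vecDen_pos X y
  rw [BetterEq, ← @Int.cast_le ℚ]
  push_cast
  rw [scoreNum_eq, scoreNum_eq]
  have h4 : 0 < scoreDen L z * vecDen X u * vecDen X y * vecDen X a := by positivity
  conv_rhs => rw [← mul_le_mul_iff_right₀ h4]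
  ring_nf

end

theorem zeroCheck_iff (X r u : ℕ) : ZeroCheck X r u ↔ vecVal X r u = 0 := by
  have h := (vecDen_pos X u).ne'
  rw [ZeroCheck, funext_iff]
  simp only [vecVal, Pi.zero_apply, div_eq_zero_iff, h, or_false, Int.cast_eq_zero]
  exact ⟨fun h j => h j j.isLt, fun h j hj => h ⟨j, hj⟩⟩

theorem reluCheck_iff (X : ℕ) {r : ℕ} (c : Fin r) (z : List Bool) (u u' : ℕ) :
    ReluCheck X r (enc (true :: false :: (natCode c ++ z))) u u' ↔
      Function.update (vecVal X r u) c (max 0 (vecVal X r u c)) = vecVal X r u' := by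
  rw [ReluCheck, funext_iff, reluCoord_enc]
  have h1 := vecDen_pos X u
  have h2 := vecDen_pos X u'
  have key : ∀ j : Fin r, ((if (j : ℕ) = c ∧ vecNum X u j < 0 then 0 else vecNum X u j) *
      vecDen X u' = vecNum X u' j * vecDen X u) ↔
      Function.update (vecVal X r u) c (max 0 (vecVal X r u c)) j = vecVal X r u' j := by
    intro j
    have : Function.update (vecVal X r u) c (max 0 (vecVal X r u c)) j =
        ((if (j : ℕ) = c ∧ vecNum X u j < 0 then 0 else vecNum X u j : ℤ) : ℚ) / vecDen X u := by
      by_cases hj : j = c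
      · subst hj
        rw [Function.update_self, vecVal_apply]
        by_cases hn : vecNum X u j < 0
        · rw [if_pos ⟨rfl, hn⟩, max_eq_left, Int.cast_zero, zero_div]
          exact div_nonpos_of_nonpos_of_nonneg (by exact_mod_cast hn.le) h1.le
        · rw [if_neg (fun h => hn h.2), max_eq_right]
          exact div_nonneg (by exact_mod_cast not_lt.1 hn) h1.le
      · rw [Function.update_of_ne hj, if_neg (fun h => hj (Fin.ext h.1)), vecVal_apply]
    rw [this, vecVal_apply, div_eq_div_iff h1.ne' h2.ne', ← @Int.cast_inj ℚ]
    push_cast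
    rfl
  exact ⟨fun h i => (key i).1 (h i i.isLt), fun h i hi => (key ⟨i, hi⟩).2 (h _)⟩

theorem embCheck_iff {X k d : ℕ} {e : Fin k → Fin d → ℚ} {z : List Bool} (hd : embWidth X = d)
    (hX : posEmb X = enc (tupleCode (tupleCode ratCode) e ++ z)) (σ : Fin k) (u : ℕ) :
    EmbCheck X σ u ↔ e σ = vecVal X d u := by
  rw [EmbCheck, hd, hX, tupleCode_tupleCode, funext_iff]
  have h2 := vecDen_pos X u
  have key : ∀ j : Fin d, (((posAt (enc ((matEntries e).flatMap ratCode ++ z)) (σ * d + j) : ℤ) -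
      negAt (enc ((matEntries e).flatMap ratCode ++ z)) (σ * d + j)) * vecDen X u =
      vecNum X u j * denAt (enc ((matEntries e).flatMap ratCode ++ z)) (σ * d + j)) ↔
      e σ j = vecVal X d u j := by
    intro j
    have hl : (σ : ℕ) * d + j < (matEntries e).length := by
      rw [length_matEntries]; exact index_lt σ.isLt j.isLt
    rw [posAt_sub_negAt_enc _ _ _ hl, denAt_enc _ _ _ hl, getElem_matEntries, vecVal_apply,
      ← @Int.cast_inj ℚ]
    have h3 : ((e σ j).den : ℚ) ≠ 0 := by exact_mod_cast (e σ j).den_ne_zero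
    conv_rhs => rw [← Rat.num_div_den (e σ j)]
    rw [div_eq_div_iff h3 h2.ne']
    push_cast
    rfl
  exact ⟨fun h i => (key i).1 (h i i.isLt), fun h i hi => (key ⟨i, hi⟩).2 (h _)⟩

theorem accCheck_iff (X : ℕ) {r : ℕ} (t : Fin r → ℚ) (z : List Bool) (u : ℕ) :
    AccCheck X r (enc (tupleCode ratCode t ++ z)) u ↔ 0 < t ⬝ᵥ vecVal X r u := by
  have hl : (List.ofFn t).length = r := List.length_ofFn
  have h2 := vecDen_pos X u
  have hE := denProd_pos_enc (List.ofFn t) z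
  rw [hl] at hE
  have hE' : (0 : ℚ) < denProd (enc ((List.ofFn t).flatMap ratCode ++ z)) r := by exact_mod_cast hE
  have key : ((∑ j ∈ Finset.range r, entry (enc (tupleCode ratCode t ++ z)) r j * vecNum X u j : ℤ)
      : ℚ) = denProd (enc ((List.ofFn t).flatMap ratCode ++ z)) r * vecDen X u *
        (t ⬝ᵥ vecVal X r u) := by
    rw [Finset.sum_range, dotProduct, Finset.mul_sum]
    push_cast
    refine Finset.sum_congr rfl fun j _ => ?_
    have := entry_enc (List.ofFn t) z j (by rw [hl]; exact j.isLt)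
    have hj : ∀ h, (List.ofFn t)[(j : ℕ)]'h = t j := fun h => by simp
    rw [hj, hl] at this
    rw [tupleCode, this, vecNum_eq X r u j]
    ring
  rw [AccCheck, ← @Int.cast_pos ℚ, key]
  exact mul_pos_iff_of_pos_left (by positivity)

namespace Decides

variable {ι : Type} {a b c d e g : (ι → ℕ) → ℕ}

@[fun_prop]
theorem attCheck (ha : Feasible a) (hb : Feasible b) (hc : Feasible c) (hd : Feasible d)
    (he : Feasible e) (hg : Feasible g) :
    Decides fun v => AttCheck (a v) (b v) (c v) (d v) (e v) (g v) := by
  have h : Decides fun v : Fin 6 → ℕ => AttCheck (v 0) (v 1) (v 2) (v 3) (v 4) (v 5) := by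
    unfold AttCheck appendNum
    fun_prop
  exact h.comp (g := ![a, b, c, d, e, g]) (by simp [Fin.forall_fin_succ, ha, hb, hc, hd, he, hg])

@[fun_prop]
theorem better (ha : Feasible a) (hb : Feasible b) (hc : Feasible c) (hd : Feasible d)
    (he : Feasible e) (hg : Feasible g) :
    Decides fun v => Better (a v) (b v) (c v) (d v) (e v) (g v) := by
  have h : Decides fun v : Fin 6 → ℕ => Better (v 0) (v 1) (v 2) (v 3) (v 4) (v 5) := by
    unfold Better scoreNum
    fun_prop
  exact h.comp (g := ![a, b, c, d, e, g]) (by simp [Fin.forall_fin_succ, ha, hb, hc, hd, he, hg])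

@[fun_prop]
theorem betterEq (ha : Feasible a) (hb : Feasible b) (hc : Feasible c) (hd : Feasible d)
    (he : Feasible e) (hg : Feasible g) :
    Decides fun v => BetterEq (a v) (b v) (c v) (d v) (e v) (g v) := by
  have h : Decides fun v : Fin 6 → ℕ => BetterEq (v 0) (v 1) (v 2) (v 3) (v 4) (v 5) := by
    unfold BetterEq scoreNum
    fun_prop
  exact h.comp (g := ![a, b, c, d, e, g]) (by simp [Fin.forall_fin_succ, ha, hb, hc, hd, he, hg])

@[fun_prop]
theorem reluCheck (ha : Feasible a) (hb : Feasible b) (hc : Feasible c) (hd : Feasible d)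
    (he : Feasible e) : Decides fun v => ReluCheck (a v) (b v) (c v) (d v) (e v) := by
  have h : Decides fun v : Fin 5 → ℕ => ReluCheck (v 0) (v 1) (v 2) (v 3) (v 4) := by
    unfold ReluCheck
    fun_prop
  exact h.comp (g := ![a, b, c, d, e]) (by simp [Fin.forall_fin_succ, ha, hb, hc, hd, he])

@[fun_prop]
theorem embCheck (ha : Feasible a) (hb : Feasible b) (hc : Feasible c) :
    Decides fun v => EmbCheck (a v) (b v) (c v) := by
  have h : Decides fun v : Fin 3 → ℕ => EmbCheck (v 0) (v 1) (v 2) := by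
    unfold EmbCheck
    fun_prop
  exact h.comp (g := ![a, b, c]) (by simp [Fin.forall_fin_succ, ha, hb, hc])

@[fun_prop]
theorem accCheck (ha : Feasible a) (hb : Feasible b) (hc : Feasible c) (hd : Feasible d) :
    Decides fun v => AccCheck (a v) (b v) (c v) (d v) := by
  have h : Decides fun v : Fin 4 → ℕ => AccCheck (v 0) (v 1) (v 2) (v 3) := by
    unfold AccCheck
    fun_prop
  exact h.comp (g := ![a, b, c, d]) (by simp [Fin.forall_fin_succ, ha, hb, hc, hd])

@[fun_prop]
theorem zeroCheck (ha : Feasible a) (hb : Feasible b) (hc : Feasible c) :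
    Decides fun v => ZeroCheck (a v) (b v) (c v) := by
  have h : Decides fun v : Fin 3 → ℕ => ZeroCheck (v 0) (v 1) (v 2) := by
    unfold ZeroCheck
    fun_prop
  exact h.comp (g := ![a, b, c]) (by simp [Fin.forall_fin_succ, ha, hb, hc])

end Decides

/-! ### A grammar that generates the formula -/

/-! ### Tokens

A token is a number that stands for a bit string. The tokens `0` and `1` stand for single bits,
`2` for the empty string, and all others expand to two tokens. -/

/-- The token with a tag and five arguments. -/
def tok (tag a b c d e : ℕ) : ℕ :=
  Nat.pair tag (Nat.pair a (Nat.pair b (Nat.pair c (Nat.pair d e)))) + 3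

/-- The concatenation of two tokens. -/
def seqTok (a b : ℕ) : ℕ := tok 0 a b 0 0 0

/-- The concatenation of a list of tokens. -/
def seqToks : List ℕ → ℕ
  | [] => 2
  | t :: ts => seqTok t (seqToks ts)

/-- The code of a number. -/
def natTok (a : ℕ) : ℕ := tok 1 a 0 0 0 0

/-- The formula that describes the vector with code `u` after `l` layers. -/
def levelTok (l u : ℕ) : ℕ := tok 2 l u 0 0 0

/-- The disjunction of the first `i` formulas of a kind. -/
def orTok (κ l p q i : ℕ) : ℕ := tok 3 κ l p q i

/-- The `i`-th formula of a kind. -/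
def bodyTok (κ l p q i : ℕ) : ℕ := tok 4 κ l p q i

/-- The formula that says that the attention vector of layer `l`, at positions with vector `u`,
is `a`. -/
def attTok (l u a : ℕ) : ℕ := tok 5 l u a 0 0

/-- The formula `⊤`. -/
def topTok : ℕ := seqToks [0, 0, 0]
/-- The formula `⊥`. -/
def botTok : ℕ := seqToks [0, 0, 1]
/-- An atomic formula. -/
def atomTok (a : ℕ) : ℕ := seqToks [0, 1, 0, natTok a]
/-- A negation. -/
def notTok (s : ℕ) : ℕ := seqToks [0, 1, 1, s]
/-- A conjunction. -/
def andTok (s t : ℕ) : ℕ := seqToks [1, 0, 0, s, t]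
/-- A disjunction. -/
def disjTok (s t : ℕ) : ℕ := seqToks [1, 0, 1, s, t]
/-- A since formula. -/
def sinceTok (s t : ℕ) : ℕ := seqToks [1, 1, 0, s, t]
/-- An until formula. -/
def untilTok (s t : ℕ) : ℕ := seqToks [1, 1, 1, s, t]

/-- The expansion of a number. -/
def expandNat (a : ℕ) : ℕ := if a = 0 then seqToks [0] else seqToks [1, a % 2, natTok (a / 2)]

/-- The expansion of the description of a vector. -/
def expandLevel (X U l u : ℕ) : ℕ :=
  if l = 0 then orTok 0 0 u 0 (natVal X)
  else if layerKind (posAfter X (l - 1)) = 0 then levelTok (l - 1) u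
  else if layerKind (posAfter X (l - 1)) = 1 then orTok 1 (l - 1) u 0 U
  else orTok 2 (l - 1) u 0 (U * U)

/-- The expansion of a disjunction. -/
def expandOr (κ l p q i : ℕ) : ℕ :=
  if i = 0 then botTok else disjTok (bodyTok κ l p q (i - 1)) (orTok κ l p q (i - 1))

open Classical in
/-- The expansion of a disjunct. -/
noncomputable def expandBody (X U κ l p q i : ℕ) : ℕ :=
  if κ = 0 then (if EmbCheck X i p then atomTok i else botTok)
  else if κ = 1 then
    (if ReluCheck X (widthAt X l) (posAfter X l) i p then levelTok l i else botTok)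
  else if κ = 2 then
    (if AttCheck X (widthAt X l) (posAfter X l) (i / U) (i % U) p then
      andTok (levelTok l (i / U)) (attTok l (i / U) (i % U)) else botTok)
  else if κ = 3 then
    (if Better X (widthAt X l) (posAfter X l) p q i then levelTok l i else botTok)
  else if κ = 4 then
    (if BetterEq X (widthAt X l) (posAfter X l) p q i then levelTok l i else botTok)
  else (if AccCheck X (widthAt X l) (posAfter X l / 2) i then levelTok l i else botTok)

open Classical in
/-- The expansion of the description of an attention vector. -/
noncomputable def expandAtt (X U l u a : ℕ) : ℕ :=
  -- Kind `3` is a strictly larger score, kind `4` a score at least as large. Kind `4 - tie`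
  -- describes defeat from the left and `3 + tie` defeat from the right: a tie counts as defeat
  -- exactly on the side that the tie-breaking rule prefers.
  if maskNum (widthAt X l) (posAfter X l) = 0 then
    disjTok (andTok (levelTok l a) (andTok
        (notTok (sinceTok topTok (orTok (4 - tieNum (widthAt X l) (posAfter X l)) l u a U)))
        (notTok (untilTok topTok (orTok (3 + tieNum (widthAt X l) (posAfter X l)) l u a U)))))
      (disjTok
        (sinceTok topTok (andTok (levelTok l a) (andTok
          (notTok (sinceTok topTok (orTok (4 - tieNum (widthAt X l) (posAfter X l)) l u a U)))
          (notTok (untilTok topTok (orTok (3 + tieNum (widthAt X l) (posAfter X l)) l u a U))))))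
        (untilTok topTok (andTok (levelTok l a) (andTok
          (notTok (sinceTok topTok (orTok (4 - tieNum (widthAt X l) (posAfter X l)) l u a U)))
          (notTok (untilTok topTok (orTok (3 + tieNum (widthAt X l) (posAfter X l)) l u a U)))))))
  else if maskNum (widthAt X l) (posAfter X l) = 1 then
    disjTok (sinceTok (notTok (orTok (3 + tieNum (widthAt X l) (posAfter X l)) l u a U))
        (andTok (levelTok l a) (notTok (sinceTok topTok
          (orTok (4 - tieNum (widthAt X l) (posAfter X l)) l u a U)))))
      (if ZeroCheck X (widthAt X l) a then notTok (sinceTok topTok topTok) else botTok)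
  else
    disjTok (untilTok (notTok (orTok (4 - tieNum (widthAt X l) (posAfter X l)) l u a U))
        (andTok (levelTok l a) (notTok (untilTok topTok
          (orTok (3 + tieNum (widthAt X l) (posAfter X l)) l u a U)))))
      (if ZeroCheck X (widthAt X l) a then notTok (untilTok topTok topTok) else botTok)

/-- The expansion of a token with a non-zero tag. -/
noncomputable def expand (X U tag a b c d e : ℕ) : ℕ :=
  if tag = 1 then expandNat a
  else if tag = 2 then expandLevel X U a b
  else if tag = 3 then expandOr a b c d e
  else if tag = 4 then expandBody X U a b c d e
  else expandAtt X U a b c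

/-- The first token of the expansion of the token `x + 3`. -/
noncomputable def leftTok (X U x : ℕ) : ℕ :=
  if fstN x = 0 then fstN (sndN x)
  else expand X U (fstN x) (fstN (sndN x)) (fstN (sndN (sndN x))) (fstN (sndN (sndN (sndN x))))
    (fstN (sndN (sndN (sndN (sndN x))))) (sndN (sndN (sndN (sndN (sndN x)))))

/-- The second token of the expansion of the token `x + 3`. -/
def rightTok (x : ℕ) : ℕ := if fstN x = 0 then fstN (sndN (sndN x)) else 2

namespace Feasible

variable {ι : Type} {a b c d e g h i : (ι → ℕ) → ℕ}

@[fun_prop]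
theorem tok (ha : Feasible a) (hb : Feasible b) (hc : Feasible c) (hd : Feasible d)
    (he : Feasible e) (hg : Feasible g) :
    Feasible fun v => tok (a v) (b v) (c v) (d v) (e v) (g v) := by
  unfold _root_.tok; fun_prop

@[fun_prop]
theorem seqTok (ha : Feasible a) (hb : Feasible b) : Feasible fun v => seqTok (a v) (b v) := by
  unfold _root_.seqTok; fun_prop

@[fun_prop]
theorem natTok (ha : Feasible a) : Feasible fun v => natTok (a v) := by
  unfold _root_.natTok; fun_prop

@[fun_prop]
theorem levelTok (ha : Feasible a) (hb : Feasible b) :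
    Feasible fun v => levelTok (a v) (b v) := by
  unfold _root_.levelTok; fun_prop

@[fun_prop]
theorem orTok (ha : Feasible a) (hb : Feasible b) (hc : Feasible c) (hd : Feasible d)
    (he : Feasible e) : Feasible fun v => orTok (a v) (b v) (c v) (d v) (e v) := by
  unfold _root_.orTok; fun_prop

@[fun_prop]
theorem bodyTok (ha : Feasible a) (hb : Feasible b) (hc : Feasible c) (hd : Feasible d)
    (he : Feasible e) : Feasible fun v => bodyTok (a v) (b v) (c v) (d v) (e v) := by
  unfold _root_.bodyTok; fun_prop

@[fun_prop]
theorem attTok (ha : Feasible a) (hb : Feasible b) (hc : Feasible c) :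
    Feasible fun v => attTok (a v) (b v) (c v) := by
  unfold _root_.attTok; fun_prop

@[fun_prop]
theorem atomTok (ha : Feasible a) : Feasible fun v => atomTok (a v) := by
  simp only [_root_.atomTok, seqToks]; fun_prop

@[fun_prop]
theorem notTok (ha : Feasible a) : Feasible fun v => notTok (a v) := by
  simp only [_root_.notTok, seqToks]; fun_prop

@[fun_prop]
theorem andTok (ha : Feasible a) (hb : Feasible b) : Feasible fun v => andTok (a v) (b v) := by
  simp only [_root_.andTok, seqToks]; fun_prop

@[fun_prop]
theorem disjTok (ha : Feasible a) (hb : Feasible b) : Feasible fun v => disjTok (a v) (b v) := by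
  simp only [_root_.disjTok, seqToks]; fun_prop

@[fun_prop]
theorem sinceTok (ha : Feasible a) (hb : Feasible b) :
    Feasible fun v => sinceTok (a v) (b v) := by
  simp only [_root_.sinceTok, seqToks]; fun_prop

@[fun_prop]
theorem untilTok (ha : Feasible a) (hb : Feasible b) :
    Feasible fun v => untilTok (a v) (b v) := by
  simp only [_root_.untilTok, seqToks]; fun_prop

@[fun_prop]
theorem expandNat (ha : Feasible a) : Feasible fun v => expandNat (a v) := by
  simp only [_root_.expandNat, seqToks]; fun_prop

@[fun_prop]
theorem expandLevel (ha : Feasible a) (hb : Feasible b) (hc : Feasible c) (hd : Feasible d) :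
    Feasible fun v => expandLevel (a v) (b v) (c v) (d v) := by
  unfold _root_.expandLevel; fun_prop

@[fun_prop]
theorem expandOr (ha : Feasible a) (hb : Feasible b) (hc : Feasible c) (hd : Feasible d)
    (he : Feasible e) : Feasible fun v => expandOr (a v) (b v) (c v) (d v) (e v) := by
  unfold _root_.expandOr; fun_prop

@[fun_prop]
theorem expandBody (ha : Feasible a) (hb : Feasible b) (hc : Feasible c) (hd : Feasible d)
    (he : Feasible e) (hg : Feasible g) (hh : Feasible h) :
    Feasible fun v => expandBody (a v) (b v) (c v) (d v) (e v) (g v) (h v) := by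
  unfold _root_.expandBody; fun_prop

@[fun_prop]
theorem expandAtt (ha : Feasible a) (hb : Feasible b) (hc : Feasible c) (hd : Feasible d)
    (he : Feasible e) : Feasible fun v => expandAtt (a v) (b v) (c v) (d v) (e v) := by
  unfold _root_.expandAtt; fun_prop

@[fun_prop]
theorem expand (ha : Feasible a) (hb : Feasible b) (hc : Feasible c) (hd : Feasible d)
    (he : Feasible e) (hg : Feasible g) (hh : Feasible h) (hi : Feasible i) :
    Feasible fun v => expand (a v) (b v) (c v) (d v) (e v) (g v) (h v) (i v) := by
  unfold _root_.expand; fun_prop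

@[fun_prop]
theorem leftTok (ha : Feasible a) (hb : Feasible b) (hc : Feasible c) :
    Feasible fun v => leftTok (a v) (b v) (c v) := by
  unfold _root_.leftTok; fun_prop

@[fun_prop]
theorem rightTok (ha : Feasible a) : Feasible fun v => rightTok (a v) := by
  unfold _root_.rightTok; fun_prop

end Feasible

/-- `Gen X U M t s N` says that the token `t` expands to the bit string `s` in at most `N` steps,
through tokens that are at most `M`. -/
inductive Gen (X U M : ℕ) : ℕ → List Bool → ℕ → Prop
  | zero {N : ℕ} (h : 1 ≤ N) : Gen X U M 0 [false] N
  | one {N : ℕ} (h : 1 ≤ N) : Gen X U M 1 [true] N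
  | empty {N : ℕ} (h : 1 ≤ N) : Gen X U M 2 [] N
  | node {x N N₁ N₂ : ℕ} {s₁ s₂ : List Bool} (hx : x + 3 ≤ M)
      (h₁ : Gen X U M (leftTok X U x) s₁ N₁) (h₂ : Gen X U M (rightTok x) s₂ N₂)
      (h : N₁ + N₂ + 1 ≤ N) : Gen X U M (x + 3) (s₁ ++ s₂) N

/-- A token expands to a bit string if it is not too large. -/
def Gens (X U M t : ℕ) (s : List Bool) (N : ℕ) : Prop := t ≤ M → Gen X U M t s N

theorem Gen.mono {X U M t N N' : ℕ} {s : List Bool} (h : Gen X U M t s N) (hN : N ≤ N') :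
    Gen X U M t s N' := by
  cases h with
  | zero h => exact .zero (h.trans hN)
  | one h => exact .one (h.trans hN)
  | empty h => exact .empty (h.trans hN)
  | node hx h₁ h₂ h => exact .node hx h₁ h₂ (h.trans hN)

/-- Every output bit costs a leaf, so the budget `N` of expansion steps bounds the size of the
formula as well as the running time. -/
theorem Gen.length_le {X U M t N : ℕ} {s : List Bool} (h : Gen X U M t s N) : s.length ≤ N := by
  induction h with
  | zero h => simpa using h
  | one h => simpa using h
  | empty h => simp
  | node hx h₁ h₂ h ih₁ ih₂ => rw [List.length_append]; omega

/-- Tokens with arguments at most `Q` expand to tokens at most `M`. -/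
def ExpandBound (X U Q M : ℕ) : Prop :=
  ∀ tag a b c d e, tag ≤ Q → a ≤ Q → b ≤ Q → c ≤ Q → d ≤ Q → e ≤ Q → expand X U tag a b c d e ≤ M

namespace Gens

variable {X U Q M N N' Ns Nt t t' : ℕ} {s s' : List Bool}

theorem mono (h : Gens X U M t s N) (hN : N ≤ N') : Gens X U M t s N' := fun ht => (h ht).mono hN

theorem zero : Gens X U M 0 [false] 1 := fun _ => .zero le_rfl
theorem one : Gens X U M 1 [true] 1 := fun _ => .one le_rfl
theorem empty : Gens X U M 2 [] 1 := fun _ => .empty le_rfl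

/-- Pairing dominates its arguments, so the parts of a token inherit its bound. With the bound kept
as a premise in `Gens`, sizes need to be checked only where a token is expanded. -/
theorem seq (h : Gens X U M t s Ns) (h' : Gens X U M t' s' Nt) :
    Gens X U M (seqTok t t') (s ++ s') (Ns + Nt + 1) := by
  intro hM
  have h1 : t ≤ M ∧ t' ≤ M := by
    have e1 := Nat.right_le_pair 0 (Nat.pair t (Nat.pair t' (Nat.pair 0 (Nat.pair 0 0))))
    have e2 := Nat.left_le_pair t (Nat.pair t' (Nat.pair 0 (Nat.pair 0 0)))
    have e3 := Nat.right_le_pair t (Nat.pair t' (Nat.pair 0 (Nat.pair 0 0)))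
    have e4 := Nat.left_le_pair t' (Nat.pair 0 (Nat.pair 0 0))
    unfold seqTok tok at hM
    omega
  refine .node (N₁ := Ns) (N₂ := Nt) hM ?_ ?_ le_rfl
  · rw [leftTok, fstN_pair, if_pos rfl, sndN_pair, fstN_pair]
    exact h h1.1
  · rw [rightTok, fstN_pair, if_pos rfl, sndN_pair, sndN_pair, fstN_pair]
    exact h' h1.2

/-- One additional step is for the node, the other for the empty token at its right. -/
theorem tok {tag a b c d e : ℕ} (hM : ExpandBound X U Q M) (h0 : tag ≠ 0) (h1 : tag ≤ Q)
    (h2 : a ≤ Q) (h3 : b ≤ Q) (h4 : c ≤ Q) (h5 : d ≤ Q) (h6 : e ≤ Q)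
    (h : Gens X U M (expand X U tag a b c d e) s N) :
    Gens X U M (tok tag a b c d e) s (N + 2) := by
  intro ht
  have := Gen.node (N₁ := N) (N₂ := 1) (s₁ := s) (s₂ := []) (N := N + 2) ht
    (by
      simp only [leftTok, fstN_pair, sndN_pair, if_neg h0]
      exact h (hM _ _ _ _ _ _ h1 h2 h3 h4 h5 h6))
    (by
      simp only [rightTok, fstN_pair, if_neg h0]
      exact .empty le_rfl) le_rfl
  rw [List.append_nil] at this
  exact this

theorem digit (a : ℕ) : Gens X U M (a % 2) [a.bodd] 1 := by
  rcases Nat.mod_two_eq_zero_or_one a with h | h <;> rw [h]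
  · rw [show a.bodd = false by simpa [Nat.mod_two_of_bodd] using h]; exact zero
  · rw [show a.bodd = true by simpa [Nat.mod_two_of_bodd] using h]; exact one

variable {k : ℕ} {φ ψ : LTL (Fin k)}

theorem top : Gens X U M topTok (LTL.top : LTL (Fin k)).code 7 :=
  (zero.seq (zero.seq (zero.seq empty)))

theorem bot : Gens X U M botTok (LTL.bot : LTL (Fin k)).code 7 :=
  (zero.seq (zero.seq (one.seq empty)))

theorem not (h : Gens X U M t φ.code Ns) : Gens X U M (notTok t) φ.not.code (Ns + 8) := by
  have := (zero.seq (one.seq (one.seq (h.seq empty))))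
  simp only [List.append_nil] at this
  exact this.mono (by omega)

theorem and (h : Gens X U M t φ.code Ns) (h' : Gens X U M t' ψ.code Nt) :
    Gens X U M (andTok t t') (φ.and ψ).code (Ns + Nt + 9) := by
  have := (one.seq (zero.seq (zero.seq (h.seq (h'.seq empty)))))
  simp only [List.append_nil] at this
  exact this.mono (by omega)

theorem or (h : Gens X U M t φ.code Ns) (h' : Gens X U M t' ψ.code Nt) :
    Gens X U M (disjTok t t') (φ.or ψ).code (Ns + Nt + 9) := by
  have := (one.seq (zero.seq (one.seq (h.seq (h'.seq empty)))))
  simp only [List.append_nil] at this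
  exact this.mono (by omega)

theorem sinceOp (h : Gens X U M t φ.code Ns) (h' : Gens X U M t' ψ.code Nt) :
    Gens X U M (sinceTok t t') (φ.sinceOp ψ).code (Ns + Nt + 9) := by
  have := (one.seq (one.seq (zero.seq (h.seq (h'.seq empty)))))
  simp only [List.append_nil] at this
  exact this.mono (by omega)

theorem untilOp (h : Gens X U M t φ.code Ns) (h' : Gens X U M t' ψ.code Nt) :
    Gens X U M (untilTok t t') (φ.untilOp ψ).code (Ns + Nt + 9) := by
  have := (one.seq (one.seq (one.seq (h.seq (h'.seq empty)))))
  simp only [List.append_nil] at this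
  exact this.mono (by omega)

theorem natTok (hM : ExpandBound X U Q M) (hQ : 5 ≤ Q) (a : ℕ) (ha : a ≤ Q) :
    Gens X U M (natTok a) (natCode a) (5 + 8 * a) := by
  induction a using Nat.strongRecOn with
  | ind a ih =>
    have key : Gens X U M (expandNat a) (natCode a) (3 + 8 * a) := by
      rw [expandNat]
      split_ifs with h0
      · subst h0
        have := (zero (X := X) (U := U) (M := M)).seq empty
        exact this.mono (by omega)
      · have := one.seq ((digit (X := X) (U := U) (M := M) a).seq
          ((ih (a / 2) (by omega) (by omega)).seq empty))
        have e : natCode a = [true] ++ ([a.bodd] ++ (natCode (a / 2) ++ [])) := by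
          have hb : Nat.bits a = a.bodd :: Nat.bits (a / 2) := by
            conv_lhs => rw [← Nat.bit_bodd_div2 a]
            rw [Nat.bits_append_bit, Nat.div2_val]
            intro h
            have := Nat.bit_bodd_div2 a
            rw [h] at this
            cases hb : a.bodd
            · rw [hb] at this; simp at this; omega
            · rfl
          simp [natCode, hb]
        rw [e]
        exact this.mono (by omega)
    have := tok (tag := 1) (b := 0) (c := 0) (d := 0) (e := 0) (s := natCode a) (N := 3 + 8 * a)
      hM one_ne_zero (by omega) ha (by omega) (by omega) (by omega) (by omega)
      (by rw [expand, if_pos rfl]; exact key)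
    exact this.mono (by omega)

theorem atom (hM : ExpandBound X U Q M) (hQ : 5 ≤ Q) (a : Fin k) (ha : k ≤ Q) :
    Gens X U M (atomTok a) (LTL.atom a).code (15 + 8 * k) := by
  have ha' := a.isLt
  have := (zero.seq (one.seq (zero.seq ((natTok hM hQ a (by omega)).seq empty))))
  simp only [List.append_nil] at this
  exact this.mono (by omega)

end Gens

/-! ### The formula -/

namespace LTL

variable {α : Type}

/-- The disjunction of the first formulas of a sequence. -/
def bigOr (f : ℕ → LTL α) : ℕ → LTL α
  | 0 => bot
  | i + 1 => or (f i) (bigOr f i)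

open Classical in
/-- The conjunction of a formula with a proposition that does not depend on the position. -/
noncomputable def guard (P : Prop) (φ : LTL α) : LTL α := if P then φ else bot

/-- The formula for an attention vector, for a mask. Here `zero` says whether the vector is zero, `φ`
describes the positions that have the vector, and `Q` and `P` describe the positions that defeat it
from the left and from the right. -/
noncomputable def attForm (mask : ℕ) (zero : Prop) (φ P Q : LTL α) : LTL α :=
  let ψ := and φ (and (not (sinceOp top Q)) (not (untilOp top P)))
  if mask = 0 then or ψ (or (sinceOp top ψ) (untilOp top ψ))
  else if mask = 1 then
    or (sinceOp (not P) (and φ (not (sinceOp top Q)))) (guard zero (not (sinceOp top top)))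
  else or (untilOp (not Q) (and φ (not (untilOp top P)))) (guard zero (not (untilOp top top)))

end LTL

section

variable (X U k : ℕ)

open LTL

/-- The formula that describes the positions whose scores are high. -/
noncomputable def scoreForm (f : ℕ → LTL (Fin k)) (κ l u a : ℕ) : LTL (Fin k) :=
  bigOr (fun i => guard (if κ = 3 then Better X (widthAt X l) (posAfter X l) u a i else
    BetterEq X (widthAt X l) (posAfter X l) u a i) (f i)) U

/-- The formula that describes the attention vectors of a layer. -/
noncomputable def attLevelForm (f : ℕ → LTL (Fin k)) (l u a : ℕ) : LTL (Fin k) :=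
  attForm (maskNum (widthAt X l) (posAfter X l)) (ZeroCheck X (widthAt X l) a) (f a)
    (scoreForm X U k f (3 + tieNum (widthAt X l) (posAfter X l)) l u a)
    (scoreForm X U k f (4 - tieNum (widthAt X l) (posAfter X l)) l u a)

open Classical in
/-- The formula that describes the positions that have the vector with a given code after a number
of layers. -/
noncomputable def levelForm : ℕ → ℕ → LTL (Fin k)
  | 0, u => bigOr (fun i => if h : i < k then guard (EmbCheck X i u) (atom ⟨i, h⟩) else bot) k
  | l + 1, u =>
    if layerKind (posAfter X l) = 0 then levelForm l u
    else if layerKind (posAfter X l) = 1 then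
      bigOr (fun i => guard (ReluCheck X (widthAt X l) (posAfter X l) i u) (levelForm l i)) U
    else bigOr (fun i => guard (AttCheck X (widthAt X l) (posAfter X l) (i / U) (i % U) u)
      (and (levelForm l (i / U)) (attLevelForm X U k (levelForm l) l (i / U) (i % U)))) (U * U)

/-- The formula that describes acceptance after `l` layers. -/
noncomputable def acceptForm (l : ℕ) : LTL (Fin k) :=
  bigOr (fun i => guard (AccCheck X (widthAt X l) (posAfter X l / 2) i) (levelForm X U k l i)) U

end

/-- A bound for the size of the formulas that describe the vectors after `l` layers. -/
def formSize (U l : ℕ) : ℕ := 100 * U ^ 2 * (100 * U ^ 3) ^ l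

namespace Gens

variable {X U Q M k : ℕ}

theorem guard {P : Prop} {t N : ℕ} {φ : LTL (Fin k)} {_ : Decidable P} (hN : 7 ≤ N)
    (h : Gens X U M t φ.code N) : Gens X U M (if P then t else botTok) (LTL.guard P φ).code N := by
  rw [LTL.guard]
  split_ifs
  · exact h
  · exact bot.mono hN

/-- Each disjunct costs `2` for expanding `bodyTok`, `2` for `orTok` and `9` for the connective,
which gives `B + 13`. The final `⊥` costs `7 + 2`. -/
theorem bigOr (hM : ExpandBound X U Q M) (hQ : 5 ≤ Q) {κ l p q n B : ℕ} (hκ : κ ≤ Q) (hl : l ≤ Q)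
    (hp : p ≤ Q) (hq : q ≤ Q) (hn : n ≤ Q) {f : ℕ → LTL (Fin k)}
    (h : ∀ i < n, Gens X U M (expandBody X U κ l p q i) (f i).code B) :
    Gens X U M (orTok κ l p q n) (LTL.bigOr f n).code ((B + 13) * n + 9) := by
  induction n with
  | zero =>
    refine (tok hM three_ne_zero (by omega) hκ hl hp hq hn (N := 7) ?_).mono (by omega)
    rw [expand, if_neg (by norm_num), if_neg (by norm_num), if_pos rfl, expandOr, if_pos rfl]
    exact bot
  | succ n ih =>
    have hb : Gens X U M (bodyTok κ l p q n) (f n).code (B + 2) := by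
      refine tok hM four_ne_zero (by omega) hκ hl hp hq (by omega) ?_
      rw [expand, if_neg (by norm_num), if_neg (by norm_num), if_neg (by norm_num), if_pos rfl]
      exact h n (by omega)
    refine (tok hM three_ne_zero (by omega) hκ hl hp hq hn
      (N := (B + 2) + ((B + 13) * n + 9) + 9) ?_).mono (le_of_eq (by ring))
    rw [expand, if_neg (by norm_num), if_neg (by norm_num), if_pos rfl, expandOr,
      if_neg (by omega), Nat.add_sub_cancel]
    exact hb.or (ih (by omega) fun i hi => h i (by omega))

theorem scoreForm (hM : ExpandBound X U Q M) (hQ : 5 ≤ Q) (hU : U ≤ Q) (hU1 : 1 ≤ U) {S l u a κ : ℕ}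
    (hκ : κ = 3 ∨ κ = 4) (hl : l ≤ Q) (hu : u ≤ Q) (ha : a ≤ Q) (hS : 22 ≤ S) {f : ℕ → LTL (Fin k)}
    (h : ∀ u < U, Gens X U M (levelTok l u) (f u).code S) :
    Gens X U M (orTok κ l u a U) (scoreForm X U k f κ l u a).code (3 * (S * U)) := by
  refine (bigOr hM hQ (B := S) (by omega) hl hu ha hU fun i hi => ?_).mono ?_
  · rcases hκ with rfl | rfl
    · norm_num [expandBody]
      exact guard (by omega) (h i hi)
    · norm_num [expandBody]
      exact guard (by omega) (h i hi)
  · nlinarith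

/-- The worst case is the empty mask, with three copies of a formula that contains `φ` and two score
formulas of size `3 * (S * U)`. The assumption `22 ≤ S` absorbs all additive constants. -/
theorem attLevelForm (hM : ExpandBound X U Q M) (hQ : 5 ≤ Q) (hU : U ≤ Q) (hU1 : 1 ≤ U) {S l u a : ℕ}
    (hl : l ≤ Q) (hu : u ≤ Q) (ha : a < U) (hS : 22 ≤ S) {f : ℕ → LTL (Fin k)}
    (h : ∀ u < U, Gens X U M (levelTok l u) (f u).code S) :
    Gens X U M (attTok l u a) (attLevelForm X U k f l u a).code (40 * (S * U)) := by
  have hP := scoreForm (u := u) (a := a) (κ := 3 + tieNum (widthAt X l) (posAfter X l)) hM hQ hU hU1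
    (by have : tieNum (widthAt X l) (posAfter X l) < 2 := Nat.mod_lt _ two_pos
        omega) hl hu (by omega) hS h
  have hN := scoreForm (u := u) (a := a) (κ := 4 - tieNum (widthAt X l) (posAfter X l)) hM hQ hU hU1
    (by have : tieNum (widthAt X l) (posAfter X l) < 2 := Nat.mod_lt _ two_pos
        omega) hl hu (by omega) hS h
  have hSU : S ≤ S * U := Nat.le_mul_of_pos_right _ hU1
  have ht : Gens X U M topTok (LTL.top : LTL (Fin k)).code 7 := top
  have hψ := (h a ha).and ((ht.sinceOp hN).not.and (ht.untilOp hP).not)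
  refine (tok hM (by norm_num) (by omega) hl hu (by omega) (by omega) (by omega)
    (N := 40 * (S * U) - 2) ?_).mono (by omega)
  norm_num only [expand, if_false]
  rw [expandAtt, _root_.attLevelForm, LTL.attForm]
  by_cases h0 : maskNum (widthAt X l) (posAfter X l) = 0
  · rw [if_pos h0, if_pos h0]
    have h1 := hψ.or ((ht.sinceOp hψ).or (ht.untilOp hψ))
    exact h1.mono (by omega)
  by_cases h1 : maskNum (widthAt X l) (posAfter X l) = 1
  · rw [if_neg h0, if_neg h0, if_pos h1, if_pos h1]
    have h1 := hP.not.sinceOp ((h a ha).and (ht.sinceOp hN).not)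
    have h2 := (ht.sinceOp ht).not.mono (show _ ≤ 31 by omega)
    exact (h1.or (guard (by omega) h2)).mono (by omega)
  · rw [if_neg h0, if_neg h0, if_neg h1, if_neg h1]
    have h1 := hN.not.untilOp ((h a ha).and (ht.untilOp hP).not)
    have h2 := (ht.untilOp ht).not.mono (show _ ≤ 31 by omega)
    exact (h1.or (guard (by omega) h2)).mono (by omega)

theorem le_formSize (hU1 : 1 ≤ U) (l : ℕ) : 22 ≤ formSize U l := by
  have h1 : 0 < U ^ 2 := by positivity
  have h2 : 0 < (100 * U ^ 3) ^ l := by positivity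
  have := Nat.mul_le_mul (Nat.mul_le_mul (le_refl 100) h1) h2
  rw [formSize]
  omega

/-- The factor `U ^ 3` per layer consists of `U * U` for the pairs of own and attended vector and
`U` for the disjunctions that compare scores. -/
theorem levelForm (hM : ExpandBound X U Q M) (hQ : 5 ≤ Q) (hU : U * U ≤ Q) (hk : natVal X = k)
    (hkU : k ≤ U) (hU1 : 1 ≤ U) (l : ℕ) (hl : l ≤ Q) : ∀ u < U,
    Gens X U M (levelTok l u) (levelForm X U k l u).code (formSize U l) := by
  have hUQ : U ≤ Q := le_trans (Nat.le_mul_of_pos_right _ hU1) hU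
  induction l with
  | zero =>
    intro u hu
    refine (tok hM two_ne_zero (by omega) hl (by omega) (by omega) (by omega) (by omega)
      (N := (15 + 8 * k + 13) * k + 9) ?_).mono ?_
    · rw [expand, if_neg (by norm_num), if_pos rfl, expandLevel, if_pos rfl, hk, _root_.levelForm]
      refine bigOr hM hQ (by omega) (by omega) (by omega) (by omega) (by omega) fun i hi => ?_
      rw [dif_pos hi, expandBody, if_pos rfl]
      exact guard (by omega) (atom hM hQ ⟨i, hi⟩ (by omega))
    · rw [formSize, pow_zero, mul_one]
      nlinarith
  | succ l ih =>
    intro u hu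
    have hS := le_formSize hU1 l
    have ih := ih (by omega)
    have hSU : formSize U (l + 1) = 100 * (formSize U l * U ^ 3) := by
      simp only [formSize, pow_succ]; ring
    have hU3 : formSize U l * U * U * U = formSize U l * U ^ 3 := by ring
    have h1 : formSize U l ≤ formSize U l * U := Nat.le_mul_of_pos_right _ hU1
    have h2 : formSize U l * U ≤ formSize U l * U * U := Nat.le_mul_of_pos_right _ hU1
    have h3 : formSize U l * U * U ≤ formSize U l * U * U * U := Nat.le_mul_of_pos_right _ hU1
    refine (tok hM two_ne_zero (by omega) hl (by omega) (by omega) (by omega) (by omega)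
      (N := formSize U (l + 1) - 2) ?_).mono (by omega)
    rw [expand, if_neg (by norm_num), if_pos rfl, expandLevel, if_neg (by omega),
      Nat.add_sub_cancel, _root_.levelForm]
    split_ifs with h0 h1
    · exact (ih u hu).mono (by omega)
    · refine (bigOr hM hQ (B := formSize U l) (by omega) (by omega) (by omega) (by omega) hUQ
        fun i hi => ?_).mono ?_
      · norm_num [expandBody]
        exact guard (by omega) (ih i hi)
      · have : (formSize U l + 13) * U ≤ 2 * (formSize U l * U) := by nlinarith
        omega
    · refine (bigOr hM hQ (B := 43 * (formSize U l * U)) (by omega) (by omega) (by omega)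
        (by omega) hU fun i hi => ?_).mono ?_
      · norm_num [expandBody]
        have hd : i / U < U := Nat.div_lt_of_lt_mul hi
        have hm : i % U < U := Nat.mod_lt _ hU1
        exact guard (by omega) (((ih _ hd).and
          (attLevelForm hM hQ hUQ hU1 (by omega) (by omega) hm hS ih)).mono (by omega))
      · have : (43 * (formSize U l * U) + 13) * (U * U) ≤ 44 * (formSize U l * U * U * U) := by
          nlinarith [Nat.mul_le_mul_right (U * U) (show 13 ≤ formSize U l * U by omega)]
        omega

theorem acceptForm (hM : ExpandBound X U Q M) (hQ : 5 ≤ Q) (hU : U * U ≤ Q) (hk : natVal X = k)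
    (hkU : k ≤ U) (hU1 : 1 ≤ U) (l : ℕ) (hl : l ≤ Q) :
    Gens X U M (orTok 5 l 0 0 U) (acceptForm X U k l).code (3 * (formSize U l * U)) := by
  have hUQ : U ≤ Q := le_trans (Nat.le_mul_of_pos_right _ hU1) hU
  have hS := le_formSize hU1 l
  refine (bigOr hM hQ (B := formSize U l) (by omega) hl (by omega) (by omega) hUQ
    fun i hi => ?_).mono ?_
  · norm_num [expandBody]
    exact guard (by omega) (levelForm hM hQ hU hk hkU hU1 l hl i hi)
  · nlinarith

end Gens

/-! ### Why the formula is correct -/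

/-! ### Semantics of the formula -/

namespace LTL

variable {α : Type} {w : List α}

theorem sat_bigOr (f : ℕ → LTL α) (n : ℕ) (i : Fin w.length) :
    (bigOr f n).Sat w i ↔ ∃ j < n, (f j).Sat w i := by
  induction n with
  | zero => simp [bigOr, Sat]
  | succ n ih => rw [bigOr, Sat, ih, Nat.exists_lt_succ_right, or_comm]

theorem sat_guard (P : Prop) (φ : LTL α) (i : Fin w.length) :
    (guard P φ).Sat w i ↔ P ∧ φ.Sat w i := by
  rw [guard]
  split_ifs with h <;> simp [h, Sat]

end LTL

/-- A score `x` at a position is defeated by a score `y` further left. -/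
def TieBreak.LosesLeft : TieBreak → ℚ → ℚ → Prop
  | .leftmost, x, y => x ≤ y
  | .rightmost, x, y => x < y

/-- A score `x` at a position is defeated by a score `y` further right. -/
def TieBreak.LosesRight : TieBreak → ℚ → ℚ → Prop
  | .leftmost, x, y => x < y
  | .rightmost, x, y => x ≤ y

namespace AttentionLayer

variable {r m n : ℕ} (L : AttentionLayer r m) (v : Fin n → Fin r → ℚ) (i : Fin n)

open Classical in
theorem mem_unmasked {n : ℕ} (i j : Fin n) : j ∈ L.unmasked i ↔ L.mask.Allows i j :=
  Finset.mem_filter.trans (and_iff_right (Finset.mem_univ j))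

open Classical in
theorem mem_best (j : Fin n) : j ∈ L.best v i ↔ L.mask.Allows i j ∧
    ∀ j', L.mask.Allows i j' → L.score (v i) (v j') ≤ L.score (v i) (v j) :=
  Finset.mem_filter.trans (and_congr (L.mem_unmasked i j)
    (forall_congr' fun j' => imp_congr_left (L.mem_unmasked i j')))

/-- Maximality and tie-breaking merge into one condition on each side: the leftmost maximum is the
position whose score is strictly larger than all scores to its left and at least as large as all to
its right, and symmetrically for the rightmost one. -/
theorem select_best_eq_iff (h : (L.best v i).Nonempty) (j : Fin n) :
    L.tie.select (L.best v i) h = j ↔ L.mask.Allows i j ∧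
      (∀ j' < j, L.mask.Allows i j' →
        ¬ L.tie.LosesLeft (L.score (v i) (v j)) (L.score (v i) (v j'))) ∧
      ∀ j' > j, L.mask.Allows i j' →
        ¬ L.tie.LosesRight (L.score (v i) (v j)) (L.score (v i) (v j')) := by
  cases L.tie with
  | leftmost =>
    simp only [TieBreak.select, TieBreak.LosesLeft, TieBreak.LosesRight, not_le, not_lt]
    rw [Finset.min'_eq_iff, mem_best]
    constructor
    · rintro ⟨⟨h1, h2⟩, h3⟩
      refine ⟨h1, fun j' hj' ha => lt_of_le_of_ne (h2 j' ha) fun he => ?_, fun j' _ ha => h2 j' ha⟩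
      refine absurd (h3 j' ((L.mem_best v i j').2 ⟨ha, fun l hl => ?_⟩)) (not_le.2 hj')
      rw [he]
      exact h2 l hl
    · rintro ⟨h1, h2, h3⟩
      have hb : ∀ j', L.mask.Allows i j' → L.score (v i) (v j') ≤ L.score (v i) (v j) := by
        intro j' ha
        rcases lt_trichotomy j' j with hl | rfl | hl
        · exact (h2 j' hl ha).le
        · exact le_rfl
        · exact h3 j' hl ha
      refine ⟨⟨h1, hb⟩, fun l hl => not_lt.1 fun hlt => ?_⟩
      rw [mem_best] at hl
      exact absurd (hl.2 j h1) (not_le.2 (h2 l hlt hl.1))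
  | rightmost =>
    simp only [TieBreak.select, TieBreak.LosesLeft, TieBreak.LosesRight, not_le, not_lt]
    rw [Finset.max'_eq_iff, mem_best]
    constructor
    · rintro ⟨⟨h1, h2⟩, h3⟩
      refine ⟨h1, fun j' _ ha => h2 j' ha, fun j' hj' ha => lt_of_le_of_ne (h2 j' ha) fun he => ?_⟩
      refine absurd (h3 j' ((L.mem_best v i j').2 ⟨ha, fun l hl => ?_⟩)) (not_le.2 hj')
      rw [he]
      exact h2 l hl
    · rintro ⟨h1, h2, h3⟩
      have hb : ∀ j', L.mask.Allows i j' → L.score (v i) (v j') ≤ L.score (v i) (v j) := by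
        intro j' ha
        rcases lt_trichotomy j' j with hl | rfl | hl
        · exact h2 j' hl ha
        · exact le_rfl
        · exact (h3 j' hl ha).le
      refine ⟨⟨h1, hb⟩, fun l hl => not_lt.1 fun hlt => ?_⟩
      rw [mem_best] at hl
      exact absurd (hl.2 j h1) (not_le.2 (h3 l hlt hl.1))

/-- Apart from the existence of a position with vector `a`, the condition refers only to the vector
`v i`, the candidate `a` and the vectors at the other positions. This is what makes it definable
once `v i` and `a` are fixed. -/
theorem attention_eq_iff (a : Fin r → ℚ) : L.attention v i = a ↔
    (∃ j, L.mask.Allows i j ∧ v j = a ∧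
      (∀ j' < j, L.mask.Allows i j' →
        ¬ L.tie.LosesLeft (L.score (v i) a) (L.score (v i) (v j'))) ∧
      ∀ j' > j, L.mask.Allows i j' →
        ¬ L.tie.LosesRight (L.score (v i) a) (L.score (v i) (v j'))) ∨
    a = 0 ∧ ∀ j, ¬ L.mask.Allows i j := by
  rw [attention]
  split_ifs with h
  · have h' := L.best_nonempty v i h
    obtain ⟨j₀, hj₀⟩ := h
    rw [mem_unmasked] at hj₀
    have key := (L.select_best_eq_iff v i h')
    constructor
    · intro ha
      obtain ⟨h1, h2, h3⟩ := (key _).1 rfl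
      rw [ha] at h2 h3
      exact Or.inl ⟨_, h1, ha, h2, h3⟩
    · rintro (⟨j, h1, rfl, h2⟩ | ⟨-, h2⟩)
      · rw [(key j).2 ⟨h1, h2⟩]
      · exact absurd hj₀ (h2 j₀)
  · have hn : ∀ j, ¬ L.mask.Allows i j :=
      fun j hj => h ⟨j, (L.mem_unmasked i j).2 hj⟩
    constructor
    · intro ha
      exact Or.inr ⟨ha.symm, hn⟩
    · rintro (⟨j, h1, -⟩ | ⟨rfl, -⟩)
      · exact absurd h1 (hn j)
      · rfl

end AttentionLayer

/-- `P` and `Q` are evaluated at positions `j`, but their scores refer to the vector at the fixed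
position `i`. This is legitimate because the query vector is a constant inside these formulas; they
are assumed to be correct only for the given `i`. -/
theorem LTL.sat_attForm {α : Type} {w : List α} {r m : ℕ} (L : AttentionLayer r m)
    (v : Fin w.length → Fin r → ℚ) (i : Fin w.length) (a : Fin r → ℚ) {z : Prop} {φ P Q : LTL α}
    (hz : z ↔ a = 0) (hφ : ∀ j, φ.Sat w j ↔ v j = a)
    (hP : ∀ j, P.Sat w j ↔ L.tie.LosesRight (L.score (v i) a) (L.score (v i) (v j)))
    (hQ : ∀ j, Q.Sat w j ↔ L.tie.LosesLeft (L.score (v i) a) (L.score (v i) (v j))) :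
    (attForm L.mask.num z φ P Q).Sat w i ↔ L.attention v i = a := by
  rw [L.attention_eq_iff]
  cases L.mask with
  | none =>
    simp only [Mask.num, attForm, if_true, Sat, Mask.Allows, hφ, hP, hQ, true_and, not_true,
      forall_true_left, implies_true, and_true, not_exists, not_and]
    constructor
    · rintro (h | ⟨j, -, h⟩ | ⟨j, -, h⟩) <;>
        exact Or.inl ⟨_, h.1, fun j' hj' => h.2.1 j' hj', fun j' hj' => h.2.2 j' hj'⟩
    · rintro (⟨j, h⟩ | ⟨-, h⟩)
      · rcases lt_trichotomy j i with hl | rfl | hl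
        · exact Or.inr (Or.inl ⟨j, hl, h⟩)
        · exact Or.inl h
        · exact Or.inr (Or.inr ⟨j, hl, h⟩)
      · exact (h i).elim
  | future =>
    simp only [Mask.num, attForm, one_ne_zero, if_false, if_true, Sat, sat_guard, Mask.Allows, hφ, hP,
      hQ, hz, implies_true, and_true, not_exists, not_and]
    -- The unmasked positions to the right of `j` are those strictly between `j` and `i`, which are
    -- the range of the since formula; to the left of `j` everything is unmasked.
    refine or_congr (exists_congr fun j => and_congr_right fun hj => ?_) Iff.rfl
    rw [and_assoc]
    refine and_congr_right fun _ => and_congr ?_ ?_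
    · exact forall_congr' fun j' => ⟨fun h hl _ => h hl, fun h hl => h hl (hl.trans hj)⟩
    · exact forall_congr' fun j' => Iff.rfl
  | past =>
    simp only [Mask.num, attForm, OfNat.ofNat_ne_zero, OfNat.ofNat_ne_one, if_false, Sat, sat_guard,
      Mask.Allows, hφ, hP, hQ, hz, implies_true, and_true, not_exists, not_and]
    refine or_congr (exists_congr fun j => and_congr_right fun hj => ?_) Iff.rfl
    rw [and_assoc]
    refine and_congr_right fun _ => and_comm.trans (and_congr ?_ ?_)
    · exact forall_congr' fun j' => ⟨fun h h1 h2 => h h2 h1, fun h h1 h2 => h h2 h1⟩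
    · exact forall_congr' fun j' => ⟨fun h hl _ => h hl, fun h hl => h hl (hj.trans hl)⟩

/-! ### Bounds for vectors -/

theorem exists_prod_den_mul (qs : List ℚ) (q : ℚ) (hq : q ∈ qs) :
    ∃ p : ℤ, ((qs.map Rat.den).prod : ℕ) * q = p := by
  obtain ⟨c, hc⟩ := List.dvd_prod (List.mem_map_of_mem (f := Rat.den) hq)
  refine ⟨c * q.num, ?_⟩
  rw [hc]
  push_cast
  rw [mul_comm (q.den : ℚ), mul_assoc, Rat.den_mul_eq_num]

theorem abs_add_one_le (q : ℚ) : |q| + 1 ≤ 2 ^ (ratCode q).length := by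
  have h1 : |q| ≤ q.num.natAbs := by
    have h : |q| = |(q.num : ℚ)| / q.den := by
      conv_lhs => rw [← Rat.num_div_den q]
      rw [abs_div, Nat.abs_cast]
    rw [h, Nat.cast_natAbs, Int.cast_abs]
    exact div_le_self (abs_nonneg _) (by exact_mod_cast q.den_pos)
  have h2 : q.num.natAbs + 1 ≤ 2 ^ (natCode q.num.natAbs).length := lt_two_pow_length_natCode _
  have h3 : (2 : ℕ) ^ (natCode q.num.natAbs).length ≤ 2 ^ (ratCode q).length :=
    Nat.pow_le_pow_right (by norm_num) (by simp [ratCode]; omega)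
  have h4 : ((q.num.natAbs + 1 : ℕ) : ℚ) ≤ (2 ^ (ratCode q).length : ℕ) := by
    exact_mod_cast h2.trans h3
  push_cast at h4
  linarith

/-- The summand `1` makes the induction multiplicative: `1 + a + b ≤ (1 + a) * (1 + b)` for
nonnegative `a` and `b`. -/
theorem sum_abs_le (qs : List ℚ) :
    (qs.map fun q => |q|).sum + 1 ≤ 2 ^ (qs.flatMap ratCode).length := by
  induction qs with
  | nil => simp
  | cons q qs ih =>
    rw [List.map_cons, List.sum_cons, List.flatMap_cons, List.length_append, pow_add]
    have h1 := abs_add_one_le q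
    have h2 := abs_nonneg q
    have h3 : 0 ≤ (qs.map fun q => |q|).sum := List.sum_nonneg (by simp)
    nlinarith

theorem sum_matEntries {n m : ℕ} (M : Fin n → Fin m → ℚ) (f : ℚ → ℚ) :
    ((matEntries M).map f).sum = ∑ i, ∑ j, f (M i j) := by
  rw [matEntries, List.map_flatten, List.sum_flatten, List.map_map, List.map_ofFn, List.sum_ofFn]
  refine Finset.sum_congr rfl fun i _ => ?_
  simp [List.map_ofFn, List.sum_ofFn]

theorem mem_matEntries {n m : ℕ} (M : Fin n → Fin m → ℚ) (i : Fin n) (j : Fin m) :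
    M i j ∈ matEntries M :=
  List.mem_flatten.2 ⟨_, (List.mem_ofFn' _ _).2 ⟨i, rfl⟩, (List.mem_ofFn' _ _).2 ⟨j, rfl⟩⟩

/-- The entries of a family of vectors have a common denominator and absolute values of at most
`2 ^ e`. -/
def Fits {ι κ : Type*} (e : ℕ) (v : ι → κ → ℚ) : Prop :=
  (∃ D : ℕ, 0 < D ∧ D ≤ 2 ^ e ∧ ∀ i j, ∃ p : ℤ, D * v i j = p) ∧ ∀ i j, |v i j| ≤ 2 ^ e

namespace Fits

variable {ι κ : Type*} {e e' n r m : ℕ} {v : ι → κ → ℚ}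

theorem emb {k d : ℕ} (f : Fin k → Fin d → ℚ) :
    Fits (tupleCode (tupleCode ratCode) f).length f := by
  rw [tupleCode_tupleCode]
  refine ⟨⟨((matEntries f).map Rat.den).prod, ?_, prod_den_le _, fun i j =>
    exists_prod_den_mul _ _ (mem_matEntries f i j)⟩, fun i j => ?_⟩
  · exact List.prod_pos (by simp [Rat.den_pos])
  · have h1 := sum_abs_le (matEntries f)
    have h2 := List.single_le_sum (l := (matEntries f).map fun q => |q|) (by simp) _
      (List.mem_map_of_mem (mem_matEntries f i j))
    linarith

theorem relu {v : Fin n → Fin r → ℚ} (h : Fits e v) (c : Fin r) : Fits e (reluRun c v) := by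
  obtain ⟨⟨D, h0, h1, h2⟩, h3⟩ := h
  refine ⟨⟨D, h0, h1, fun i j => ?_⟩, fun i j => ?_⟩ <;> rw [reluRun, Function.update_apply] <;>
    split_ifs
  · rcases max_choice 0 (v i c) with hm | hm <;> rw [hm]
    · exact ⟨0, by simp⟩
    · exact h2 i c
  · exact h2 i j
  · rcases max_choice 0 (v i c) with hm | hm <;> rw [hm]
    · simp
    · exact h3 i c
  · exact h3 i j

/-- Every entry is an entry of `v` or zero, so the exponent does not grow, whatever the score maps
are. -/
theorem attention {v : Fin n → Fin r → ℚ} (h : Fits e v) (L : AttentionLayer r m) :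
    Fits e fun i => Fin.append (v i) (L.attention v i) := by
  have key : ∀ i j, Fin.append (v i) (L.attention v i) j = 0 ∨
      ∃ i' j', Fin.append (v i) (L.attention v i) j = v i' j' := by
    intro i j
    refine Fin.addCases (fun j => ?_) (fun j => ?_) j
    · exact Or.inr ⟨i, j, Fin.append_left _ _ _⟩
    · rw [Fin.append_right, AttentionLayer.attention]
      split_ifs
      · exact Or.inr ⟨_, j, rfl⟩
      · exact Or.inl rfl
  obtain ⟨⟨D, h0, h1, h2⟩, h3⟩ := h
  refine ⟨⟨D, h0, h1, fun i j => ?_⟩, fun i j => ?_⟩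
  · rcases key i j with hk | ⟨i', j', hk⟩ <;> simp only [hk]
    · exact ⟨0, by simp⟩
    · exact h2 i' j'
  · rcases key i j with hk | ⟨i', j', hk⟩ <;> simp only [hk]
    · simp
    · exact h3 i' j'

/-- The old common denominator is multiplied by all denominators of `A`. As `1 ≤ 2 ^ e`, each
coordinate is at most `2 ^ e` times the sum of the absolute values of all entries of `A`. Both
factors are at most `2` to the length of the code of `A`, so the exponents add and do not multiply.
-/
theorem affine {v : Fin n → Fin r → ℚ} (h : Fits e v) (A : QAffine r m) :
    Fits (e + A.code.length) fun i => A.apply (v i) := by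
  obtain ⟨⟨D, h0, h1, h2⟩, h3⟩ := h
  have hmem1 : ∀ i j, A.mat i j ∈ A.entries := fun i j =>
    List.mem_append_left _ (mem_matEntries (fun i j => A.mat i j) i j)
  have hmem2 : ∀ i, A.bias i ∈ A.entries := fun i =>
    List.mem_append_right _ ((List.mem_ofFn' _ _).2 ⟨i, rfl⟩)
  rw [A.code_eq]
  refine ⟨⟨D * (A.entries.map Rat.den).prod, ?_, ?_, fun i j => ?_⟩, fun i j => ?_⟩
  · exact Nat.mul_pos h0 (List.prod_pos (by simp [Rat.den_pos]))
  · rw [pow_add]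
    exact Nat.mul_le_mul h1 (prod_den_le _)
  · choose p hp using h2 i
    choose q hq using fun l => exists_prod_den_mul _ _ (hmem1 j l)
    obtain ⟨b, hb⟩ := exists_prod_den_mul _ _ (hmem2 j)
    refine ⟨∑ l, q l * p l + D * b, ?_⟩
    have hA : (fun i => A.apply (v i)) i j = ∑ l, A.mat j l * v i l + A.bias j := rfl
    rw [Int.cast_add, Int.cast_sum, Int.cast_mul, ← hb, hA, Nat.cast_mul, mul_add, Finset.mul_sum]
    simp only [Int.cast_mul, ← hp, ← hq, Int.cast_natCast]
    congr 1
    · exact Finset.sum_congr rfl fun l _ => by ring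
    · ring
  · have hs := sum_abs_le A.entries
    have h2e : (0 : ℚ) < 2 ^ e := by positivity
    have h1e : (1 : ℚ) ≤ 2 ^ e := one_le_pow₀ one_le_two
    rw [QAffine.entries, List.map_append, List.sum_append, sum_matEntries, List.map_ofFn,
      List.sum_ofFn] at hs
    have hA : ∑ l, |A.mat j l| ≤ ∑ i, ∑ l, |A.mat i l| :=
      Finset.single_le_sum (f := fun i => ∑ l, |A.mat i l|)
        (fun i _ => Finset.sum_nonneg fun l _ => abs_nonneg _) (Finset.mem_univ j)
    have hB : |A.bias j| ≤ ∑ i, |A.bias i| :=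
      Finset.single_le_sum (f := fun i => |A.bias i|) (fun i _ => abs_nonneg _) (Finset.mem_univ j)
    have hM : |∑ l, A.mat j l * v i l| ≤ (∑ l, |A.mat j l|) * 2 ^ e := by
      rw [Finset.sum_mul]
      refine (Finset.abs_sum_le_sum_abs _ _).trans (Finset.sum_le_sum fun l _ => ?_)
      rw [abs_mul]
      exact mul_le_mul_of_nonneg_left (h3 i l) (abs_nonneg _)
    calc |A.apply (v i) j| ≤ |∑ l, A.mat j l * v i l| + |A.bias j| := abs_add_le _ _
      _ ≤ (∑ l, |A.mat j l|) * 2 ^ e + |A.bias j| * 2 ^ e :=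
        add_le_add hM (le_mul_of_one_le_right (abs_nonneg _) h1e)
      _ = 2 ^ e * (∑ l, |A.mat j l| + |A.bias j|) := by ring
      _ ≤ 2 ^ e * 2 ^ (A.entries.flatMap ratCode).length := by
        refine mul_le_mul_of_nonneg_left ?_ h2e.le
        refine le_trans (add_le_add hA hB) (le_trans ?_ hs)
        exact le_add_of_nonneg_right zero_le_one
      _ = 2 ^ (e + (A.entries.flatMap ratCode).length) := (pow_add _ _ _).symm

theorem exists_code {X N : ℕ} {v : Fin n → Fin r → ℚ} (h : Fits e v) (he : 2 ^ e ≤ X) (hr : r ≤ N)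
    (i : Fin n) : ∃ u < base X ^ (N + 1), vecVal X r u = v i := by
  obtain ⟨⟨D, h0, h1, h2⟩, h3⟩ := h
  obtain ⟨u, hu, hv⟩ := exists_vecVal X r D h0 (h1.trans he) (v i) (h2 i) fun j =>
    (h3 i j).trans (by exact_mod_cast he)
  refine ⟨u, hu.trans_le (Nat.pow_le_pow_right ?_ (by omega)), hv⟩
  rw [base, half]
  omega

end Fits

/-! ### Correctness of the formula -/

/-- The formulas for the vectors after `l` layers describe the sequence `v`. -/
def Describes (X U : ℕ) {k : ℕ} (w : List (Fin k)) (l : ℕ) {r : ℕ}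
    (v : Fin w.length → Fin r → ℚ) : Prop :=
  ∀ u < U, ∀ i, (levelForm X U k l u).Sat w i ↔ v i = vecVal X r u

/-- All vectors of a sequence have codes. -/
def Covered (X U : ℕ) {ι : Type*} {r : ℕ} (v : ι → Fin r → ℚ) : Prop :=
  ∀ i, ∃ u < U, vecVal X r u = v i

namespace Describes

open LTL

variable {X U k l r m : ℕ} {w : List (Fin k)} {v : Fin w.length → Fin r → ℚ}

theorem emb {d : ℕ} {e : Fin k → Fin d → ℚ} {z : List Bool} (hd : embWidth X = d)
    (hX : posEmb X = enc (tupleCode (tupleCode ratCode) e ++ z)) :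
    Describes X U w 0 fun i => e (w.get i) := by
  intro u _ i
  rw [levelForm, sat_bigOr]
  constructor
  · rintro ⟨j, hj, h⟩
    rw [dif_pos hj, sat_guard] at h
    have h2 : w.get i = ⟨j, hj⟩ := h.2
    show e (w.get i) = _
    rw [h2]
    exact (embCheck_iff hd hX ⟨j, hj⟩ u).1 h.1
  · intro h
    refine ⟨w.get i, (w.get i).isLt, ?_⟩
    rw [dif_pos (w.get i).isLt, sat_guard]
    exact ⟨(embCheck_iff hd hX _ u).2 h, rfl⟩

theorem nil (h : Describes X U w l v) (h0 : layerKind (posAfter X l) = 0) :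
    Describes X U w (l + 1) v := by
  intro u hu i
  rw [levelForm, if_pos h0]
  exact h u hu i

theorem relu (h : Describes X U w l v) (hr : widthAt X l = r) (c : Fin r) {z : List Bool}
    (hX : posAfter X l = enc (true :: false :: (natCode c ++ z))) (hv : Covered X U v) :
    Describes X U w (l + 1) (reluRun c v) := by
  intro u hu i
  rw [levelForm, hr, hX, layerKind_relu, if_neg one_ne_zero, if_pos rfl, sat_bigOr]
  simp only [sat_guard, reluCheck_iff]
  constructor
  · rintro ⟨j, hj, h1, h2⟩
    rw [reluRun, (h j hj i).1 h2, h1]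
  · intro h1
    obtain ⟨j, hj, h2⟩ := hv i
    refine ⟨j, hj, ?_, (h j hj i).2 h2.symm⟩
    rw [h2]
    exact h1

theorem sat_scoreForm (h : Describes X U w l v) (κ u a : ℕ)
    (i : Fin w.length) : (scoreForm X U k (levelForm X U k l) κ l u a).Sat w i ↔
      ∃ y < U, vecVal X r y = v i ∧ if κ = 3 then Better X (widthAt X l) (posAfter X l) u a y else
        BetterEq X (widthAt X l) (posAfter X l) u a y := by
  rw [scoreForm, sat_bigOr]
  simp only [sat_guard]
  refine exists_congr fun y => and_congr_right fun hy => ?_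
  rw [h y hy i, and_comm, eq_comm]

/-- The disjunction runs over pairs `u * U + a`. Several pairs of codes may denote the same vectors;
this is harmless, since `Describes` speaks of every code and only the existence of one is needed.
Coverage is required of `v` for the own vector and for the compared ones, and of `L.attention v` for
the attended one. -/
theorem attention (h : Describes X U w l v) (hr : widthAt X l = r) (L : AttentionLayer r m)
    {z : List Bool} (hX : posAfter X l = enc (attCode L z)) (hv : Covered X U v)
    (ha : Covered X U (L.attention v)) : Describes X U w (l + 1) (L.run v) := by
  have hS : ∀ u a, ∀ i, (scoreForm X U k (levelForm X U k l) 3 l u a).Sat w i ↔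
      L.score (vecVal X r u) (vecVal X r a) < L.score (vecVal X r u) (v i) := by
    intro u a i
    rw [h.sat_scoreForm, hr, hX]
    simp only [if_true, better_iff]
    constructor
    · rintro ⟨y, -, hy, h1⟩
      rwa [← hy]
    · intro h1
      obtain ⟨y, hyU, hy⟩ := hv i
      exact ⟨y, hyU, hy, by rwa [hy]⟩
  have hS' : ∀ u a, ∀ i, (scoreForm X U k (levelForm X U k l) 4 l u a).Sat w i ↔
      L.score (vecVal X r u) (vecVal X r a) ≤ L.score (vecVal X r u) (v i) := by
    intro u a i
    rw [h.sat_scoreForm, hr, hX]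
    simp only [show ¬ (4 = 3) by norm_num, if_false, betterEq_iff]
    constructor
    · rintro ⟨y, -, hy, h1⟩
      rwa [← hy]
    · intro h1
      obtain ⟨y, hyU, hy⟩ := hv i
      exact ⟨y, hyU, hy, by rwa [hy]⟩
  have key : ∀ u a, a < U → ∀ i, v i = vecVal X r u →
      ((attLevelForm X U k (levelForm X U k l) l u a).Sat w i ↔
        L.attention v i = vecVal X r a) := by
    intro u a haU i hi
    rw [attLevelForm, hr, hX, maskNum_attCode, tieNum_attCode]
    refine sat_attForm L v i _ (zeroCheck_iff X r a) (h a haU) (fun j => ?_) fun j => ?_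
    · rw [hi]
      cases L.tie
      · exact hS u a j
      · exact hS' u a j
    · rw [hi]
      cases L.tie
      · exact hS' u a j
      · exact hS u a j
  intro u' _ i
  have h2 : layerKind (enc (attCode L z)) = 2 := layerKind_attention _
  rw [levelForm, hr, hX, h2, if_neg two_ne_zero, if_neg (by norm_num), sat_bigOr]
  simp only [sat_guard, attCheck_iff]
  constructor
  · rintro ⟨j, hj, h1, h3, h4⟩
    have hj1 : j / U < U := Nat.div_lt_of_lt_mul hj
    have hj2 : j % U < U := Nat.mod_lt _ (by omega)
    rw [h _ hj1 i] at h3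
    rw [key _ _ hj2 i h3] at h4
    rw [AttentionLayer.run, h3, h4, h1]
  · intro h1
    obtain ⟨u, hu, hu'⟩ := hv i
    obtain ⟨a, haU, ha'⟩ := ha i
    have e1 : (u * U + a) / U = u := by
      rw [mul_comm, Nat.mul_add_div (by omega), Nat.div_eq_of_lt haU, add_zero]
    have e2 : (u * U + a) % U = a := by
      rw [mul_comm, Nat.mul_add_mod, Nat.mod_eq_of_lt haU]
    refine ⟨u * U + a, index_lt hu haU, ?_⟩
    rw [e1, e2, hu', ha']
    exact ⟨h1, (h u hu i).2 hu'.symm, (key u a haU i hu'.symm).2 ha'.symm⟩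

end Describes

theorem length_le_length_flatMap_ratCode (qs : List ℚ) :
    qs.length ≤ (qs.flatMap ratCode).length := by
  induction qs with
  | nil => exact le_rfl
  | cons q qs ih =>
    rw [List.length_cons, List.flatMap_cons, List.length_append]
    simp only [ratCode, List.length_cons]
    omega

theorem Fits.covered {ι : Type*} {X n e r : ℕ} {v : ι → Fin r → ℚ} (h : Fits e v) (hX : 2 ^ n ≤ X)
    (he : e ≤ n) (hr : r ≤ n) : Covered X (base X ^ (n + 1)) v := by
  intro i
  have h' : Fits e fun _ : Fin 1 => v i :=
    ⟨⟨h.1.choose, h.1.choose_spec.1, h.1.choose_spec.2.1, fun _ => h.1.choose_spec.2.2 i⟩,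
      fun _ => h.2 i⟩
  exact h'.exists_code ((Nat.pow_le_pow_right two_pos he).trans hX) hr 0

theorem QAffine.width_le {r m : ℕ} (A : QAffine r m) : m ≤ A.code.length := by
  rw [A.code_eq]
  refine le_trans ?_ (length_le_length_flatMap_ratCode _)
  rw [A.length_entries]
  omega

/-- The invariant is that the current exponent plus the length of the unread code is at most `n`:
whatever a layer adds to the exponent it has removed from the code. Widths stay at most `n` because
the bias of `C` has one entry for each output coordinate. -/
theorem Layers.exists_describes {X n k : ℕ} (hX : 2 ^ n ≤ X) {w : List (Fin k)} {r s : ℕ}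
    (L : Layers r s) : ∀ (l e : ℕ) (v : Fin w.length → Fin r → ℚ) (z : List Bool), r ≤ n →
      widthAt X l = r → posAfter X l = enc (L.code ++ z) →
      Describes X (base X ^ (n + 1)) w l v → Fits e v → e + L.code.length ≤ n →
      ∃ l' ≤ l + L.code.length, widthAt X l' = s ∧ posAfter X l' = enc (false :: z) ∧
        Describes X (base X ^ (n + 1)) w l' (L.run v) ∧
        Covered X (base X ^ (n + 1)) (L.run v) := by
  induction L with
  | nil =>
    intro l e v z hr hw hp hd hf he
    exact ⟨l, by omega, hw, hp, hd, hf.covered hX (by omega) hr⟩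
  | attention hr₀ L rest ih =>
    intro l e v z hr hw hp hd hf he
    have hp' : posAfter X l = enc (attCode L (rest.code ++ z)) := by
      rw [hp, attCode, Layers.code]
      simp only [List.cons_append, List.append_assoc]
    have hC := L.C.width_le
    simp only [Layers.code, AttentionLayer.code, List.length_cons, List.length_append] at he ⊢
    have hf1 := hf.attention L
    have hf2 : Fits e (L.attention v) := by
      refine ⟨⟨hf1.1.choose, hf1.1.choose_spec.1, hf1.1.choose_spec.2.1, fun i j => ?_⟩,
        fun i j => ?_⟩
      · have := hf1.1.choose_spec.2.2 i (Fin.natAdd _ j)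
        simpa only [Fin.append_right] using this
      · have := hf1.2 i (Fin.natAdd _ j)
        simpa only [Fin.append_right] using this
    obtain ⟨l', h1, h2⟩ := ih (l + 1) (e + L.C.code.length) (L.run v) z (by omega)
      (by rw [widthAt_succ, hw, hp', nextWidth_attCode])
      (by rw [posAfter_succ, hw, hp', nextPos_attCode])
      (hd.attention hw L hp' (hf.covered hX (by omega) hr) (hf2.covered hX (by omega) hr))
      (hf1.affine L.C) (by omega)
    exact ⟨l', by omega, h2⟩
  | relu c rest ih =>
    intro l e v z hr hw hp hd hf he
    have hp' : posAfter X l = enc (true :: false :: (natCode c ++ (rest.code ++ z))) := by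
      rw [hp, Layers.code]
      simp only [List.cons_append, List.append_assoc]
    simp only [Layers.code, List.length_cons, List.length_append] at he ⊢
    obtain ⟨l', h1, h2⟩ := ih (l + 1) e (reluRun c v) z hr
      (by rw [widthAt_succ, hw, hp', nextWidth_relu])
      (by rw [posAfter_succ, hw, hp', nextPos_relu])
      (hd.relu hw c hp' (hf.covered hX (by omega) hr)) (hf.relu c) (by omega)
    exact ⟨l', by omega, h2⟩

theorem Describes.nil_add {X U k l r : ℕ} {w : List (Fin k)} {v : Fin w.length → Fin r → ℚ}
    {z : List Bool} (h : Describes X U w l v) (hw : widthAt X l = r)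
    (hp : posAfter X l = enc (false :: z)) (t : ℕ) : widthAt X (l + t) = r ∧
      posAfter X (l + t) = enc (false :: z) ∧ Describes X U w (l + t) v := by
  induction t with
  | zero => exact ⟨hw, hp, h⟩
  | succ t ih =>
    obtain ⟨h1, h2, h3⟩ := ih
    refine ⟨?_, ?_, h3.nil (by rw [h2, layerKind_nil])⟩
    · rw [← add_assoc, widthAt_succ, h1, h2, nextWidth_nil]
    · rw [← add_assoc, posAfter_succ, h1, h2, nextPos_nil]

namespace UHAT

variable {k : ℕ} (T : UHAT k)

theorem natVal_code : natVal (enc T.code) = k := natVal_enc _ _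

theorem sat_acceptForm (w : List (Fin k)) (i : Fin w.length) :
    (acceptForm (enc T.code) (base (enc T.code) ^ (T.size + 1)) k T.size).Sat w i ↔
      0 < T.accept ⬝ᵥ T.run w i := by
  set X := enc T.code with hX
  have h1 : skipNat X = enc (natCode T.d ++ (tupleCode (tupleCode ratCode) T.emb ++
      (T.layers.code ++ (tupleCode ratCode T.accept ++ T.out.code)))) := skipNat_enc _ _
  have hd : embWidth X = T.d := by rw [embWidth, h1, natVal_enc]
  have hE : posEmb X = enc (tupleCode (tupleCode ratCode) T.emb ++
      (T.layers.code ++ (tupleCode ratCode T.accept ++ T.out.code))) := by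
    rw [posEmb, h1, skipNat_enc]
  have hL : posLayers X = enc (T.layers.code ++ (tupleCode ratCode T.accept ++ T.out.code)) := by
    rw [posLayers, hE, hd, T.natVal_code, tupleCode_tupleCode, ← length_matEntries T.emb,
      ratPos_enc_length]
  -- The alphabet is non-empty because `w` has a position. Without symbols the code of the embedding
  -- would be empty and could not bound the width `T.d`.
  have hk : 1 ≤ k := (Nat.zero_le _).trans_lt (w.get i).isLt
  have hn : (tupleCode (tupleCode ratCode) T.emb).length + T.layers.code.length ≤ T.size := by
    simp only [UHAT.size, UHAT.code, List.length_append]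
    omega
  have hdn : T.d ≤ (tupleCode (tupleCode ratCode) T.emb).length := by
    rw [tupleCode_tupleCode]
    refine le_trans ?_ (length_le_length_flatMap_ratCode _)
    rw [length_matEntries]
    exact Nat.le_mul_of_pos_left _ hk
  have hf : Fits (tupleCode (tupleCode ratCode) T.emb).length fun i => T.emb (w.get i) := by
    obtain ⟨⟨D, h0, h1, h2⟩, h3⟩ := Fits.emb T.emb
    exact ⟨⟨D, h0, h1, fun i => h2 _⟩, fun i => h3 _⟩
  obtain ⟨l, hl, hw, hp, hD, hC⟩ := T.layers.exists_describes (X := X) (n := T.size)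
    (two_pow_le_enc T.code) 0 _ (fun i => T.emb (w.get i)) _ (hdn.trans (by omega))
    (by rw [widthAt_zero, hd]) (by rw [posAfter_zero, hL]) (Describes.emb hd hE) hf hn
  -- The true number `l` of layers is padded with idle layers up to `T.size`, the index used in
  -- `acceptForm`.
  obtain ⟨hw, hp, hD⟩ := hD.nil_add hw hp (T.size - l)
  rw [Nat.add_sub_cancel' (by omega)] at hw hp hD
  rw [acceptForm, LTL.sat_bigOr, hw, hp, enc_cons_div]
  simp only [LTL.sat_guard, accCheck_iff]
  constructor
  · rintro ⟨u, hu, h3, h4⟩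
    rw [hD u hu i] at h4
    rw [UHAT.run, h4]
    exact h3
  · intro h3
    obtain ⟨u, hu, h4⟩ := hC i
    refine ⟨u, hu, ?_, (hD u hu i).2 h4.symm⟩
    rw [h4]
    exact h3

theorem language_acceptForm :
    (acceptForm (enc T.code) (base (enc T.code) ^ (T.size + 1)) k T.size).language T.out =
      T.language := by
  ext w
  exact exists_congr fun h => T.sat_acceptForm w _

end UHAT

/-! ### The translating machine -/

/-! ### The machine -/

namespace Prog

/-- The store with a given list of stacks. -/
def stk (l : List (List Bool)) : Store := fun j => l.getD j []

theorem update_stk (l : List (List Bool)) {j : ℕ} (x : List Bool) (hj : j < l.length) :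
    Function.update (stk l) j x = stk (l.set j x) := by
  funext i
  rw [Function.update_apply, stk, stk, List.getD_eq_getElem?_getD, List.getD_eq_getElem?_getD,
    List.getElem?_set]
  by_cases h : i = j
  · subst h; simp [hj]
  · simp [h, Ne.symm h]

theorem stk_eq_nil {l : List (List Bool)} {a : ℕ} (h : ∀ x ∈ l.drop a, x = []) (j : ℕ)
    (hj : a ≤ j) : stk l j = [] := by
  obtain ⟨i, rfl⟩ := Nat.exists_eq_add_of_le hj
  rw [stk, List.getD_eq_getElem?_getD, ← List.getElem?_drop]
  cases hx : (l.drop a)[i]? with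
  | none => rfl
  | some x => exact h x (List.mem_of_getElem? hx)

theorem Run.stk {p : Prog} {l l' : List (List Bool)} {j T : ℕ} {x : List Bool}
    (h : Run p (stk l) (Function.update (stk l) j x) T) (hj : j < l.length) (e : l.set j x = l') :
    Run p (Prog.stk l) (Prog.stk l') T :=
  h.to (by rw [update_stk l x hj, e])

theorem run_clear_stk {l l' : List (List Bool)} {a n : ℕ} (h : stk l a = rep n)
    (ha : a < l.length) (e : l.set a [] = l') :
    Run (clear a) (stk l) (stk l') (2 * n + 1) := (run_clear h).stk ha e

theorem run_move_stk {l l' : List (List Bool)} {a b n : ℕ} {x : List Bool} (hab : a ≠ b)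
    (h : stk l a = rep n ++ x) (hx : headTrue x.head? = false) (ha : a < l.length)
    (hb : b < l.length) (e : (l.set a x).set b (rep n ++ stk l b) = l') :
    Run (move a b) (stk l) (stk l') (3 * n + 1) :=
  (run_move hab h hx).to (by
    rw [update_stk l x ha, update_stk _ _ (by rwa [List.length_set]), e])

/-- The test for a nonempty stack. -/
def nonempty (o : Option Bool) : Bool := o.isSome

/-- The program that replaces the number in one stack by the number in another one. -/
def replace (a b : ℕ) : Prog := seq (clear a) (move b a)

theorem run_replace_stk {l l' : List (List Bool)} {a b m n : ℕ} (hab : b ≠ a)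
    (h : stk l a = rep m) (h' : stk l b = rep n) (ha : a < l.length) (hb : b < l.length)
    (e : (l.set a (rep n)).set b [] = l') :
    Run (replace a b) (stk l) (stk l') (2 * m + 3 * n + 2) := by
  refine ((run_clear h).seq (run_move (n := n) (l := []) hab ?_ rfl)).mono (by omega) |>.to ?_
  · rw [Function.update_of_ne hab, h', List.append_nil]
  · rw [Function.update_self, List.append_nil, ← e, update_stk l _ ha, update_stk _ _ (by simpa),
      update_stk _ _ (by simpa), List.set_comm _ _ hab, List.set_set]

/-! ### Reading the input -/

/-- Reverses the input. -/
def reverseInput : Prog :=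
  loop 0 nonempty (seq (ite 0 headTrue (push 2 true) (push 2 false)) (pop 0))

theorem run_reverseInput (x y : List Bool) :
    Run reverseInput (stk [x, [], y, [], [], [], [], [], []])
      (stk [[], [], x.reverse ++ y, [], [], [], [], [], []]) (4 * x.length + 1) := by
  induction x generalizing y with
  | nil => exact Run.loop_end rfl
  | cons b x ih =>
    have h1 : Run (ite 0 headTrue (push 2 true) (push 2 false))
        (stk [b :: x, [], y, [], [], [], [], [], []])
        (stk [b :: x, [], b :: y, [], [], [], [], [], []]) (1 + 1) := by
      cases b
      · exact Run.ite_false rfl ((run_push 2 false _).stk (by simp) rfl)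
      · exact Run.ite_true rfl ((run_push 2 true _).stk (by simp) rfl)
    have h2 : Run (pop 0) (stk [b :: x, [], b :: y, [], [], [], [], [], []])
        (stk [x, [], b :: y, [], [], [], [], [], []]) 1 := (run_pop 0 _).stk (by simp) rfl
    refine ((Run.loop_step rfl (h1.seq h2) (ih (b :: y))).mono ?_).to ?_
    · rw [List.length_cons]; omega
    · simp

/-- There is a program that computes the number of the input, and its length. -/
theorem exists_read : ∃ (p : Prog) (c : ℕ), ∀ (x : List Bool) (B : ℕ), 2 ≤ B → enc x ≤ B →
    Run p (stk [x, [], [], [], [], [], [], [], []])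
      (stk [[], [], [], rep (enc x), rep x.length, [], [], [], []]) (B ^ c) := by
  have hF : Feasible fun v : Fin 1 → ℕ => 2 * v 0 := by fun_prop
  obtain ⟨p, c, hp⟩ := hF
  -- Stack `2` holds the reversed input and later the pending tokens; stacks `3`, `4`, `5` hold `X`,
  -- `n`, `U` in unary, and `6` to `8` are scratch. The input is read from its end because `enc`
  -- takes the first bit as the least significant one. Clearing the empty stack `6` does nothing.
  let body : Prog := seq (p (fun _ => 3) 6) (seq (replace 3 6)
    (seq (ite 2 headTrue (push 3 true) (clear 6)) (seq (pop 2) (push 4 true))))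
  have hbody : ∀ (b : Bool) (l l₂ : List Bool) (B : ℕ), 2 ≤ B → enc (b :: l₂) ≤ B →
      Run body (stk [[], [], b :: l, rep (enc l₂), rep l₂.length, [], [], [], []])
        (stk [[], [], l, rep (enc (b :: l₂)), rep (b :: l₂).length, [], [], [], []])
        (B ^ c + (5 * B + 6)) := by
    intro b l l₂ B hB hb
    have hb' : 2 * enc l₂ ≤ B := (Nat.le_add_right _ _).trans hb
    have h1 := ((hp B hB (fun _ => enc l₂) fun _ => by omega).2 (fun _ => 3) 6
      (stk [[], [], b :: l, rep (enc l₂), rep l₂.length, [], [], [], []]) (fun _ => by norm_num)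
      (fun _ => rfl) (stk_eq_nil (by simp))).stk (by simp) rfl
    have h2 : Run (replace 3 6)
        (stk [[], [], b :: l, rep (enc l₂), rep l₂.length, [], rep (2 * enc l₂), [], []])
        (stk [[], [], b :: l, rep (2 * enc l₂), rep l₂.length, [], [], [], []])
        (2 * enc l₂ + 3 * (2 * enc l₂) + 2) :=
      run_replace_stk (by norm_num) rfl rfl (by simp) (by simp) rfl
    have h3 : Run (ite 2 headTrue (push 3 true) (clear 6))
        (stk [[], [], b :: l, rep (2 * enc l₂), rep l₂.length, [], [], [], []])
        (stk [[], [], b :: l, rep (enc (b :: l₂)), rep l₂.length, [], [], [], []]) (1 + 1) := by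
      cases b
      · exact Run.ite_false rfl (run_clear_stk (n := 0) rfl (by simp) rfl)
      · exact Run.ite_true rfl ((run_push 3 true _).stk (by simp) rfl)
    have h4 : Run (pop 2)
        (stk [[], [], b :: l, rep (enc (b :: l₂)), rep l₂.length, [], [], [], []])
        (stk [[], [], l, rep (enc (b :: l₂)), rep l₂.length, [], [], [], []]) 1 :=
      (run_pop 2 _).stk (by simp) rfl
    have h5 : Run (push 4 true)
        (stk [[], [], l, rep (enc (b :: l₂)), rep l₂.length, [], [], [], []])
        (stk [[], [], l, rep (enc (b :: l₂)), rep (b :: l₂).length, [], [], [], []]) 1 :=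
      (run_push 4 true _).stk (by simp) rfl
    exact (h1.seq (h2.seq (h3.seq (h4.seq h5)))).mono (by omega)
  have hloop : ∀ (l l₂ : List Bool) (B : ℕ), 2 ≤ B → enc (l.reverse ++ l₂) ≤ B →
      Run (loop 2 nonempty body)
        (stk [[], [], l, rep (enc l₂), rep l₂.length, [], [], [], []])
        (stk [[], [], [], rep (enc (l.reverse ++ l₂)), rep (l.reverse ++ l₂).length, [], [], [], []])
        (l.length * (B ^ c + (5 * B + 7)) + 1) := by
    intro l
    induction l with
    | nil => intro l₂ B _ _; exact (Run.loop_end rfl).mono (by omega)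
    | cons b l ih =>
      intro l₂ B hB hb
      rw [List.reverse_cons, List.append_assoc] at hb ⊢
      have h1 := hbody b l l₂ B hB ((enc_le_append _ _).trans hb)
      refine (Run.loop_step rfl h1 (ih (b :: l₂) B hB hb)).mono (le_of_eq ?_)
      rw [List.length_cons]
      ring
  have hT : PolyBdd fun B => (4 * B + 1) + (1 + (B * (B ^ c + (5 * B + 7)) + 1)) :=
    (((PolyBdd.const 4).mul .id).add (.const 1)).add ((PolyBdd.const 1).add
      ((PolyBdd.id.mul ((PolyBdd.pow c).add (((PolyBdd.const 5).mul .id).add (.const 7)))).add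
        (.const 1)))
  obtain ⟨d, hd⟩ := hT
  beta_reduce at hd
  refine ⟨seq reverseInput (seq (push 3 true) (loop 2 nonempty body)), d, fun x B hB hx => ?_⟩
  have hl : x.length ≤ B := (length_le_enc x).trans hx
  have h1 := run_reverseInput x []
  rw [List.append_nil] at h1
  have h2 : Run (push 3 true) (stk [[], [], x.reverse, [], [], [], [], [], []])
      (stk [[], [], x.reverse, rep (enc []), [], [], [], [], []]) 1 :=
    (run_push 3 true _).stk (by simp) rfl
  have h3 := hloop x.reverse [] B hB (by simpa using hx)
  rw [List.reverse_reverse, List.append_nil, List.length_reverse] at h3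
  refine (h1.seq (h2.seq h3)).mono (le_trans ?_ (hd B hB))
  have := Nat.mul_le_mul_right (B ^ c + (5 * B + 7)) hl
  omega

/-- There is a program that computes a bound for the codes of vectors. -/
theorem exists_pow : ∃ (p : Prog) (c : ℕ), ∀ X n B : ℕ, 2 ≤ B → X ≤ B → n ≤ B →
    base X ^ (n + 1) ≤ B → Run p (stk [[], [], [], rep X, rep n, [], [], [], []])
      (stk [[], [], [], rep X, rep n, rep (base X ^ (n + 1)), [], [], []]) (B ^ c) := by
  have hF : Feasible fun v : Fin 2 → ℕ => v 0 * base (v 1) := by unfold base half; fun_prop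
  obtain ⟨p, c, hp⟩ := hF
  -- The power is not polynomial in `X` and `n`, hence not `Feasible`. Only one multiplication is,
  -- and the loop is timed by a bound `B` for the result.
  let body : Prog := seq (pop 6) (seq (p ![5, 3] 7) (replace 5 7))
  have hT : PolyBdd fun B => 1 + ((7 * B + 2) + (1 + ((B + 1) * ((B ^ c + 5 * B + 3) + 1) + 1))) :=
    (PolyBdd.const 1).add ((((PolyBdd.const 7).mul .id).add (.const 2)).add ((PolyBdd.const 1).add
      (((PolyBdd.id.add (.const 1)).mul ((((PolyBdd.pow c).add ((PolyBdd.const 5).mul .id)).add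
        (.const 3)).add (.const 1))).add (.const 1))))
  obtain ⟨d, hd⟩ := hT
  beta_reduce at hd
  refine ⟨seq (push 5 true) (seq (copy 4 6 7) (seq (push 6 true) (loop 6 headTrue body))), d,
    fun X n B hB hX hn hU => ?_⟩
  have h1 : Run (push 5 true) (stk [[], [], [], rep X, rep n, [], [], [], []])
      (stk [[], [], [], rep X, rep n, rep 1, [], [], []]) 1 := (run_push 5 true _).stk (by simp) rfl
  have h2 : Run (copy 4 6 7) (stk [[], [], [], rep X, rep n, rep 1, [], [], []])
      (stk [[], [], [], rep X, rep n, rep 1, rep n, [], []]) (7 * n + 2) :=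
    (run_copy (a := 4) (b := 6) (c := 7) (n := n) (by norm_num) (by norm_num) (by norm_num) rfl rfl
      rfl).stk (by simp) rfl
  have h3 : Run (push 6 true) (stk [[], [], [], rep X, rep n, rep 1, rep n, [], []])
      (stk [[], [], [], rep X, rep n, rep 1, rep (n + 1), [], []]) 1 :=
    (run_push 6 true _).stk (by simp) rfl
  have hb : 1 ≤ base X := by rw [base, half]; omega
  have hpow : ∀ i ≤ n + 1, base X ^ i ≤ B := fun i hi =>
    (Nat.pow_le_pow_right hb hi).trans hU
  have h4 := run_loop (k := 6) (f := headTrue) (p := body)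
    (fun i => stk [[], [], [], rep X, rep n, rep (base X ^ i), rep (n + 1 - i), [], []])
    (B ^ c + 5 * B + 3) (n + 1) ?_ ?_ ?_
  · have e : n + 1 - (n + 1) = 0 := Nat.sub_self _
    simp only [pow_zero, Nat.sub_zero, e] at h4
    refine (h1.seq (h2.seq (h3.seq h4))).mono (le_trans ?_ (hd B hB))
    have := Nat.mul_le_mul_right ((B ^ c + 5 * B + 3) + 1) (show n + 1 ≤ B + 1 by omega)
    omega
  · intro i hi
    obtain ⟨m, hm⟩ : ∃ m, n + 1 - i = m + 1 := ⟨n - i, by omega⟩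
    rw [hm]
    rfl
  · rw [Nat.sub_self]
    rfl
  · intro i hi
    obtain ⟨m, hm⟩ : ∃ m, n + 1 - i = m + 1 := ⟨n - i, by omega⟩
    have hm' : n + 1 - (i + 1) = m := by omega
    rw [hm, hm']
    have h5 : Run (pop 6)
        (stk [[], [], [], rep X, rep n, rep (base X ^ i), rep (m + 1), [], []])
        (stk [[], [], [], rep X, rep n, rep (base X ^ i), rep m, [], []]) 1 :=
      (run_pop 6 _).stk (by simp) rfl
    have h6 : Run (p ![5, 3] 7)
        (stk [[], [], [], rep X, rep n, rep (base X ^ i), rep m, [], []])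
        (stk [[], [], [], rep X, rep n, rep (base X ^ i), rep m, rep (base X ^ i * base X), []])
        (B ^ c) :=
      ((hp B hB ![base X ^ i, X] (by
        simp only [Fin.forall_fin_two]
        exact ⟨hpow i (by omega), hX⟩)).2 ![5, 3] 7 _ (by simp [Fin.forall_fin_two])
        (by simp only [Fin.forall_fin_two]; exact ⟨rfl, rfl⟩) (stk_eq_nil (by simp))).stk
        (by simp) rfl
    have h7 : Run (replace 5 7)
        (stk [[], [], [], rep X, rep n, rep (base X ^ i), rep m, rep (base X ^ i * base X), []])
        (stk [[], [], [], rep X, rep n, rep (base X ^ i * base X), rep m, [], []])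
        (2 * base X ^ i + 3 * (base X ^ i * base X) + 2) :=
      run_replace_stk (by norm_num) rfl rfl (by simp) (by simp) rfl
    rw [pow_succ]
    have e1 := hpow i (by omega)
    have e2 := hpow (i + 1) (by omega)
    rw [pow_succ] at e2
    exact (h5.seq (h6.seq h7)).mono (by omega)

/-! ### Expanding tokens -/

/-- There is a program that writes the initial token. -/
theorem exists_root : ∃ (p : Prog) (c : ℕ), ∀ X n U B : ℕ, 2 ≤ B → n ≤ B → U ≤ B →
    orTok 5 n 0 0 U ≤ B ^ c ∧ Run p (stk [[], [], [], rep X, rep n, rep U, [], [], []])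
      (stk [[], [], rep (orTok 5 n 0 0 U) ++ [false], rep X, rep n, rep U, [], [], []])
      (B ^ c) := by
  have hF : Feasible fun v : Fin 2 → ℕ => orTok 5 (v 0) 0 0 (v 1) := by fun_prop
  obtain ⟨p, c, hp⟩ := hF
  have hT : PolyBdd fun B => B ^ c + (1 + (3 * B ^ c + 1)) :=
    (PolyBdd.pow c).add ((PolyBdd.const 1).add (((PolyBdd.const 3).mul (.pow c)).add (.const 1)))
  obtain ⟨d, hd⟩ := hT
  beta_reduce at hd
  refine ⟨seq (p ![4, 5] 6) (seq (push 2 false) (move 6 2)), d, fun X n U B hB hn hU => ?_⟩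
  obtain ⟨e1, e2⟩ := hp B hB ![n, U] (by simp only [Fin.forall_fin_two]; exact ⟨hn, hU⟩)
  have hd := hd B hB
  have e1' : orTok 5 n 0 0 U ≤ B ^ c := e1
  refine ⟨e1'.trans (by omega), ?_⟩
  have h1 : Run (p ![4, 5] 6) (stk [[], [], [], rep X, rep n, rep U, [], [], []])
      (stk [[], [], [], rep X, rep n, rep U, rep (orTok 5 n 0 0 U), [], []]) (B ^ c) :=
    (e2 ![4, 5] 6 _ (by simp [Fin.forall_fin_two])
      (by simp only [Fin.forall_fin_two]; exact ⟨rfl, rfl⟩) (stk_eq_nil (by simp))).stk (by simp) rfl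
  have h2 : Run (push 2 false)
      (stk [[], [], [], rep X, rep n, rep U, rep (orTok 5 n 0 0 U), [], []])
      (stk [[], [], [false], rep X, rep n, rep U, rep (orTok 5 n 0 0 U), [], []]) 1 :=
    (run_push 2 false _).stk (by simp) rfl
  have h3 : Run (move 6 2)
      (stk [[], [], [false], rep X, rep n, rep U, rep (orTok 5 n 0 0 U), [], []])
      (stk [[], [], rep (orTok 5 n 0 0 U) ++ [false], rep X, rep n, rep U, [], [], []])
      (3 * orTok 5 n 0 0 U + 1) :=
    run_move_stk (by norm_num) (List.append_nil _).symm rfl (by simp) (by simp) rfl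
  exact (h1.seq (h2.seq h3)).mono (by omega)

end Prog

theorem Gen.le {X U M t N : ℕ} {s : List Bool} (hM : 2 ≤ M) (h : Gen X U M t s N) : t ≤ M := by
  cases h <;> omega

namespace Prog

/-- There is a program that expands a token. -/
theorem exists_expand : ∃ (p : Prog) (c : ℕ), ∀ X U M : ℕ, 2 ≤ M → X ≤ M → U ≤ M →
    ∀ (t N : ℕ) (s z : List Bool), Gen X U M t s N →
      Run p (stk [[], [], rep t ++ [false], rep X, z, rep U, [], [], []])
        (stk [[], s, [], rep X, z, rep U, [], [], []]) (N * M ^ c + 1) := by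
  have hL : Feasible fun v : Fin 3 → ℕ => leftTok (v 0) (v 1) (v 2) := by fun_prop
  have hR : Feasible fun v : Fin 1 → ℕ => rightTok (v 0) := by fun_prop
  obtain ⟨pl, a, hl⟩ := hL
  obtain ⟨pr, b, hr⟩ := hR
  -- The right token is pushed last and therefore expanded first. The output is thus written from
  -- its end, and the output stack finally shows the first bit on top.
  let node : Prog := seq (pl ![3, 5, 6] 7) (seq (pr (fun _ => 6) 8) (seq (clear 6)
    (seq (push 2 false) (seq (move 7 2) (seq (push 2 false) (move 8 2))))))
  let body : Prog := seq (move 2 6) (seq (pop 2) (ite 6 headTrue (seq (pop 6)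
    (ite 6 headTrue (seq (pop 6) (ite 6 headTrue (seq (pop 6) node) (clear 6))) (push 1 true)))
    (push 1 false)))
  have hT : PolyBdd fun M => (M ^ a + M ^ b + 11 * M + 20) + 1 :=
    ((((PolyBdd.pow a).add (.pow b)).add ((PolyBdd.const 11).mul .id)).add (.const 20)).add
      (.const 1)
  obtain ⟨c, hc⟩ := hT
  beta_reduce at hc
  refine ⟨loop 2 nonempty body, c, fun X U M hM hX hU t N s z hg => ?_⟩
  have hc := hc M hM
  have hstart : ∀ (t : ℕ) (o y : List Bool), Run (seq (move 2 6) (pop 2))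
      (stk [[], o, rep t ++ false :: y, rep X, z, rep U, [], [], []])
      (stk [[], o, y, rep X, z, rep U, rep t, [], []]) (3 * t + 1 + 1) := by
    intro t o y
    have h1 : Run (move 2 6) (stk [[], o, rep t ++ false :: y, rep X, z, rep U, [], [], []])
        (stk [[], o, false :: y, rep X, z, rep U, rep t ++ [], [], []]) (3 * t + 1) :=
      run_move_stk (by norm_num) rfl rfl (by simp) (by simp) rfl
    rw [List.append_nil] at h1
    exact h1.seq ((run_pop 2 _).stk (by simp) rfl)
  have hpop : ∀ (t : ℕ) (o y : List Bool), Run (pop 6)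
      (stk [[], o, y, rep X, z, rep U, rep (t + 1), [], []])
      (stk [[], o, y, rep X, z, rep U, rep t, [], []]) 1 := fun t o y =>
    (run_pop 6 _).stk (by simp) rfl
  have hassoc : ∀ {q : Prog} {s₁ s₂ s₃ : Store} {T₁ T₂ : ℕ}, Run (seq (move 2 6) (pop 2)) s₁ s₂ T₁ →
      Run q s₂ s₃ T₂ → Run (seq (move 2 6) (seq (pop 2) q)) s₁ s₃ (T₁ + T₂) := by
    rintro q s₁ s₂ s₃ T₁ T₂ ⟨t₁, h₁, e₁⟩ ⟨t₂, h₂, e₂⟩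
    cases e₁ with
    | seq e₁ e₃ => exact ⟨_, by omega, e₁.seq (e₃.seq e₂)⟩
  have hnode : ∀ (x : ℕ) (o y : List Bool), x ≤ M → leftTok X U x ≤ M → rightTok x ≤ M →
      Run node (stk [[], o, y, rep X, z, rep U, rep x, [], []])
        (stk [[], o, rep (rightTok x) ++ false :: (rep (leftTok X U x) ++ false :: y), rep X, z,
          rep U, [], [], []]) (M ^ a + M ^ b + 8 * M + 5) := by
    intro x o y hx hlt hrt
    have h1 : Run (pl ![3, 5, 6] 7) (stk [[], o, y, rep X, z, rep U, rep x, [], []])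
        (stk [[], o, y, rep X, z, rep U, rep x, rep (leftTok X U x), []]) (M ^ a) :=
      ((hl M hM ![X, U, x] (by
        simp only [Fin.forall_fin_succ]
        exact ⟨hX, hU, hx, fun i => i.elim0⟩)).2 ![3, 5, 6] 7 _ (by simp [Fin.forall_fin_succ])
        (by simp only [Fin.forall_fin_succ]; exact ⟨rfl, rfl, rfl, fun i => i.elim0⟩)
        (stk_eq_nil (by simp))).stk (by simp) rfl
    have h2 : Run (pr (fun _ => 6) 8)
        (stk [[], o, y, rep X, z, rep U, rep x, rep (leftTok X U x), []])
        (stk [[], o, y, rep X, z, rep U, rep x, rep (leftTok X U x), rep (rightTok x)]) (M ^ b) :=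
      ((hr M hM (fun _ => x) fun _ => hx).2 (fun _ => 6) 8 _ (fun _ => by norm_num)
        (fun _ => rfl) (stk_eq_nil (by simp))).stk (by simp) rfl
    have h3 : Run (clear 6)
        (stk [[], o, y, rep X, z, rep U, rep x, rep (leftTok X U x), rep (rightTok x)])
        (stk [[], o, y, rep X, z, rep U, [], rep (leftTok X U x), rep (rightTok x)])
        (2 * x + 1) := run_clear_stk rfl (by simp) rfl
    have h4 : Run (push 2 false)
        (stk [[], o, y, rep X, z, rep U, [], rep (leftTok X U x), rep (rightTok x)])
        (stk [[], o, false :: y, rep X, z, rep U, [], rep (leftTok X U x), rep (rightTok x)]) 1 :=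
      (run_push 2 false _).stk (by simp) rfl
    have h5 : Run (move 7 2)
        (stk [[], o, false :: y, rep X, z, rep U, [], rep (leftTok X U x), rep (rightTok x)])
        (stk [[], o, rep (leftTok X U x) ++ false :: y, rep X, z, rep U, [], [],
          rep (rightTok x)]) (3 * leftTok X U x + 1) :=
      run_move_stk (by norm_num) (List.append_nil _).symm rfl (by simp) (by simp) rfl
    have h6 : Run (push 2 false)
        (stk [[], o, rep (leftTok X U x) ++ false :: y, rep X, z, rep U, [], [], rep (rightTok x)])
        (stk [[], o, false :: (rep (leftTok X U x) ++ false :: y), rep X, z, rep U, [], [],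
          rep (rightTok x)]) 1 := (run_push 2 false _).stk (by simp) rfl
    have h7 : Run (move 8 2)
        (stk [[], o, false :: (rep (leftTok X U x) ++ false :: y), rep X, z, rep U, [], [],
          rep (rightTok x)])
        (stk [[], o, rep (rightTok x) ++ false :: (rep (leftTok X U x) ++ false :: y), rep X, z,
          rep U, [], [], []]) (3 * rightTok x + 1) :=
      run_move_stk (by norm_num) (List.append_nil _).symm rfl (by simp) (by simp) rfl
    exact (h1.seq (h2.seq (h3.seq (h4.seq (h5.seq (h6.seq h7)))))).mono (by omega)
  have hstep : ∀ {s₁ s₂ s₃ : Store} {T N N' : ℕ}, nonempty (s₁ 2).head? = true →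
      Run body s₁ s₂ (M ^ a + M ^ b + 11 * M + 20) →
      Run (loop 2 nonempty body) s₂ s₃ (N * M ^ c + T) → N + 1 ≤ N' →
      Run (loop 2 nonempty body) s₁ s₃ (N' * M ^ c + T) := by
    intro s₁ s₂ s₃ T N N' h0 h1 h2 hN
    refine (Run.loop_step h0 h1 h2).mono ?_
    have := Nat.mul_le_mul_right (M ^ c) hN
    rw [add_mul, one_mul] at this
    omega
  have hne : ∀ (t : ℕ) (o y : List Bool),
      nonempty (stk [[], o, rep t ++ false :: y, rep X, z, rep U, [], [], []] 2).head? = true := by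
    rintro (_ | t) o y <;> rfl
  -- A run of a loop is built by prepending iterations, so the claim has continuation form: any run
  -- that starts after `s` has been written extends to one that starts with `t` on top. At a node,
  -- the continuation of the right token is the run for the left one.
  have key : ∀ (t N : ℕ) (s : List Bool), Gen X U M t s N → ∀ (o y : List Bool) (s' : Store) (T : ℕ),
      Run (loop 2 nonempty body) (stk [[], s ++ o, y, rep X, z, rep U, [], [], []]) s' T →
      Run (loop 2 nonempty body)
        (stk [[], o, rep t ++ false :: y, rep X, z, rep U, [], [], []]) s' (N * M ^ c + T) := by
    intro t N s hg
    induction hg with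
    | zero h =>
      intro o y s' T hrun
      refine hstep (N := 0) (hne _ _ _) ((hassoc (hstart 0 o y) (Run.ite_false rfl
        ((run_push 1 false _).stk (by simp) rfl))).mono (by omega)) (hrun.mono (by omega)) h
    | one h =>
      intro o y s' T hrun
      refine hstep (N := 0) (hne _ _ _) ((hassoc (hstart 1 o y) (Run.ite_true rfl
        ((hpop 0 o y).seq (Run.ite_false rfl ((run_push 1 true _).stk (by simp) rfl))))).mono
          (by omega)) (hrun.mono (by omega)) h
    | empty h =>
      intro o y s' T hrun
      refine hstep (N := 0) (hne _ _ _) ((hassoc (hstart 2 o y) (Run.ite_true rfl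
        ((hpop 1 o y).seq (Run.ite_true rfl ((hpop 0 o y).seq (Run.ite_false rfl
          (run_clear_stk (n := 0) rfl (by simp) rfl))))))).mono
          (by omega)) (hrun.mono (by omega)) h
    | @node x N N₁ N₂ s₁ s₂ hx h₁ h₂ h ih₁ ih₂ =>
      intro o y s' T hrun
      rw [List.append_assoc] at hrun
      have h3 := ih₂ o _ s' _ (ih₁ (s₂ ++ o) y s' T hrun)
      rw [← add_assoc, ← add_mul] at h3
      exact hstep (hne _ _ _) ((hassoc (hstart (x + 3) o y) (Run.ite_true rfl
        ((hpop (x + 2) o y).seq (Run.ite_true rfl ((hpop (x + 1) o y).seq (Run.ite_true rfl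
          ((hpop x o y).seq (hnode x o y (by omega) (h₁.le hM) (h₂.le hM))))))))).mono
          (by omega)) h3 (by omega)
  have := key t N s hg [] [] _ 1 (Run.loop_end rfl)
  rwa [List.append_nil] at this

/-- There is a program that computes the formula of a transformer, in time polynomial in a bound for
the codes of vectors, the tokens, and the size of the formula. -/
theorem exists_translate : ∃ (p : Prog) (c : ℕ), ∀ (x s : List Bool) (B U N : ℕ), 2 ≤ B →
    U = base (enc x) ^ (x.length + 1) → enc x ≤ B → U ≤ B → N ≤ B →
    Gen (enc x) U B (orTok 5 x.length 0 0 U) s N →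
    Run p (Function.update (fun _ => []) 0 x) (Function.update (fun _ => []) 1 s) (B ^ c) := by
  obtain ⟨p₁, c₁, h₁⟩ := exists_read
  obtain ⟨p₂, c₂, h₂⟩ := exists_pow
  obtain ⟨p₃, c₃, h₃⟩ := exists_root
  obtain ⟨p₄, c₄, h₄⟩ := exists_expand
  have hT : PolyBdd fun B => B ^ c₁ + (B ^ c₂ + (B ^ c₃ + ((B * B ^ c₄ + 1) + (6 * B + 3)))) :=
    (PolyBdd.pow c₁).add ((PolyBdd.pow c₂).add ((PolyBdd.pow c₃).add
      (((PolyBdd.id.mul (.pow c₄)).add (.const 1)).add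
        (((PolyBdd.const 6).mul .id).add (.const 3)))))
  obtain ⟨d, hd⟩ := hT
  beta_reduce at hd
  -- The last three programs remove `X`, `n` and `U`, since only the output may remain.
  refine ⟨seq p₁ (seq p₂ (seq p₃ (seq p₄ (seq (clear 3) (seq (clear 4) (clear 5)))))), d,
    fun x s B U N hB hU hx hUB hN hg => ?_⟩
  have hl : x.length ≤ B := (length_le_enc x).trans hx
  have e0 : (Function.update (fun _ => []) 0 x : Store) = stk [x, [], [], [], [], [], [], [], []] := by
    have : (fun _ => [] : Store) = stk [[], [], [], [], [], [], [], [], []] :=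
      funext fun j => (stk_eq_nil (a := 0) (by simp) j (Nat.zero_le j)).symm
    rw [this, update_stk _ _ (by simp)]
    rfl
  have e1 : (Function.update (fun _ => []) 1 s : Store) = stk [[], s, [], [], [], [], [], [], []] := by
    have : (fun _ => [] : Store) = stk [[], [], [], [], [], [], [], [], []] :=
      funext fun j => (stk_eq_nil (a := 0) (by simp) j (Nat.zero_le j)).symm
    rw [this, update_stk _ _ (by simp)]
    rfl
  rw [e0, e1]
  have r1 := h₁ x B hB hx
  have r2 := h₂ (enc x) x.length B hB hx hl (hU ▸ hUB)
  rw [← hU] at r2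
  have r3 := (h₃ (enc x) x.length U B hB hl hUB).2
  have r4 := h₄ (enc x) U B hB hx hUB _ N s (rep x.length) hg
  have r5 : Run (clear 3) (stk [[], s, [], rep (enc x), rep x.length, rep U, [], [], []])
      (stk [[], s, [], [], rep x.length, rep U, [], [], []]) (2 * enc x + 1) :=
    run_clear_stk rfl (by simp) rfl
  have r6 : Run (clear 4) (stk [[], s, [], [], rep x.length, rep U, [], [], []])
      (stk [[], s, [], [], [], rep U, [], [], []]) (2 * x.length + 1) :=
    run_clear_stk rfl (by simp) rfl
  have r7 : Run (clear 5) (stk [[], s, [], [], [], rep U, [], [], []])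
      (stk [[], s, [], [], [], [], [], [], []]) (2 * U + 1) :=
    run_clear_stk rfl (by simp) rfl
  refine (r1.seq (r2.seq (r3.seq (r4.seq (r5.seq (r6.seq r7)))))).mono (le_trans ?_ (hd B hB))
  have := Nat.mul_le_mul_right (B ^ c₄) hN
  omega

end Prog

/-! ### Bounds -/

theorem le_base_pow (X n : ℕ) : X ≤ base X ^ (n + 1) := by
  have h1 : X ≤ base X := by
    have := Nat.le_mul_self X
    rw [base, half]
    omega
  have h2 : 1 ≤ base X := by rw [base, half]; omega
  exact h1.trans (Nat.le_self_pow (by omega) _)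

theorem four_le_base_pow {X : ℕ} (hX : 0 < X) (n : ℕ) : 4 ≤ base X ^ (n + 1) := by
  have h1 : 4 ≤ base X := by
    have : 0 < X * X := Nat.mul_pos hX hX
    rw [base, half]
    omega
  exact h1.trans (Nat.le_self_pow (by omega) _)

theorem base_pow_le (l : List Bool) :
    base (enc l) ^ (l.length + 1) ≤ 2 ^ ((2 * l.length + 3) * (l.length + 1)) := by
  have h1 : enc l + 1 ≤ 2 ^ (l.length + 1) := enc_lt_two_pow l
  have h2 : base (enc l) ≤ 2 ^ (2 * l.length + 3) := by
    have h3 := Nat.mul_le_mul h1 h1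
    have h4 : 2 ^ (2 * l.length + 3) = 2 * (2 ^ (l.length + 1) * 2 ^ (l.length + 1)) := by ring
    rw [base, half, h4]
    nlinarith
  rw [pow_mul]
  exact Nat.pow_le_pow_left h2 _

theorem formSize_le {U : ℕ} (hU : 4 ≤ U) (n : ℕ) :
    3 * (formSize U n * U) ≤ U ^ (8 * (n + 1)) := by
  have h1 : 300 ≤ U ^ 5 := le_trans (by norm_num) (Nat.pow_le_pow_left hU 5)
  have h2 : 300 * U ^ 3 ≤ U ^ 8 := by
    rw [show U ^ 8 = U ^ 5 * U ^ 3 by ring]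
    exact Nat.mul_le_mul_right _ h1
  have h3 : (100 * U ^ 3) ^ n ≤ (U ^ 8) ^ n := Nat.pow_le_pow_left (by omega) n
  calc 3 * (formSize U n * U) = 300 * U ^ 3 * (100 * U ^ 3) ^ n := by rw [formSize]; ring
    _ ≤ U ^ 8 * (U ^ 8) ^ n := Nat.mul_le_mul h2 h3
    _ = U ^ (8 * (n + 1)) := by rw [pow_mul, pow_succ (U ^ 8), mul_comm (U ^ 8)]

/-- Feasibility also bounds values: one exponent serves for all transformers, because `X` and `U`
are arguments of `expand`. -/
theorem exists_expandBound : ∃ c, ∀ X U Q : ℕ, 2 ≤ Q → X ≤ Q → U ≤ Q → ∀ n ≤ Q,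
    ExpandBound X U Q (Q ^ c) ∧ orTok 5 n 0 0 U ≤ Q ^ c := by
  have h1 : Feasible fun v : Fin 8 → ℕ =>
    expand (v 0) (v 1) (v 2) (v 3) (v 4) (v 5) (v 6) (v 7) := by fun_prop
  have h2 : Feasible fun v : Fin 2 → ℕ => orTok 5 (v 0) 0 0 (v 1) := by fun_prop
  obtain ⟨c, hc⟩ := h1.bound
  obtain ⟨d, hd⟩ := h2.bound
  refine ⟨max c d, fun X U Q hQ hX hU n hn => ⟨?_, ?_⟩⟩
  · intro tag a b e f g k1 k2 k3 k4 k5 k6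
    refine (hc Q hQ ![X, U, tag, a, b, e, f, g] ?_).trans
      (Nat.pow_le_pow_right (by omega) (le_max_left _ _))
    simp only [Fin.forall_fin_succ]
    exact ⟨hX, hU, k1, k2, k3, k4, k5, k6, fun i => i.elim0⟩
  · refine (hd Q hQ ![n, U] ?_).trans (Nat.pow_le_pow_right (by omega) (le_max_right _ _))
    simp only [Fin.forall_fin_two]
    exact ⟨hn, hU⟩

/-- The clause on `M.tm.Γ` makes all stack alphabets finite, so that no single stack symbol can hold
unbounded data. -/
theorem mainTheorem2 :
    ∃ (M : Turing.TM2ComputableAux Bool Bool) (p : Polynomial ℕ),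
      (∀ κ, Finite (M.tm.Γ κ)) ∧
      ∀ (k : ℕ) (T : UHAT k), ∃ φ : LTL (Fin k),
        φ.language T.out = T.language ∧
        φ.size ≤ 2 ^ p.eval T.size ∧
        OutputsWithin M T.code φ.code (2 ^ p.eval T.size) := by
  obtain ⟨P, c, hP⟩ := Prog.exists_translate
  obtain ⟨d, hd⟩ := exists_expandBound
  -- The factors are the exponent of `2` in the bound for `U`, the exponent of `U` in `B`, and the
  -- exponent of `B` in the time bound. The last is `c + 1` rather than `c` so that it is positive
  -- and also covers the size of the formula.
  refine ⟨P.machine, (2 * .X + 3) * (.X + 1) * ((2 * .C d + 8) * (.X + 1)) * .C (c + 1),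
    fun κ => inferInstanceAs (Finite Bool), fun k T => ?_⟩
  have hp : Polynomial.eval T.size ((2 * .X + 3) * (.X + 1) * ((2 * .C d + 8) * (.X + 1)) *
      .C (c + 1)) =
      (2 * T.size + 3) * (T.size + 1) * ((2 * d + 8) * (T.size + 1)) * (c + 1) := by
    simp
  rw [hp]
  set n := T.size with hn
  set X := enc T.code with hX
  set U := base X ^ (n + 1) with hU
  -- Token arguments are at most `U * U`, the number of pairs, so tokens are at most `(U * U) ^ d`,
  -- while the formula has size at most `U ^ (8 * (n + 1))`. The exponent of `B` dominates both.
  set B := U ^ ((2 * d + 8) * (n + 1)) with hB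
  have hX0 : 0 < X := enc_pos _
  have hU4 : 4 ≤ U := four_le_base_pow hX0 n
  have hXU : X ≤ U := le_base_pow X n
  have hnX : n ≤ X := length_le_enc T.code
  have hUQ : U ≤ U * U := Nat.le_mul_self U
  have hQ : 16 ≤ U * U := Nat.mul_le_mul hU4 hU4
  have hUB : U ≤ B := Nat.le_self_pow (by positivity) _
  obtain ⟨hE, ho⟩ := hd X U (U * U) (by omega) (by omega) (by omega) n (by omega)
  have hQB : (U * U) ^ d ≤ B := by
    rw [← sq, ← pow_mul]
    refine Nat.pow_le_pow_right (by omega) ?_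
    nlinarith
  have hNB : 3 * (formSize U n * U) ≤ B := by
    refine (formSize_le hU4 n).trans (Nat.pow_le_pow_right (by omega) ?_)
    exact Nat.mul_le_mul_right _ (by omega)
  have hEB : ExpandBound X U (U * U) B := fun tag a b c d e h1 h2 h3 h4 h5 h6 =>
    (hE tag a b c d e h1 h2 h3 h4 h5 h6).trans hQB
  have hk : k ≤ U := by
    have := natVal_le X
    rw [hX, T.natVal_code] at this
    omega
  have hG := Gens.acceptForm hEB (by omega) le_rfl T.natVal_code hk (by omega) n (by omega)
    (ho.trans hQB)
  have hBp : B ^ (c + 1) ≤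
      2 ^ ((2 * n + 3) * (n + 1) * ((2 * d + 8) * (n + 1)) * (c + 1)) := by
    rw [pow_mul _ _ (c + 1), pow_mul _ ((2 * n + 3) * (n + 1))]
    exact Nat.pow_le_pow_left (Nat.pow_le_pow_left (base_pow_le T.code) _) _
  refine ⟨acceptForm X U k n, T.language_acceptForm, ?_, ?_⟩
  · calc (acceptForm X U k n).size ≤ B := hG.length_le.trans hNB
      _ ≤ B ^ (c + 1) := Nat.le_self_pow (by omega) _
      _ ≤ _ := hBp
  · obtain ⟨t, ht, he⟩ := hP T.code _ B U _ (by omega) hU (by omega) hUB hNB hG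
    refine Prog.outputsWithin_machine (ht.trans (le_trans ?_ hBp)) he
    exact Nat.pow_le_pow_right (by omega) (by omega)
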